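/- Let $d\ge 1$ and $0<\beta\le 1$, and write $\log$ for the logarithm to base $2$. **Thinning.** A $(1+\beta)$-thinning strategy is a sequence of measurable functions $f_n:([0,1)^d)^{n-1}\times[0,1)^d\to[0,1]$ such that, for every fixed value of the first $n-1$ entries, $f_n\ge 1-\beta$ almost everywhere. Given i.i.d. uniform points $X_1,X_2,\dots$ of $[0,1)^d$ and, independently of them, i.i.d. uniform $U_1,U_2,\dots$ in $[0,1]$, it produces the sequence $Z=(Z_n)$ defined inductively by $\chi_n=\mathbb 1\{U_n>f_n((Z_1,\dots,Z_{n-1}),X_{n+\sum_{i<n}\chi_i})\}$ and $Z_n=X_{n+\sum_{i\le n}\chi_i}$. **Haar strategy.** A one-dimensional Haar function of order $s\ge 0$ is the function $H$ on $[0,1)$ with value $1$ on $[2a2^{-s},(2a+1)2^{-s})$, $-1$ on $[(2a+1)2^{-s},(2a+2)2^{-s})$ and $0$ elsewhere, where $a\ge 0$ is an integer with $2a+1\le 2^s$. A Haar function on $[0,1)^d$ is a product $H(x)=\prod_{i=1}^d H_i(x_i)$ of one-dimensional ones, and its order is the sum of their orders. Let $\mathcal H_1^h$ be the set of the Haar functions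 on $[0,1)^d$ of order between $1$ and $h$, let $W(h)=\sum_{i=1}^h\binom{i+d-1}{d-1}$ and $h(n)=\lfloor\log n\rfloor$. With $\nu_{n-1}=\sum_{i<n}\delta_{Z_i}$ and $\langle\nu,H\rangle=\int H\,d\nu$, put $$\lambda_n(x)=1+\frac{\beta}{2W(h(n))}\sum_{H\in\mathcal H_1^{h(n)}}\operatorname{sgn}\langle\nu_{n-1},-H\rangle\,H(x)$$ ($\lambda_1=1$). The Haar strategy is $f_n((Z_1,\dots,Z_{n-1}),x)=\lambda_n(x)-\frac\beta2$. **Theorem.** The Haar strategy is a $(1+\beta)$-thinning strategy, and for every $n\ge 2$ and every $\Delta>0$ the sequence $Z$ that it produces satisfies $$\mathbb P\Big(\mathrm{Disc}(Z^n)\ge\beta^{-1}\log^{2d}(n)\,\big(\Delta+1000+100d^2\log n\big)\Big)\le\beta^{-2}e^{-\Delta/50},$$ where $\mathrm{Disc}(Z^n)=\sup_R\big||\{i\le n: Z_i\in R\}|-n|R|\big|$ over all boxes $R=\prod_{i=1}^d[a_i,b_i)$ with $0\le a_i<b_i\le1$. Moreover, there are an online algorithm and a constant $C$, both depending on $d$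 only, such that for all $n\ge2$ and all inputs the algorithm, given $\beta$ and being shown the candidates and the numbers $U_1,U_2,\dots$ one after the other, applies the Haar strategy to produce the first $n$ samples with at most $C\,n\log^d n$ computations and at most $C\,n\log^d n$ memory. Here the algorithm is a finite program for a random access machine with integer cells and real cells, in which each of the following costs one unit whatever the size of the numbers: addition, subtraction and multiplication of integers or of reals, comparison, conversion of an integer to a real, indirect addressing by integers, and receiving one real input. Memory is measured by the largest address that is used. -/

import Mathlib

open MeasureTheory ProbabilityTheory

/-! ### The cube, axis-parallel boxes and discrepancy -/

/-- Points of `ℝ^d`. -/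
abbrev Pt (d : ℕ) := Fin d → ℝ

/-- The half-open unit cube `[0,1)^d`. -/
def cube (d : ℕ) : Set (Pt d) := Set.univ.pi fun _ => Set.Ico 0 1

/-- The uniform distribution on `[0,1)^d`. -/
noncomputable def unifCube (d : ℕ) : Measure (Pt d) := volume.restrict (cube d)

/-- The axis-parallel box `∏ [a_i, b_i)`. -/
def box {d : ℕ} (a b : Pt d) : Set (Pt d) := Set.univ.pi fun i => Set.Ico (a i) (b i)

/-- The discrepancy of the first `n` terms `z 0, …, z (n-1)` of a sequence: the supremum over all boxes
`R = ∏ [a_i, b_i)` with `0 ≤ a_i < b_i ≤ 1` of `| #{i < n : z i ∈ R} - n |R| |`. -/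
noncomputable def disc {d : ℕ} (z : ℕ → Pt d) (n : ℕ) : ℝ :=
  sSup {r : ℝ | ∃ a b : Pt d, (∀ i, 0 ≤ a i ∧ a i < b i ∧ b i ≤ 1) ∧
    r = |(∑ i ∈ Finset.range n, (box a b).indicator (fun _ => (1 : ℝ)) (z i))
          - n * volume.real (box a b)|}

/-! ### Thinning strategies and the sequences they produce

All sequences are indexed from `0`: the entry with index `n` is the `(n+1)`-st one. -/

/-- The data of a thinning strategy: `f n z x` is the probability of keeping the candidate `x` for the sample
of index `n`, when the earlier samples are `z 0, …, z (n-1)`. -/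
abbrev Strategy (d : ℕ) := (n : ℕ) → (Fin n → Pt d) → Pt d → ℝ

/-- `f` is a `(1+β)`-thinning strategy: each `f n` is measurable, takes values in `[0,1]` on the cube, and
for every fixed past it is almost everywhere at least `1 - β`. -/
def IsThinningStrategy {d : ℕ} (β : ℝ) (f : Strategy d) : Prop :=
  ∀ n, Measurable (fun p : (Fin n → Pt d) × Pt d => f n p.1 p.2) ∧
    ∀ z : Fin n → Pt d, (∀ i, z i ∈ cube d) →
      (∀ x ∈ cube d, f n z x ∈ Set.Icc (0 : ℝ) 1) ∧ ∀ᵐ x ∂(unifCube d), 1 - β ≤ f n z x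

/-- Outcome of the test `u > f_n(z, x)`: `1` means that the candidate `x` is rejected, `0` that it is kept. -/
noncomputable def rejectBit {d : ℕ} (f : Strategy d) (n : ℕ) (z : Fin n → Pt d) (x : Pt d) (u : ℝ) : ℕ :=
  if f n z x < u then 1 else 0

/-- The first `n` samples that the strategy `f` produces from the candidates `X` and the external
randomness `U`, together with the number of candidates rejected so far. If `k` candidates have been rejected
while the first `n` samples were produced, the next candidate is `X (n + k)`; it is kept, or else it is
rejected and the candidate that follows it is taken. -/
noncomputable def thinned {d : ℕ} (f : Strategy d) (X : ℕ → Pt d) (U : ℕ → ℝ) :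
    (n : ℕ) → (Fin n → Pt d) × ℕ
  | 0 => (Fin.elim0, 0)
  | n + 1 =>
    let z := (thinned f X U n).1
    let k := (thinned f X U n).2
    let r := rejectBit f n z (X (n + k)) (U n)
    (Fin.snoc z (X (n + k + r)), k + r)

/-- The number of candidates rejected while the first `n` samples are produced. -/
noncomputable def rejections {d : ℕ} (f : Strategy d) (X : ℕ → Pt d) (U : ℕ → ℝ) (n : ℕ) : ℕ :=
  (thinned f X U n).2

/-- The candidate that is presented for the sample of index `n`. -/
noncomputable def candidate {d : ℕ} (f : Strategy d) (X : ℕ → Pt d) (U : ℕ → ℝ) (n : ℕ) : Pt d :=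
  X (n + rejections f X U n)

/-- The decision (`1`: reject, `0`: keep) on the candidate for the sample of index `n`. -/
noncomputable def decision {d : ℕ} (f : Strategy d) (X : ℕ → Pt d) (U : ℕ → ℝ) (n : ℕ) : ℕ :=
  rejectBit f n (thinned f X U n).1 (candidate f X U n) (U n)

/-- The output sequence `Z` of the strategy `f`. -/
noncomputable def sample {d : ℕ} (f : Strategy d) (X : ℕ → Pt d) (U : ℕ → ℝ) (n : ℕ) : Pt d :=
  X (n + rejections f X U (n + 1))

/-! ### Haar functions and the Haar strategy -/

/-- The one-dimensional Haar function of order `s` attached to the dyadic interval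
`I = [2a/2^s, (2a+2)/2^s)`: it is `1` on the left half of `I`, `-1` on the right half, `0` elsewhere.
For `s = a = 0` it is the constant `1` on `[0,1)`. -/
noncomputable def haarOne (s a : ℕ) (x : ℝ) : ℤ :=
  if (2 * a : ℝ) / 2 ^ s ≤ x ∧ x < (2 * a + 1 : ℝ) / 2 ^ s then 1
  else if (2 * a + 1 : ℝ) / 2 ^ s ≤ x ∧ x < (2 * a + 2 : ℝ) / 2 ^ s then -1
  else 0

/-- The `d`-dimensional Haar function of order `∑ s_i`, a product of one-dimensional ones. -/
noncomputable def haar {d : ℕ} (s a : Fin d → ℕ) (x : Pt d) : ℤ :=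
  ∏ i, haarOne (s i) (a i) (x i)

/-- The (indices of the) Haar functions on `[0,1)^d` of order between `h₀` and `h₁`. The condition
`2 a_i + 1 ≤ 2 ^ s_i` says that the left half of the `i`-th dyadic interval lies in `[0,1)`. -/
def haarIndex (d h₀ h₁ : ℕ) : Finset ((Fin d → ℕ) × (Fin d → ℕ)) :=
  ((Fintype.piFinset fun _ => Finset.range (h₁ + 1)) ×ˢ
    (Fintype.piFinset fun _ => Finset.range (2 ^ h₁))).filter fun p =>
      (∀ i, 2 * p.2 i + 1 ≤ 2 ^ p.1 i) ∧ h₀ ≤ ∑ i, p.1 i ∧ ∑ i, p.1 i ≤ h₁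

/-- `W(h) = ∑_{i=1}^h C(i+d-1, d-1)`. -/
def haarWeight (d h : ℕ) : ℕ := ∑ i ∈ Finset.Icc 1 h, (i + d - 1).choose (d - 1)

/-- The pairing `⟨ν, H⟩ = ∑_j H(z_j)` of a Haar function with the counting measure `ν` of the points `z`. -/
noncomputable def haarPairing {d k : ℕ} (z : Fin k → Pt d) (s a : Fin d → ℕ) : ℤ :=
  ∑ j, haar s a (z j)

/-- The conditional density at time `m`, with `h = ⌊log₂ m⌋`:
`λ_m(ν)(x) = 1 + β / (2 W(h)) * ∑_{H of order 1, …, h} sgn⟨ν, -H⟩ H(x)`, where `ν` is the counting measure of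
the points `z`. (For `m = 1` there is no such `H`, and the density is the constant `1`.) -/
noncomputable def haarDensity {d : ℕ} (β : ℝ) (m : ℕ) {k : ℕ} (z : Fin k → Pt d) (x : Pt d) : ℝ :=
  1 + β / (2 * (haarWeight d (Nat.log 2 m) : ℝ)) *
    ((∑ p ∈ haarIndex d 1 (Nat.log 2 m), (-haarPairing z p.1 p.2).sign * haar p.1 p.2 x : ℤ) : ℝ)

/-- The Haar `(1+β)`-thinning strategy: it keeps a candidate `x` for the sample number `n + 1`
with probability `λ_{n+1}(ν_n)(x) - β/2`. -/
noncomputable def haarStrategy (d : ℕ) (β : ℝ) : Strategy d :=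
  fun n z x => haarDensity β (n + 1) z x - β / 2

/-! ### A random access machine with integer and real cells

Programs are finite. The memory consists of integer cells and of real cells; only integers
can be used as addresses. Every instruction and every test costs one time unit, independently of the size of
the numbers involved. The instructions are: constants, copies through indirect addressing, the ring operations
on integers and on reals, and the conversion of an integer into a real number; there is no rounding,
no division and no conversion of reals into integers. -/

/-- The contents of the integer cells `W` and of the real cells `R`. -/
structure Mem where
  W : ℕ → ℤ
  R : ℕ → ℝ

/-- Elementary instructions. -/
inductive Instr where
  /-- `W[a] := c` -/
  | const (a : ℕ) (c : ℤ)
  /-- `W[a] := W[b] + W[c]` -/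
  | iadd (a b c : ℕ)
  /-- `W[a] := W[b] - W[c]` -/
  | isub (a b c : ℕ)
  /-- `W[a] := W[b] * W[c]` -/
  | imul (a b c : ℕ)
  /-- `W[a] := W[W[b]]` -/
  | iload (a b : ℕ)
  /-- `W[W[a]] := W[b]` -/
  | istore (a b : ℕ)
  /-- `R[a] := W[b]` -/
  | cast (a b : ℕ)
  /-- `R[a] := R[b] + R[c]` -/
  | radd (a b c : ℕ)
  /-- `R[a] := R[b] - R[c]` -/
  | rsub (a b c : ℕ)
  /-- `R[a] := R[b] * R[c]` -/
  | rmul (a b c : ℕ)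
  /-- `R[a] := R[W[b]]` -/
  | rload (a b : ℕ)
  /-- `R[W[a]] := R[b]` -/
  | rstore (a b : ℕ)

/-- The instruction can be executed and touches only cells whose address is less than `S`; in
particular an integer that is used as an address has to be non-negative. -/
def Instr.Valid (S : ℕ) (σ : Mem) : Instr → Prop
  | .const a _ => a < S
  | .iadd a b c | .isub a b c | .imul a b c => a < S ∧ b < S ∧ c < S
  | .iload a b => a < S ∧ b < S ∧ 0 ≤ σ.W b ∧ σ.W b < S
  | .istore a b => a < S ∧ b < S ∧ 0 ≤ σ.W a ∧ σ.W a < S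
  | .cast a b => a < S ∧ b < S
  | .radd a b c | .rsub a b c | .rmul a b c => a < S ∧ b < S ∧ c < S
  | .rload a b => a < S ∧ b < S ∧ 0 ≤ σ.W b ∧ σ.W b < S
  | .rstore a b => a < S ∧ b < S ∧ 0 ≤ σ.W a ∧ σ.W a < S

/-- The effect of an instruction on the memory. -/
noncomputable def Instr.run (σ : Mem) : Instr → Mem
  | .const a c => ⟨Function.update σ.W a c, σ.R⟩
  | .iadd a b c => ⟨Function.update σ.W a (σ.W b + σ.W c), σ.R⟩
  | .isub a b c => ⟨Function.update σ.W a (σ.W b - σ.W c), σ.R⟩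
  | .imul a b c => ⟨Function.update σ.W a (σ.W b * σ.W c), σ.R⟩
  | .iload a b => ⟨Function.update σ.W a (σ.W (σ.W b).toNat), σ.R⟩
  | .istore a b => ⟨Function.update σ.W (σ.W a).toNat (σ.W b), σ.R⟩
  | .cast a b => ⟨σ.W, Function.update σ.R a (σ.W b : ℝ)⟩
  | .radd a b c => ⟨σ.W, Function.update σ.R a (σ.R b + σ.R c)⟩
  | .rsub a b c => ⟨σ.W, Function.update σ.R a (σ.R b - σ.R c)⟩
  | .rmul a b c => ⟨σ.W, Function.update σ.R a (σ.R b * σ.R c)⟩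
  | .rload a b => ⟨σ.W, Function.update σ.R a (σ.R (σ.W b).toNat)⟩
  | .rstore a b => ⟨σ.W, Function.update σ.R (σ.W a).toNat (σ.R b)⟩

/-- Tests: comparison of two integer cells, or of two real cells. -/
inductive Test where
  /-- `W[a] ≤ W[b]` -/
  | ile (a b : ℕ)
  /-- `R[a] ≤ R[b]` -/
  | rle (a b : ℕ)

/-- The test succeeds. -/
def Test.Holds (σ : Mem) : Test → Prop
  | .ile a b => σ.W a ≤ σ.W b
  | .rle a b => σ.R a ≤ σ.R b

/-- The test looks only at cells whose address is less than `S`. -/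
def Test.Valid (S : ℕ) : Test → Prop
  | .ile a b | .rle a b => a < S ∧ b < S

/-- Programs. -/
inductive Prog where
  | skip
  | instr (i : Instr)
  | seq (p q : Prog)
  | ite (b : Test) (p q : Prog)
  | while (b : Test) (p : Prog)

/-- `Exec S p σ τ t`: started with memory `σ`, the program `p` halts with memory `τ` after `t`
time units, and it touches only integer and real cells whose address is less than `S`. -/
inductive Exec (S : ℕ) : Prog → Mem → Mem → ℕ → Prop where
  | skip (σ : Mem) : Exec S .skip σ σ 0
  | instr (i : Instr) (σ : Mem) : i.Valid S σ → Exec S (.instr i) σ (i.run σ) 1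
  | seq {p q : Prog} {σ τ ρ : Mem} {t u : ℕ} :
      Exec S p σ τ t → Exec S q τ ρ u → Exec S (.seq p q) σ ρ (t + u)
  | ite_true {b : Test} {p q : Prog} {σ τ : Mem} {t : ℕ} :
      b.Valid S → b.Holds σ → Exec S p σ τ t → Exec S (.ite b p q) σ τ (t + 1)
  | ite_false {b : Test} {p q : Prog} {σ τ : Mem} {t : ℕ} :
      b.Valid S → ¬ b.Holds σ → Exec S q σ τ t → Exec S (.ite b p q) σ τ (t + 1)
  | while_true {b : Test} {p : Prog} {σ τ ρ : Mem} {t u : ℕ} :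
      b.Valid S → b.Holds σ → Exec S p σ τ t → Exec S (.while b p) τ ρ u →
      Exec S (.while b p) σ ρ (t + u + 1)
  | while_false {b : Test} {p : Prog} {σ : Mem} :
      b.Valid S → ¬ b.Holds σ → Exec S (.while b p) σ σ 1

/-- An overseer's online algorithm: `init` is executed once, before the first point is shown. In every round
`decide` is executed when a candidate has been shown, and `record` when the new sample is determined. -/
structure OnlineAlg where
  init : Prog
  decide : Prog
  record : Prog

/-- The initial memory: the parameter `β` is in the real cell `0`, all other cells are `0`. -/
def Mem.start (β : ℝ) : Mem := ⟨fun _ => 0, fun a => if a = 0 then β else 0⟩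

/-- Writing the coordinates of a point into the real cells `1, …, d`. -/
def Mem.showPoint {d : ℕ} (σ : Mem) (x : Pt d) : Mem :=
  ⟨σ.W, fun a => if h : 0 < a ∧ a - 1 < d then x ⟨a - 1, h.2⟩ else σ.R a⟩

/-- Writing a number into the real cell `d + 1`. -/
def Mem.showRandom (σ : Mem) (d : ℕ) (u : ℝ) : Mem := ⟨σ.W, Function.update σ.R (d + 1) u⟩

/-- `Applies A f β S X U n σ t`: on the candidates `X` and the external randomness `U`, the online algorithm
`A` applies the strategy `f` to produce the first `n` samples, within `t` time units and touching only
cells whose address is less than `S`; it ends with memory `σ`. In each round the candidate (in the real cells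
`1, …, d`) and the number `U n` (in the real cell `d + 1`) are shown to the algorithm, `decide` has to leave
the decision of the strategy in the integer cell `0` (`1`: reject, `0`: keep), and then the resulting sample
(the same candidate if it was kept, the one following it otherwise) is put into the real cells `1, …, d` for
`record`. Each real number that is shown costs one time unit. -/
inductive Applies {d : ℕ} (A : OnlineAlg) (f : Strategy d) (β : ℝ) (S : ℕ) (X : ℕ → Pt d) (U : ℕ → ℝ) :
    ℕ → Mem → ℕ → Prop where
  | init {σ : Mem} {t : ℕ} : d + 1 < S → Exec S A.init (Mem.start β) σ t → Applies A f β S X U 0 σ t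
  | round {n : ℕ} {σ τ ρ : Mem} {t t₁ t₂ : ℕ} :
      Applies A f β S X U n σ t →
      Exec S A.decide ((σ.showPoint (candidate f X U n)).showRandom d (U n)) τ t₁ →
      τ.W 0 = (decision f X U n : ℤ) →
      Exec S A.record (τ.showPoint (sample f X U n)) ρ t₂ →
      Applies A f β S X U (n + 1) ρ (t + (d + 1 + t₁) + (d + t₂))

/-! Probability. A rejected candidate is replaced by a fresh uniform point that is kept
unconditionally, so given the past the next sample has density `f_n + ∫ (1 - f_n)`
(`lintegral_sample`). For the Haar strategy the rejection probability is exactly `β/2`, and the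
density is `λ_n` itself. Since Haar functions are orthogonal, `λ_n` moves the pairing `M = ⟨ν, H⟩`
of each `H` of order between `1` and `h(n)` towards `0`: the expected increment is `-sgn(M) β |H| /
(2W)`, where `|H|` is the volume of the support. The quantity to follow is `E cosh(θM)` with `3Wθ ≤
β`. This choice makes the second-order term of one step at most half of the drift term, so that a
step acts on the moment like `m ↦ (1 - B/2) m + B`, whose fixed point is `2`. As long as the drift
on `H` has not started, fewer than `2 ^ order` samples have been drawn; the moment then grows only
through the second-order term and stays below `2` as well (`growth_before_drift`). Hence `E cosh(θM)
≤ 2` at all times (`coshMoment_le_two`), so `M` has an exponential tail on the scale `W/β`, and a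
union bound over at most `n ^ (2d)` Haar functions bounds all pairings by a common `t`.

Geometry. The indicator of a dyadic interval is a combination of Haar functions whose coefficients
have total absolute value at most `1`. Multiplying over the coordinates, the counting error of a
dyadic box of order at most `h` is at most `t` (`abs_countErr_dyadic_le`). An arbitrary box is cut,
one side after the other, along the binary digits of its endpoints. This produces dyadic boxes and
remainders, each remainder lying in a dyadic box of volume `2 ^ (-h)`, where at most two points are
expected. Counting the pieces gives discrepancy at most `2^d C(h+1+d, d) (t+2)` (`disc_le`). As `t`
is proportional to `W = C(h+d, d) - 1`, two powers `log^d n` meet and produce `log^{2d} n`.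

Algorithm. A point lies in the support of exactly one Haar function for each order vector. So the
density can be evaluated, and the pairings updated, by `d` nested loops with at most `(h+1)^d`
leaves (`halts_levels`). The pairings are kept in a table whose address combines a base `h+1` code
of the order vector with the concatenated binary positions; the latter stay below `2^h` because the
orders add up to at most `h`, and the table has size of order `h^d 2^h`. Since `n` is not known in
advance, the table is built anew from the stored points whenever `h` grows. The rebuilds occur when
the number of the round reaches a power of two, so their cost is amortised (`two_pow_log_succ_add`).
-/

/-! ### Haar functions and binary digits -/

/-- The index of the dyadic interval of length `2⁻ˢ` that contains `x`. -/
noncomputable def dyadic (s : ℕ) (x : ℝ) : ℕ := ⌊x * 2 ^ s⌋₊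

lemma dyadic_eq_iff {s k : ℕ} {x : ℝ} (hx : 0 ≤ x) :
    dyadic s x = k ↔ (k : ℝ) / 2 ^ s ≤ x ∧ x < (k + 1 : ℝ) / 2 ^ s := by
  have h2 : (0 : ℝ) < 2 ^ s := by positivity
  rw [dyadic, Nat.floor_eq_iff (by positivity), div_le_iff₀ h2, lt_div_iff₀ h2]

lemma dyadic_succ_div_two (s : ℕ) (x : ℝ) : dyadic (s + 1) x / 2 = dyadic s x := by
  rw [dyadic, dyadic, ← Nat.floor_div_natCast]
  congr 1
  rw [pow_succ]
  push_cast
  ring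

lemma dyadic_zero {x : ℝ} (hx : x ∈ Set.Ico (0 : ℝ) 1) : dyadic 0 x = 0 := by
  rw [dyadic_eq_iff hx.1]
  simpa using hx

lemma dyadic_lt (s : ℕ) {x : ℝ} (hx : x ∈ Set.Ico (0 : ℝ) 1) : dyadic s x < 2 ^ s := by
  have h2 : (0 : ℝ) < 2 ^ s := by positivity
  rw [dyadic, Nat.floor_lt (mul_nonneg hx.1 h2.le)]
  push_cast
  nlinarith [hx.2]

/-- The first `s` binary digits of `x` tell everything: all but the last select the supporting
interval, and the last one, that is the parity of `dyadic s x`, selects its half. For `s = 0` there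
is no digit, and the value is `1`. -/
lemma haarOne_eq (s a : ℕ) {x : ℝ} (hx : 0 ≤ x) :
    haarOne s a x = if a = dyadic s x / 2 then (-1) ^ dyadic s x else 0 := by
  have h1 := dyadic_eq_iff (s := s) (k := 2 * a) hx
  have h2 := dyadic_eq_iff (s := s) (k := 2 * a + 1) hx
  push_cast at h1 h2
  rw [add_assoc, one_add_one_eq_two] at h2
  simp only [haarOne, ← h1, ← h2]
  split_ifs with h3 h4 h5 h6 h7
  · rw [h3, pow_mul]; simp
  · omega
  · rw [h5, pow_succ, pow_mul]; simp
  · omega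
  · omega
  · rfl

lemma two_mul_dyadic_div_two_lt (s : ℕ) {x : ℝ} (hx : x ∈ Set.Ico (0 : ℝ) 1) :
    2 * (dyadic s x / 2) + 1 ≤ 2 ^ s := by
  have h := dyadic_lt s hx
  rcases s with _ | s
  · simp at h; simp [h]
  · rw [pow_succ] at h ⊢; omega

variable {d : ℕ}

/-- The position of the only Haar function with orders `s` that does not vanish at `x`. -/
noncomputable def haarPos (s : Fin d → ℕ) (x : Pt d) : Fin d → ℕ := fun i => dyadic (s i) (x i) / 2

/-- The value at `x` of the only Haar function with orders `s` that does not vanish at `x`. -/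
noncomputable def haarSgn (s : Fin d → ℕ) (x : Pt d) : ℤ := ∏ i, (-1) ^ dyadic (s i) (x i)

lemma mem_cube {x : Pt d} : x ∈ cube d ↔ ∀ i, x i ∈ Set.Ico (0 : ℝ) 1 := by
  simp [cube]

lemma haar_eq (s a : Fin d → ℕ) {x : Pt d} (hx : x ∈ cube d) :
    haar s a x = if a = haarPos s x then haarSgn s x else 0 := by
  rw [mem_cube] at hx
  have : ∀ i, haarOne (s i) (a i) (x i) =
      if a i = dyadic (s i) (x i) / 2 then (-1) ^ dyadic (s i) (x i) else 0 :=
    fun i => haarOne_eq _ _ (hx i).1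
  simp only [haar, this]
  split_ifs with h
  · refine Finset.prod_congr rfl fun i _ => ?_
    rw [if_pos (by rw [h]; rfl)]
  · obtain ⟨i, hi⟩ := Function.ne_iff.1 h
    exact Finset.prod_eq_zero (Finset.mem_univ i) (if_neg hi)

lemma haarSgn_eq_or (s : Fin d → ℕ) (x : Pt d) : haarSgn s x = 1 ∨ haarSgn s x = -1 := by
  rw [haarSgn, Finset.prod_pow_eq_pow_sum]
  exact neg_one_pow_eq_or _ _

lemma abs_haarOne_le (s a : ℕ) (x : ℝ) : |haarOne s a x| ≤ 1 := by
  rw [haarOne]; split_ifs <;> simp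

lemma haar_cases (s a : Fin d → ℕ) (x : Pt d) : haar s a x = 0 ∨ haar s a x = 1 ∨ haar s a x = -1 := by
  have h : |haar s a x| ≤ 1 := by
    rw [haar, Finset.abs_prod]
    exact Finset.prod_le_one (fun i _ => abs_nonneg _) fun i _ => abs_haarOne_le _ _ _
  rw [abs_le] at h
  omega

/-! ### Order vectors -/

/-- The order vectors of the Haar functions of order between `h₀` and `h₁`. -/
def orderVectors (d h₀ h₁ : ℕ) : Finset (Fin d → ℕ) :=
  (Fintype.piFinset fun _ => Finset.range (h₁ + 1)).filter fun s => h₀ ≤ ∑ i, s i ∧ ∑ i, s i ≤ h₁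

lemma mem_orderVectors {h₀ h₁ : ℕ} {s : Fin d → ℕ} :
    s ∈ orderVectors d h₀ h₁ ↔ h₀ ≤ ∑ i, s i ∧ ∑ i, s i ≤ h₁ := by
  simp only [orderVectors, Finset.mem_filter, Fintype.mem_piFinset, Finset.mem_range,
    and_iff_right_iff_imp]
  intro h i
  have := Finset.single_le_sum (f := s) (fun j _ => Nat.zero_le _) (Finset.mem_univ i)
  omega

lemma mem_haarIndex {h₀ h₁ : ℕ} {p : (Fin d → ℕ) × (Fin d → ℕ)} :
    p ∈ haarIndex d h₀ h₁ ↔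
      (∀ i, 2 * p.2 i + 1 ≤ 2 ^ p.1 i) ∧ h₀ ≤ ∑ i, p.1 i ∧ ∑ i, p.1 i ≤ h₁ := by
  simp only [haarIndex, Finset.mem_filter, Finset.mem_product, Fintype.mem_piFinset,
    Finset.mem_range, and_iff_right_iff_imp]
  intro h
  have hs : ∀ i, p.1 i ≤ h₁ := fun i =>
    (Finset.single_le_sum (f := p.1) (fun j _ => Nat.zero_le _) (Finset.mem_univ i)).trans h.2.2
  refine ⟨fun i => Nat.lt_succ_of_le (hs i), fun i => ?_⟩
  have h1 := h.1 i
  have h2 := Nat.pow_le_pow_right (n := 2) (by norm_num) (hs i)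
  omega

/-- Haar functions with the same orders have disjoint supports, which cover the cube. So at a given
point the exponentially long sum over Haar functions has one surviving term for each order vector.
Both the bound on the density and the fast algorithm rest on this. -/
lemma sum_haarIndex (h₀ h₁ : ℕ) {x : Pt d} (hx : x ∈ cube d) (g : (Fin d → ℕ) → (Fin d → ℕ) → ℤ) :
    ∑ p ∈ haarIndex d h₀ h₁, g p.1 p.2 * haar p.1 p.2 x =
      ∑ s ∈ orderVectors d h₀ h₁, g s (haarPos s x) * haarSgn s x := by
  symm
  rw [← Finset.sum_filter_of_ne (s := haarIndex d h₀ h₁) (p := fun p => p.2 = haarPos p.1 x)]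
  · refine Finset.sum_bij (fun s _ => (s, haarPos s x)) ?_ ?_ ?_ ?_
    · intro s hs
      simp only [Finset.mem_filter, mem_haarIndex, and_true]
      exact ⟨fun i => two_mul_dyadic_div_two_lt _ (mem_cube.1 hx i), mem_orderVectors.1 hs⟩
    · intro s _ t _ h
      exact congrArg Prod.fst h
    · rintro ⟨s, a⟩ hp
      simp only [Finset.mem_filter, mem_haarIndex] at hp
      exact ⟨s, mem_orderVectors.2 hp.1.2, by rw [← hp.2]⟩
    · intro s _
      rw [haar_eq _ _ hx, if_pos rfl]
  · intro p _ hp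
    by_contra h
    rw [haar_eq _ _ hx, if_neg h] at hp
    simp at hp

lemma card_sum_eq (d i : ℕ) (hd : 1 ≤ d) :
    (Finset.piAntidiag (Finset.univ : Finset (Fin d)) i).card = (i + d - 1).choose (d - 1) := by
  have h := Finset.card_finsuppAntidiag_nat_eq_choose (s := (Finset.univ : Finset (Fin d))) i
  rw [Finset.finsuppAntidiag, Finset.card_map, Finset.card_attach] at h
  rw [h, Finset.card_univ, Fintype.card_fin, add_comm d i]
  apply Nat.choose_symm_of_eq_add
  omega

lemma card_orderVectors (d h : ℕ) (hd : 1 ≤ d) : (orderVectors d 1 h).card = haarWeight d h := by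
  rw [haarWeight, Finset.sum_congr rfl fun i _ => (card_sum_eq d i hd).symm,
    ← Finset.card_biUnion]
  · congr 1
    ext s
    simp [mem_orderVectors]
  · intro i _ j _ hij
    refine Finset.disjoint_left.2 fun s hs ht => ?_
    simp only [Finset.mem_piAntidiag] at hs ht
    exact hij (hs.1.symm.trans ht.1)

/-- The hockey-stick identity; the added `1` stands for the order vector `0`. -/
lemma haarWeight_add_one (d h : ℕ) (hd : 1 ≤ d) : haarWeight d h + 1 = (h + d).choose d := by
  obtain ⟨e, rfl⟩ : ∃ e, d = e + 1 := ⟨d - 1, by omega⟩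
  induction h with
  | zero => simp [haarWeight]
  | succ h ih =>
    rw [haarWeight, Finset.sum_Icc_succ_top (by omega)]
    rw [haarWeight] at ih
    have h1 : h + 1 + (e + 1) = (h + (e + 1)) + 1 := by ring
    rw [h1, Nat.choose_succ_succ, ← ih]
    have h2 : h + 1 + (e + 1) - 1 = h + (e + 1) := by omega
    simp only [Nat.add_sub_cancel]
    ring

lemma haarWeight_mono (d : ℕ) : Monotone (haarWeight d) := fun _ _ h =>
  Finset.sum_le_sum_of_subset (Finset.Icc_subset_Icc le_rfl h)

lemma haarWeight_pos (d : ℕ) {h : ℕ} (hh : 1 ≤ h) : 0 < haarWeight d h := by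
  apply Finset.sum_pos
  · intro i hi
    exact Nat.choose_pos (by have := (Finset.mem_Icc.1 hi).1; omega)
  · exact ⟨1, by simp [hh]⟩

/-! ### Integrals of Haar functions and the Haar density -/

lemma unifCube_eq_pi : unifCube d = Measure.pi fun _ => volume.restrict (Set.Ico (0 : ℝ) 1) := by
  rw [unifCube, cube, volume_pi, Measure.restrict_pi_pi]

instance : IsProbabilityMeasure (volume.restrict (Set.Ico (0 : ℝ) 1)) := ⟨by simp⟩

instance : IsProbabilityMeasure (unifCube d) := by
  rw [unifCube_eq_pi]; infer_instance

lemma measurableSet_cube : MeasurableSet (cube d) :=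
  MeasurableSet.univ_pi fun _ => measurableSet_Ico

lemma ae_mem_cube : ∀ᵐ x ∂(unifCube d), x ∈ cube d := ae_restrict_mem measurableSet_cube

@[fun_prop]
lemma measurable_haarOne (s a : ℕ) : Measurable (haarOne s a) := by
  refine Measurable.ite ?_ measurable_const (Measurable.ite ?_ measurable_const measurable_const)
  · exact measurableSet_Ico
  · exact measurableSet_Ico

@[fun_prop]
lemma measurable_haar (s a : Fin d → ℕ) : Measurable (haar s a) := by
  unfold haar
  fun_prop

lemma dyadic_add_div_two_pow (s j : ℕ) (x : ℝ) : dyadic (s + j) x / 2 ^ j = dyadic s x := by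
  induction j with
  | zero => simp
  | succ j ih => rw [← add_assoc, pow_succ', ← Nat.div_div_eq_div_mul, dyadic_succ_div_two, ih]

/-- The length of the support of a one-dimensional Haar function of order `s`. -/
noncomputable def haarLen (s : ℕ) : ℝ := if s = 0 then 1 else 2 / 2 ^ s

lemma haarOne_eq_indicator (s a : ℕ) (x : ℝ) : (haarOne s a x : ℝ) =
    (Set.Ico ((2 * a : ℝ) / 2 ^ s) ((2 * a + 1 : ℝ) / 2 ^ s)).indicator (fun _ => 1) x -
    (Set.Ico ((2 * a + 1 : ℝ) / 2 ^ s) ((2 * a + 2 : ℝ) / 2 ^ s)).indicator (fun _ => 1) x := by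
  simp only [haarOne, Set.indicator_apply, Set.mem_Ico]
  split_ifs with h1 h2 <;> first | (exfalso; linarith [h1.2, h2.1]) | simp

lemma haarOne_sq_eq_indicator (s a : ℕ) (x : ℝ) : (haarOne s a x : ℝ) * haarOne s a x =
    (Set.Ico ((2 * a : ℝ) / 2 ^ s) ((2 * a + 1 : ℝ) / 2 ^ s)).indicator (fun _ => 1) x +
    (Set.Ico ((2 * a + 1 : ℝ) / 2 ^ s) ((2 * a + 2 : ℝ) / 2 ^ s)).indicator (fun _ => 1) x := by
  simp only [haarOne, Set.indicator_apply, Set.mem_Ico]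
  split_ifs with h1 h2 <;> first | (exfalso; linarith [h1.2, h2.1]) | simp

lemma integral_indicator_Ico {a b : ℝ} (ha : 0 ≤ a) (hab : a ≤ b) (hb : b ≤ 1) :
    ∫ x in Set.Ico (0 : ℝ) 1, (Set.Ico a b).indicator (fun _ => (1 : ℝ)) x = b - a := by
  rw [integral_indicator_const _ measurableSet_Ico]
  rw [measureReal_restrict_apply measurableSet_Ico,
    Set.inter_eq_left.2 (Set.Ico_subset_Ico ha hb)]
  simp [hab]

lemma integrable_indicator_Ico (a b : ℝ) :
    Integrable (fun x => (Set.Ico a b).indicator (fun _ => (1 : ℝ)) x)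
      (volume.restrict (Set.Ico (0 : ℝ) 1)) :=
  (integrable_const 1).indicator measurableSet_Ico

lemma haar_interval_bounds {s a : ℕ} (ha : 2 * a + 1 ≤ 2 ^ (s + 1)) :
    (0 : ℝ) ≤ (2 * a : ℝ) / 2 ^ (s + 1) ∧
    (2 * a : ℝ) / 2 ^ (s + 1) ≤ (2 * a + 1 : ℝ) / 2 ^ (s + 1) ∧
    (2 * a + 1 : ℝ) / 2 ^ (s + 1) ≤ (2 * a + 2 : ℝ) / 2 ^ (s + 1) ∧
    (2 * a + 2 : ℝ) / 2 ^ (s + 1) ≤ 1 := by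
  refine ⟨by positivity, by gcongr; linarith, by gcongr; linarith, ?_⟩
  rw [div_le_one (by positivity)]
  have : 2 * a + 2 ≤ 2 ^ (s + 1) := by rw [pow_succ] at ha ⊢; omega
  exact_mod_cast this

lemma integral_haarOne {s a : ℕ} (ha : 2 * a + 1 ≤ 2 ^ (s + 1)) :
    ∫ x in Set.Ico (0 : ℝ) 1, (haarOne (s + 1) a x : ℝ) = 0 := by
  obtain ⟨h1, h2, h3, h4⟩ := haar_interval_bounds ha
  simp only [haarOne_eq_indicator]
  rw [integral_sub (integrable_indicator_Ico _ _) (integrable_indicator_Ico _ _),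
    integral_indicator_Ico h1 h2 (h3.trans h4), integral_indicator_Ico (h1.trans h2) h3 h4]
  ring

lemma integral_haarOne_sq {s a : ℕ} (ha : 2 * a + 1 ≤ 2 ^ s) :
    ∫ x in Set.Ico (0 : ℝ) 1, (haarOne s a x : ℝ) * haarOne s a x = haarLen s := by
  rcases s with _ | s
  · obtain rfl : a = 0 := by simpa using ha
    rw [setIntegral_congr_fun (g := fun _ => (1 : ℝ)) measurableSet_Ico]
    · simp [haarLen]
    · intro x hx
      simp [haarOne, hx.1, hx.2]
  obtain ⟨h1, h2, h3, h4⟩ := haar_interval_bounds ha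
  simp only [haarOne_sq_eq_indicator]
  rw [integral_add (integrable_indicator_Ico _ _) (integrable_indicator_Ico _ _),
    integral_indicator_Ico h1 h2 (h3.trans h4), integral_indicator_Ico (h1.trans h2) h3 h4]
  simp only [haarLen, Nat.add_eq_zero_iff, one_ne_zero, and_false, if_false]
  ring

/-- The coarser function is constant on the support of the finer one, and the finer one has mean
zero. -/
lemma integral_haarOne_mul_of_lt {s s' a a' : ℕ} (ha : 2 * a' + 1 ≤ 2 ^ s') (hs : s < s') :
    ∫ x in Set.Ico (0 : ℝ) 1, (haarOne s a x : ℝ) * haarOne s' a' x = 0 := by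
  obtain ⟨j, rfl⟩ : ∃ j, s' = s + j + 1 := ⟨s' - s - 1, by omega⟩
  -- On the support of the finer function the first `s + j` digits of `x` form `a'`, so the first
  -- `s` digits form `a' / 2 ^ j`; this gives the constant.
  rw [setIntegral_congr_fun (g := fun x => ((if a = a' / 2 ^ j / 2 then (-1) ^ (a' / 2 ^ j)
    else 0 : ℤ) : ℝ) * haarOne (s + j + 1) a' x) measurableSet_Ico]
  · rw [integral_const_mul, integral_haarOne ha, mul_zero]
  · intro x hx
    simp only
    by_cases h : a' = dyadic (s + j) x
    · rw [haarOne_eq s a hx.1, ← dyadic_add_div_two_pow s j, ← h]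
    · rw [haarOne_eq (s + j + 1) a' hx.1, dyadic_succ_div_two, if_neg h]
      simp

lemma integral_haarOne_mul {s s' a a' : ℕ} (ha : 2 * a + 1 ≤ 2 ^ s) (ha' : 2 * a' + 1 ≤ 2 ^ s')
    (h : (s, a) ≠ (s', a')) :
    ∫ x in Set.Ico (0 : ℝ) 1, (haarOne s a x : ℝ) * haarOne s' a' x = 0 := by
  rcases lt_trichotomy s s' with hs | rfl | hs
  · exact integral_haarOne_mul_of_lt ha' hs
  · rw [setIntegral_congr_fun (g := fun _ => (0 : ℝ)) measurableSet_Ico]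
    · simp
    · intro x hx
      simp only [haarOne_eq s _ hx.1]
      split_ifs with h1 h2 h2 <;> simp
      exact h (by rw [h1, h2])
  · simp only [mul_comm (haarOne s a _ : ℝ)]
    exact integral_haarOne_mul_of_lt ha hs

/-- The volume of the support of a Haar function with orders `s`. -/
noncomputable def haarVol (s : Fin d → ℕ) : ℝ := ∏ i, haarLen (s i)

lemma integral_haar_mul_eq_prod (s a s' a' : Fin d → ℕ) :
    ∫ x, (haar s a x : ℝ) * haar s' a' x ∂(unifCube d) =
      ∏ i, ∫ x in Set.Ico (0 : ℝ) 1, (haarOne (s i) (a i) x : ℝ) * haarOne (s' i) (a' i) x := by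
  rw [unifCube_eq_pi, ← integral_fintype_prod_eq_prod
    (f := fun i x => (haarOne (s i) (a i) x : ℝ) * haarOne (s' i) (a' i) x)]
  simp only [haar, Int.cast_prod, Finset.prod_mul_distrib]

lemma integral_haar_mul {s a s' a' : Fin d → ℕ} (ha : ∀ i, 2 * a i + 1 ≤ 2 ^ s i)
    (ha' : ∀ i, 2 * a' i + 1 ≤ 2 ^ s' i) :
    ∫ x, (haar s a x : ℝ) * haar s' a' x ∂(unifCube d) =
      if (s, a) = (s', a') then haarVol s else 0 := by
  rw [integral_haar_mul_eq_prod]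
  split_ifs with h
  · obtain ⟨rfl, rfl⟩ := Prod.mk.inj h
    exact Finset.prod_congr rfl fun i _ => integral_haarOne_sq (ha i)
  · obtain ⟨i, hi⟩ : ∃ i, (s i, a i) ≠ (s' i, a' i) := by
      by_contra! hc
      exact h (Prod.ext (funext fun i => congrArg Prod.fst (hc i))
        (funext fun i => congrArg Prod.snd (hc i)))
    exact Finset.prod_eq_zero (Finset.mem_univ i) (integral_haarOne_mul (ha i) (ha' i) hi)

/-- Orthogonality to the constant function, which is the Haar function of order `0`. -/
lemma integral_haar {s a : Fin d → ℕ} (ha : ∀ i, 2 * a i + 1 ≤ 2 ^ s i) (hs : 1 ≤ ∑ i, s i) :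
    ∫ x, (haar s a x : ℝ) ∂(unifCube d) = 0 := by
  have h := integral_haar_mul (s' := fun _ => 0) (a' := fun _ => 0) ha (by simp)
  rw [if_neg] at h
  · rw [← h]
    refine integral_congr_ae ?_
    filter_upwards [ae_mem_cube] with x hx
    have : haar (fun _ : Fin d => 0) (fun _ => 0) x = 1 :=
      Finset.prod_eq_one fun i _ => by
        have := mem_cube.1 hx i
        simp [haarOne, this.1, this.2]
    rw [this]; simp
  · intro h
    rw [(Prod.mk.inj h).1] at hs
    simp at hs

lemma haarVol_pos (s : Fin d → ℕ) : 0 < haarVol s :=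
  Finset.prod_pos fun i _ => by rw [haarLen]; split_ifs <;> positivity

lemma haarVol_le_one (s : Fin d → ℕ) : haarVol s ≤ 1 :=
  Finset.prod_le_one (fun i _ => by rw [haarLen]; split_ifs <;> positivity) fun i _ => by
    rw [haarLen]
    split_ifs with h
    · rfl
    · rw [div_le_one (by positivity)]
      obtain ⟨j, hj⟩ := Nat.exists_eq_succ_of_ne_zero h
      rw [hj, pow_succ]
      have := one_le_pow₀ (n := j) (one_le_two (α := ℝ))
      linarith

/-- A nonzero order `s i` gives an interval of length `2 · 2 ^ (-s i)`, but order `0` gives length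
`1`. The resulting power of `2` is what `two_pow_card_support_le` has to absorb. -/
lemma haarVol_eq (s : Fin d → ℕ) :
    haarVol s = 2 ^ (Finset.univ.filter fun i => s i ≠ 0).card / 2 ^ ∑ i, s i := by
  have : ∀ i, haarLen (s i) = (if s i ≠ 0 then 2 else 1) / 2 ^ s i := by
    intro i; rw [haarLen]; split_ifs <;> simp_all
  simp only [haarVol, this, Finset.prod_div_distrib, Finset.prod_pow_eq_pow_sum,
    Finset.prod_ite, Finset.prod_const]
  simp

lemma integrable_haar_mul (s a s' a' : Fin d → ℕ) :
    Integrable (fun x => (haar s a x : ℝ) * haar s' a' x) (unifCube d) := by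
  refine Integrable.of_bound (C := 1) (by fun_prop) (Filter.Eventually.of_forall fun x => ?_)
  rcases haar_cases s a x with h | h | h <;> rcases haar_cases s' a' x with h' | h' | h' <;>
    simp [h, h']

lemma integrable_haar (s a : Fin d → ℕ) :
    Integrable (fun x => (haar s a x : ℝ)) (unifCube d) := by
  refine Integrable.of_bound (C := 1) (by fun_prop) (Filter.Eventually.of_forall fun x => ?_)
  rcases haar_cases s a x with h | h | h <;> simp [h]

variable {k : ℕ}

lemma haarDensity_eq (β : ℝ) (m : ℕ) (z : Fin k → Pt d) (x : Pt d) :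
    haarDensity β m z x = 1 + β / (2 * (haarWeight d (Nat.log 2 m) : ℝ)) *
      ∑ p ∈ haarIndex d 1 (Nat.log 2 m),
        ((-haarPairing z p.1 p.2).sign : ℝ) * (haar p.1 p.2 x : ℝ) := by
  rw [haarDensity]; push_cast; rfl

/-- At a point of the cube only one Haar function per order vector contributes, with a term in `{-1,
0, 1}`, and there are `W(h)` order vectors. -/
lemma abs_haarDensity_sub_one_le (hd : 1 ≤ d) {β : ℝ} (hβ : 0 ≤ β) (m : ℕ) (z : Fin k → Pt d)
    {x : Pt d} (hx : x ∈ cube d) : |haarDensity β m z x - 1| ≤ β / 2 := by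
  set h := Nat.log 2 m
  have h1 : |∑ p ∈ haarIndex d 1 h, (-haarPairing z p.1 p.2).sign * haar p.1 p.2 x| ≤
      haarWeight d h := by
    rw [sum_haarIndex 1 h hx (fun s a => (-haarPairing z s a).sign), ← card_orderVectors d h hd]
    refine (Finset.abs_sum_le_sum_abs _ _).trans ?_
    rw [Finset.card_eq_sum_ones]
    push_cast
    refine Finset.sum_le_sum fun s _ => ?_
    rw [abs_mul]
    have h2 : |haarSgn s x| = 1 := by rcases haarSgn_eq_or s x with h | h <;> simp [h]
    rw [h2, mul_one]
    rcases Int.sign_trichotomy (-haarPairing z s (haarPos s x)) with h | h | h <;> simp [h]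
  rw [haarDensity, add_sub_cancel_left, abs_mul, ← Int.cast_abs]
  have h3 : ((|∑ p ∈ haarIndex d 1 h, (-haarPairing z p.1 p.2).sign * haar p.1 p.2 x| : ℤ) : ℝ) ≤
      haarWeight d h := by exact_mod_cast h1
  rw [abs_of_nonneg (by positivity)]
  -- The weight vanishes only for `h = 0`; then division by zero gives the coefficient `0`, and the
  -- density is `1`.
  rcases Nat.eq_zero_or_pos (haarWeight d h) with h0 | h0
  · simp only [h0, Nat.cast_zero, mul_zero, div_zero, zero_mul, h]
    positivity
  · refine (mul_le_mul_of_nonneg_left h3 (by positivity)).trans (le_of_eq ?_)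
    have : (haarWeight d h : ℝ) ≠ 0 := by positivity
    simp only [h] at this ⊢
    field_simp

/-- This is the drift of the pairing with `H`: orthogonality leaves only the term of `H` itself,
which is present in the density once `h` has reached the order of `H`. -/
lemma integral_haar_mul_haarDensity (β : ℝ) (m : ℕ) (z : Fin k → Pt d) {s a : Fin d → ℕ}
    (ha : ∀ i, 2 * a i + 1 ≤ 2 ^ s i) (hs : 1 ≤ ∑ i, s i) :
    ∫ x, (haar s a x : ℝ) * haarDensity β m z x ∂(unifCube d) =
      if ∑ i, s i ≤ Nat.log 2 m then
        β / (2 * (haarWeight d (Nat.log 2 m) : ℝ)) * ((-haarPairing z s a).sign : ℝ) * haarVol s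
      else 0 := by
  have h : ∀ x, (haar s a x : ℝ) * haarDensity β m z x = (haar s a x : ℝ) +
      ∑ p ∈ haarIndex d 1 (Nat.log 2 m), β / (2 * (haarWeight d (Nat.log 2 m) : ℝ)) *
        ((-haarPairing z p.1 p.2).sign : ℝ) * ((haar s a x : ℝ) * haar p.1 p.2 x) := by
    intro x
    rw [haarDensity_eq, mul_add, mul_one, Finset.mul_sum, Finset.mul_sum]
    congr 1
    exact Finset.sum_congr rfl fun p _ => by ring
  simp only [h]
  rw [integral_add (integrable_haar _ _)
    (integrable_finsetSum _ fun p _ => (integrable_haar_mul _ _ _ _).const_mul _),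
    integral_haar ha hs, zero_add,
    integral_finsetSum _ fun p _ => (integrable_haar_mul _ _ _ _).const_mul _]
  simp only [integral_const_mul]
  rw [Finset.sum_congr rfl fun p hp => by rw [integral_haar_mul ha (mem_haarIndex.1 hp).1]]
  simp only [mul_ite, mul_zero, Prod.mk.eta, Finset.sum_ite_eq, mem_haarIndex]
  simp only [ha, hs, implies_true, true_and]

lemma integral_haarDensity (β : ℝ) (m : ℕ) (z : Fin k → Pt d) :
    ∫ x, haarDensity β m z x ∂(unifCube d) = 1 := by
  simp only [haarDensity_eq]
  rw [integral_add (integrable_const 1)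
    ((integrable_finsetSum _ fun p _ => (integrable_haar _ _).const_mul _).const_mul _),
    integral_const_mul, integral_finsetSum _ fun p _ => (integrable_haar _ _).const_mul _]
  simp only [integral_const_mul]
  rw [Finset.sum_eq_zero fun p hp => by
    rw [integral_haar (mem_haarIndex.1 hp).1 (mem_haarIndex.1 hp).2.1, mul_zero]]
  simp

lemma measurable_haarDensity (β : ℝ) (m : ℕ) :
    Measurable fun p : (Fin k → Pt d) × Pt d => haarDensity β m p.1 p.2 := by
  simp only [haarDensity_eq]
  have h1 : ∀ s a : Fin d → ℕ, Measurable fun z : Fin k → Pt d =>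
      ((-haarPairing z s a).sign : ℝ) := by
    intro s a
    refine (measurable_of_countable fun i : ℤ => ((-i).sign : ℝ)).comp ?_
    unfold haarPairing
    fun_prop
  have h2 : ∀ s a : Fin d → ℕ, Measurable fun p : (Fin k → Pt d) × Pt d =>
      ((-haarPairing p.1 s a).sign : ℝ) := fun s a => (h1 s a).comp measurable_fst
  fun_prop

/-- The density lies in `[1 - β/2, 1 + β/2]`, and the shift by `β/2` moves this interval to `[1 - β,
1]`. -/
theorem isThinningStrategy_haarStrategy (hd : 1 ≤ d) {β : ℝ} (h0 : 0 < β) (h1 : β ≤ 1) :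
    IsThinningStrategy β (haarStrategy d β) := by
  have key : ∀ (n : ℕ) (z : Fin n → Pt d), ∀ x ∈ cube d,
      1 - β ≤ haarStrategy d β n z x ∧ haarStrategy d β n z x ≤ 1 := by
    intro n z x hx
    have h := abs_le.1 (abs_haarDensity_sub_one_le hd h0.le (n + 1) z hx)
    simp only [haarStrategy]
    constructor <;> linarith [h.1, h.2]
  refine fun n => ⟨(measurable_haarDensity β (n + 1)).sub_const _, fun z _ => ⟨fun x hx => ?_, ?_⟩⟩
  · exact ⟨by linarith [(key n z x hx).1], (key n z x hx).2⟩
  · filter_upwards [ae_mem_cube] with x hx using (key n z x hx).1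

/-! ### The law of the samples -/

open scoped ENNReal

/-- Here `A` and `C` are the past candidates and the past random numbers, `B` and `D` the fresh
ones. The joint law is a product, so the fresh variables may be integrated out with the past frozen.
-/
lemma lintegral_of_indep {Ω α β γ δ : Type*} [MeasurableSpace Ω] [MeasurableSpace α]
    [MeasurableSpace β] [MeasurableSpace γ] [MeasurableSpace δ] {P : Measure Ω}
    [IsProbabilityMeasure P] {A : Ω → α} {B : Ω → β} {C : Ω → γ} {D : Ω → δ}
    (hA : Measurable A) (hB : Measurable B) (hC : Measurable C) (hD : Measurable D)
    (hAB : IndepFun A B P) (hCD : IndepFun C D P)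
    (h : IndepFun (fun ω => (A ω, B ω)) (fun ω => (C ω, D ω)) P)
    {F : (α × γ) × (β × δ) → ℝ≥0∞} (hF : Measurable F) :
    ∫⁻ ω, F ((A ω, C ω), (B ω, D ω)) ∂P =
      ∫⁻ ω, ∫⁻ b, ∫⁻ u, F ((A ω, C ω), (b, u)) ∂(P.map D) ∂(P.map B) ∂P := by
  have := Measure.isProbabilityMeasure_map (μ := P) hA.aemeasurable
  have := Measure.isProbabilityMeasure_map (μ := P) hB.aemeasurable
  have := Measure.isProbabilityMeasure_map (μ := P) hC.aemeasurable
  have := Measure.isProbabilityMeasure_map (μ := P) hD.aemeasurable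
  have h4 : P.map (fun ω => ((A ω, B ω), (C ω, D ω))) =
      ((P.map A).prod (P.map B)).prod ((P.map C).prod (P.map D)) := by
    rw [h.map_prod_eq_prod_map_map (by fun_prop) (by fun_prop),
      hAB.map_prod_eq_prod_map_map (by fun_prop) (by fun_prop),
      hCD.map_prod_eq_prod_map_map (by fun_prop) (by fun_prop)]
  have hAC : P.map (fun ω => (A ω, C ω)) = (P.map A).prod (P.map C) :=
    (h.comp measurable_fst measurable_fst).map_prod_eq_prod_map_map
      hA.aemeasurable hC.aemeasurable
  have hL : ∫⁻ ω, F ((A ω, C ω), (B ω, D ω)) ∂P =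
      ∫⁻ q, F ((q.1.1, q.2.1), (q.1.2, q.2.2))
        ∂(((P.map A).prod (P.map B)).prod ((P.map C).prod (P.map D))) := by
    rw [← h4, lintegral_map (by fun_prop) (by fun_prop)]
  have hR : ∫⁻ ω, ∫⁻ b, ∫⁻ u, F ((A ω, C ω), (b, u)) ∂(P.map D) ∂(P.map B) ∂P =
      ∫⁻ q, ∫⁻ b, ∫⁻ u, F (q, (b, u)) ∂(P.map D) ∂(P.map B) ∂((P.map A).prod (P.map C)) := by
    rw [← hAC, lintegral_map _ (by fun_prop)]
    refine Measurable.lintegral_prod_right' (f := fun q : (α × γ) × β =>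
      ∫⁻ u, F (q.1, (q.2, u)) ∂(P.map D)) ?_
    exact Measurable.lintegral_prod_right' (f := fun q : ((α × γ) × β) × δ =>
      F (q.1.1, (q.1.2, q.2))) (by fun_prop)
  have hm : Measurable fun q : (α × γ) × β => ∫⁻ u, F (q.1, (q.2, u)) ∂(P.map D) :=
    Measurable.lintegral_prod_right' (f := fun q : ((α × γ) × β) × δ =>
      F (q.1.1, (q.1.2, q.2))) (by fun_prop)
  rw [hL, hR, lintegral_prod _ (by fun_prop), lintegral_prod, lintegral_prod]
  · refine lintegral_congr fun a => ?_
    trans ∫⁻ b, ∫⁻ c, ∫⁻ u, F ((a, c), (b, u)) ∂(P.map D) ∂(P.map C) ∂(P.map B)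
    · refine lintegral_congr fun b => ?_
      rw [lintegral_prod _ (by fun_prop)]
    · refine lintegral_lintegral_swap (f := fun b c => ∫⁻ u, F ((a, c), (b, u)) ∂(P.map D)) ?_
      have hg : Measurable fun q : β × γ => (((a, q.2), q.1) : (α × γ) × β) := by fun_prop
      exact (hm.comp hg).aemeasurable
  · exact (Measurable.lintegral_prod_right' hm).aemeasurable
  · exact (Measurable.lintegral_prod_right' (f := fun q : (α × β) × (γ × δ) =>
      F ((q.1.1, q.2.1), (q.1.2, q.2.2))) (by fun_prop)).aemeasurable

/-! ### Locality and measurability of the thinned sequence -/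

section Thinned

variable {f : Strategy d} {X X' : ℕ → Pt d} {U U' : ℕ → ℝ} {n : ℕ}

lemma thinned_succ : thinned f X U (n + 1) =
    (Fin.snoc (thinned f X U n).1 (sample f X U n), rejections f X U (n + 1)) := by
  simp only [thinned, sample, rejections, add_assoc]

lemma rejections_succ : rejections f X U (n + 1) = rejections f X U n + decision f X U n := rfl

lemma sample_eq : sample f X U n = X (n + rejections f X U n + decision f X U n) := by
  rw [sample, rejections_succ, add_assoc]

lemma thinned_fst (n : ℕ) : (thinned f X U n).1 = fun i : Fin n => sample f X U i := by
  induction n with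
  | zero => exact funext fun i => i.elim0
  | succ n ih =>
    rw [thinned_succ]
    funext i
    refine Fin.lastCases ?_ (fun j => ?_) i
    · simp
    · simp [ih]

/-- The process reads no input beyond these. How many candidates it has read is itself random, which
is why the hypothesis refers to the rejections of the first of the two processes. -/
lemma thinned_congr (hX : ∀ j < n + rejections f X U n, X j = X' j) (hU : ∀ j < n, U j = U' j) :
    thinned f X U n = thinned f X' U' n := by
  induction n with
  | zero => rfl
  | succ n ih =>
    rw [rejections_succ] at hX
    have h := ih (fun j hj => hX j (by omega)) (fun j hj => hU j (by omega))
    have hr : rejections f X U n = rejections f X' U' n := congrArg Prod.snd h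
    have hc : decision f X U n = decision f X' U' n := by
      simp only [decision, candidate]
      rw [← h, ← hr, ← hU n (by omega), ← hX _ (by omega)]
    have hs : rejections f X U (n + 1) = rejections f X' U' (n + 1) := by
      rw [rejections_succ, rejections_succ, hr, hc]
    rw [thinned_succ, thinned_succ, h, hs]
    congr 2
    rw [sample, sample, ← hs, hX _ (by rw [rejections_succ]; omega)]

lemma measurable_eval_nat {E : Type*} [MeasurableSpace E] :
    Measurable fun p : (ℕ → E) × ℕ => p.1 p.2 :=
  measurable_from_prod_countable_left fun j => measurable_pi_apply j

lemma measurable_rejectBit (hf : Measurable fun p : (Fin n → Pt d) × Pt d => f n p.1 p.2) :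
    Measurable fun p : ((Fin n → Pt d) × Pt d) × ℝ => rejectBit f n p.1.1 p.1.2 p.2 := by
  unfold rejectBit
  exact Measurable.ite (measurableSet_lt (hf.comp measurable_fst) measurable_snd)
    measurable_const measurable_const

lemma measurable_thinned
    (hf : ∀ n, Measurable fun p : (Fin n → Pt d) × Pt d => f n p.1 p.2) (n : ℕ) :
    Measurable fun p : (ℕ → Pt d) × (ℕ → ℝ) => thinned f p.1 p.2 n := by
  induction n with
  | zero => exact measurable_const
  | succ n ih =>
    have h1 : Measurable fun p : (ℕ → Pt d) × (ℕ → ℝ) => candidate f p.1 p.2 n :=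
      measurable_eval_nat.comp (measurable_fst.prodMk ((measurable_of_countable (n + ·)).comp ih.snd))
    have h2 : Measurable fun p : (ℕ → Pt d) × (ℕ → ℝ) => decision f p.1 p.2 n :=
      (measurable_rejectBit (hf n)).comp ((ih.fst.prodMk h1).prodMk (by fun_prop))
    have h3 : Measurable fun p : (ℕ → Pt d) × (ℕ → ℝ) => rejections f p.1 p.2 (n + 1) :=
      ih.snd.add h2
    have h4 : Measurable fun p : (ℕ → Pt d) × (ℕ → ℝ) => sample f p.1 p.2 n :=
      measurable_eval_nat.comp (measurable_fst.prodMk ((measurable_of_countable (n + ·)).comp h3))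
    simp only [thinned_succ]
    refine Measurable.prodMk (measurable_pi_iff.2 fun i => ?_) h3
    refine Fin.lastCases ?_ (fun j => ?_) i
    · simpa using h4
    · simpa [Function.comp_def] using (measurable_pi_apply j).comp ih.fst

lemma measurable_sample
    (hf : ∀ n, Measurable fun p : (Fin n → Pt d) × Pt d => f n p.1 p.2) (n : ℕ) :
    Measurable fun p : (ℕ → Pt d) × (ℕ → ℝ) => sample f p.1 p.2 n := by
  have h := (measurable_pi_apply (Fin.last n)).comp (measurable_thinned hf (n + 1)).fst
  simpa [Function.comp_def, thinned_succ] using h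

end Thinned

lemma lintegral_threshold {p : ℝ} (hp : p ∈ Set.Icc (0 : ℝ) 1) (c c' : ℝ≥0∞) :
    ∫⁻ u in Set.Icc (0 : ℝ) 1, (if p < u then c else c') =
      c' * ENNReal.ofReal p + c * ENNReal.ofReal (1 - p) := by
  have h : ∀ u : ℝ, (if p < u then c else c') =
      (Set.Iic p).indicator (fun _ => c') u + (Set.Ioi p).indicator (fun _ => c) u := by
    intro u
    by_cases hu : p < u
    · simp [hu]
    · simp [hu, not_lt.1 hu]
  simp only [h]
  rw [lintegral_add_left (measurable_const.indicator measurableSet_Iic),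
    lintegral_indicator_const measurableSet_Iic, lintegral_indicator_const measurableSet_Ioi,
    Measure.restrict_apply measurableSet_Iic, Measure.restrict_apply measurableSet_Ioi]
  have h1 : Set.Iic p ∩ Set.Icc 0 1 = Set.Icc 0 p := by
    ext u; simp only [Set.mem_inter_iff, Set.mem_Iic, Set.mem_Icc]
    constructor
    · rintro ⟨h, h', _⟩; exact ⟨h', h⟩
    · rintro ⟨h, h'⟩; exact ⟨h', h, h'.trans hp.2⟩
  have h2 : Set.Ioi p ∩ Set.Icc 0 1 = Set.Ioc p 1 := by
    ext u; simp only [Set.mem_inter_iff, Set.mem_Ioi, Set.mem_Icc, Set.mem_Ioc]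
    constructor
    · rintro ⟨h, _, h'⟩; exact ⟨h, h'⟩
    · rintro ⟨h, h'⟩; exact ⟨h, hp.1.trans h.le, h'⟩
  rw [h1, h2]
  simp

/-- The law of one round: the candidate `b.1` survives with probability `g b.1`; otherwise the
independent uniform point `b.2` takes its place, which spreads the rejected mass `∫ (1 - g)`
uniformly. -/
lemma lintegral_keep_or_replace {g : Pt d → ℝ} (hg : Measurable g)
    (hg01 : ∀ x ∈ cube d, g x ∈ Set.Icc (0 : ℝ) 1) {φ : Pt d → ℝ≥0∞} (hφ : Measurable φ) :
    ∫⁻ b : Pt d × Pt d, ∫⁻ u in Set.Icc (0 : ℝ) 1, φ (if g b.1 < u then b.2 else b.1) ∂volume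
        ∂((unifCube d).prod (unifCube d)) =
      ∫⁻ x, φ x * (ENNReal.ofReal (g x) + ∫⁻ y, ENNReal.ofReal (1 - g y) ∂(unifCube d))
        ∂(unifCube d) := by
  have h1 : ∀ᵐ b ∂((unifCube d).prod (unifCube d)), b.1 ∈ cube d :=
    Measure.quasiMeasurePreserving_fst.ae ae_mem_cube
  have h2 : ∫⁻ b : Pt d × Pt d, ∫⁻ u in Set.Icc (0 : ℝ) 1, φ (if g b.1 < u then b.2 else b.1) ∂volume
        ∂((unifCube d).prod (unifCube d)) =
      ∫⁻ b : Pt d × Pt d, (φ b.1 * ENNReal.ofReal (g b.1) + φ b.2 * ENNReal.ofReal (1 - g b.1))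
        ∂((unifCube d).prod (unifCube d)) := by
    refine lintegral_congr_ae ?_
    filter_upwards [h1] with b hb
    simp only [apply_ite φ]
    exact lintegral_threshold (hg01 _ hb) _ _
  rw [h2, lintegral_prod _ (by fun_prop)]
  have h3 : ∀ x, ∫⁻ y, (φ x * ENNReal.ofReal (g x) + φ y * ENNReal.ofReal (1 - g x)) ∂(unifCube d) =
      φ x * ENNReal.ofReal (g x) + (∫⁻ y, φ y ∂(unifCube d)) * ENNReal.ofReal (1 - g x) := by
    intro x
    rw [lintegral_add_left measurable_const, lintegral_mul_const _ hφ]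
    simp
  simp only [h3, mul_add]
  rw [lintegral_add_left (by fun_prop), lintegral_add_left (by fun_prop),
    lintegral_const_mul _ (by fun_prop), lintegral_mul_const _ hφ]

/-- The conditional density of the next sample given the earlier ones, in integrated form. The index
of the next candidate is random, so the expectation is split according to the number `κ` of earlier
rejections; for fixed `κ` the next two candidates have fixed indices and are independent of
everything read so far. -/
theorem lintegral_sample {f : Strategy d}
    (hf : ∀ n, Measurable fun p : (Fin n → Pt d) × Pt d => f n p.1 p.2)
    (hf01 : ∀ n z, ∀ x ∈ cube d, f n z x ∈ Set.Icc (0 : ℝ) 1)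
    {Ω : Type*} [MeasurableSpace Ω] {P : Measure Ω} [IsProbabilityMeasure P]
    {X : ℕ → Ω → Pt d} {U : ℕ → Ω → ℝ}
    (hX : ∀ j, Measurable (X j)) (hU : ∀ j, Measurable (U j))
    (hXl : ∀ j, P.map (X j) = unifCube d) (hUl : ∀ j, P.map (U j) = volume.restrict (Set.Icc 0 1))
    (hXi : iIndepFun X P) (hUi : iIndepFun U P)
    (hXU : IndepFun (fun ω j => X j ω) (fun ω j => U j ω) P) (n : ℕ)
    {Φ : (Fin n → Pt d) × Pt d → ℝ≥0∞} (hΦ : Measurable Φ) :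
    ∫⁻ ω, Φ ((thinned f (fun j => X j ω) (fun j => U j ω) n).1,
        sample f (fun j => X j ω) (fun j => U j ω) n) ∂P =
      ∫⁻ ω, ∫⁻ x, Φ ((thinned f (fun j => X j ω) (fun j => U j ω) n).1, x) *
        (ENNReal.ofReal (f n (thinned f (fun j => X j ω) (fun j => U j ω) n).1 x) +
          ∫⁻ y, ENNReal.ofReal (1 - f n (thinned f (fun j => X j ω) (fun j => U j ω) n).1 y)
            ∂(unifCube d)) ∂(unifCube d) ∂P := by
  set T : (ℕ → Pt d) × (ℕ → ℝ) → (Fin n → Pt d) × ℕ := fun p => thinned f p.1 p.2 n with hT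
  have hTm : Measurable T := measurable_thinned hf n
  set V : Ω → (ℕ → Pt d) × (ℕ → ℝ) := fun ω => (fun j => X j ω, fun j => U j ω) with hV
  have hVm : Measurable V := by fun_prop
  set G : (Fin n → Pt d) → ℝ≥0∞ := fun z => ∫⁻ x, Φ (z, x) * (ENNReal.ofReal (f n z x) +
    ∫⁻ y, ENNReal.ofReal (1 - f n z y) ∂(unifCube d)) ∂(unifCube d) with hG
  have hfn := hf n
  have hGm : Measurable G := by
    refine Measurable.lintegral_prod_right' (f := fun p : (Fin n → Pt d) × Pt d =>
      Φ p * (ENNReal.ofReal (f n p.1 p.2) + ∫⁻ y, ENNReal.ofReal (1 - f n p.1 y) ∂(unifCube d))) ?_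
    refine hΦ.mul (hfn.ennreal_ofReal.add ?_)
    exact (Measurable.lintegral_prod_right' (f := fun p : (Fin n → Pt d) × Pt d =>
      ENNReal.ofReal (1 - f n p.1 p.2)) (by fun_prop)).comp measurable_fst
  have hsm : Measurable fun ω => Φ ((T (V ω)).1, sample f (V ω).1 (V ω).2 n) :=
    hΦ.comp ((hTm.comp hVm).fst.prodMk ((measurable_sample hf n).comp hVm))
  have hset : ∀ κ : ℕ, MeasurableSet {ω | (T (V ω)).2 = κ} := fun κ =>
    (hTm.comp hVm).snd (measurableSet_singleton κ)
  have hsplit : ∀ g : Ω → ℝ≥0∞, Measurable g →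
      ∫⁻ ω, g ω ∂P = ∑' κ : ℕ, ∫⁻ ω, (if (T (V ω)).2 = κ then g ω else 0) ∂P := by
    intro g hg
    rw [← lintegral_tsum fun κ => (Measurable.ite (hset κ) hg measurable_const).aemeasurable]
    exact lintegral_congr fun ω => (tsum_ite_eq' (T (V ω)).2 (fun _ => g ω)).symm
  change ∫⁻ ω, Φ ((T (V ω)).1, sample f (V ω).1 (V ω).2 n) ∂P = ∫⁻ ω, G (T (V ω)).1 ∂P
  rw [hsplit _ hsm, hsplit (fun ω => G (T (V ω)).1) (hGm.comp (hTm.comp hVm).fst)]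
  refine tsum_congr fun κ => ?_
  -- The inputs are cut off after the part that is read when `κ` candidates have been rejected. The
  -- cut sequences are independent of the two fresh candidates and of the fresh random number.
  set A : Ω → ℕ → Pt d := fun ω j => if j < n + κ then X j ω else 0 with hA
  set B : Ω → Pt d × Pt d := fun ω => (X (n + κ) ω, X (n + κ + 1) ω) with hB
  set C : Ω → ℕ → ℝ := fun ω j => if j < n then U j ω else 0 with hC
  have hAm : Measurable A := measurable_pi_iff.2 fun j => by
    simp only [hA]; split_ifs <;> fun_prop
  have hBm : Measurable B := by fun_prop
  have hCm : Measurable C := measurable_pi_iff.2 fun j => by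
    simp only [hC]; split_ifs <;> fun_prop
  have hAB : IndepFun A B P := by
    have h := hXi.indepFun_finset (Finset.range (n + κ)) {n + κ, n + κ + 1}
      (by simp [Finset.disjoint_left]; omega) hX
    have h' := h.comp (φ := fun (a : Finset.range (n + κ) → Pt d) (j : ℕ) =>
        if hj : j < n + κ then a ⟨j, by simpa using hj⟩ else 0)
      (ψ := fun b : ({n + κ, n + κ + 1} : Finset ℕ) → Pt d => (b ⟨n + κ, by simp⟩, b ⟨n + κ + 1, by simp⟩))
      (measurable_pi_iff.2 fun j => by split_ifs <;> fun_prop) (by fun_prop)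
    convert! h' using 2 with ω
  have hCD : IndepFun C (U n) P := by
    have hψ : Measurable fun b : ({n} : Finset ℕ) → ℝ => b ⟨n, Finset.mem_singleton_self n⟩ :=
      measurable_pi_apply _
    have h := hUi.indepFun_finset (Finset.range n) {n} (by simp) hU
    have h' := h.comp (φ := fun (a : Finset.range n → ℝ) (j : ℕ) =>
        if hj : j < n then a ⟨j, by simpa using hj⟩ else 0)
      (ψ := fun b : ({n} : Finset ℕ) → ℝ => b ⟨n, by simp⟩)
      (measurable_pi_iff.2 fun j => by split_ifs <;> fun_prop)
      hψ
    convert! h' using 2 with ω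
  have hABCD : IndepFun (fun ω => (A ω, B ω)) (fun ω => (C ω, U n ω)) P :=
    hXU.comp (φ := fun ξ : ℕ → Pt d => ((fun j => if j < n + κ then ξ j else 0 : ℕ → Pt d),
        (ξ (n + κ), ξ (n + κ + 1))))
      (ψ := fun υ : ℕ → ℝ => ((fun j => if j < n then υ j else 0 : ℕ → ℝ), υ n))
      ((measurable_pi_iff.2 fun j => by split_ifs <;> fun_prop).prodMk (by fun_prop))
      ((measurable_pi_iff.2 fun j => by split_ifs <;> fun_prop).prodMk (by fun_prop))
  have hBl : P.map B = (unifCube d).prod (unifCube d) := by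
    rw [(hXi.indepFun (by omega : n + κ ≠ n + κ + 1)).map_prod_eq_prod_map_map
      (hX _).aemeasurable (hX _).aemeasurable, hXl, hXl]
  -- Whether exactly `κ` candidates have been rejected can be read off from the cut inputs, and if
  -- so the cut does not change the past samples.
  have hcut : ∀ ω, ((T (A ω, C ω)).2 = κ ↔ (T (V ω)).2 = κ) ∧
      ((T (V ω)).2 = κ → T (A ω, C ω) = T (V ω)) := by
    intro ω
    have h1 : (T (V ω)).2 = κ → T (A ω, C ω) = T (V ω) := fun h =>
      (thinned_congr (fun j hj => by
        have hj' : j < n + κ := by rw [← h]; exact hj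
        simp [hA, hj', hV]) (fun j hj => by simp [hC, hj, hV])).symm
    have h2 : (T (A ω, C ω)).2 = κ → T (A ω, C ω) = T (V ω) := fun h =>
      thinned_congr (fun j hj => by
        have hj' : j < n + κ := by rw [← h]; exact hj
        simp [hA, hj', hV]) (fun j hj => by simp [hC, hj, hV])
    exact ⟨⟨fun h => by rw [← h2 h, h], fun h => by rw [h1 h, h]⟩, h1⟩
  set F : ((ℕ → Pt d) × (ℕ → ℝ)) × ((Pt d × Pt d) × ℝ) → ℝ≥0∞ := fun q =>
    if (T q.1).2 = κ then Φ ((T q.1).1, if f n (T q.1).1 q.2.1.1 < q.2.2 then q.2.1.2 else q.2.1.1)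
    else 0 with hF
  have hFm : Measurable F := by
    have hz : Measurable fun q : ((ℕ → Pt d) × (ℕ → ℝ)) × ((Pt d × Pt d) × ℝ) => (T q.1).1 :=
      (hTm.comp measurable_fst).fst
    refine Measurable.ite ((hTm.comp measurable_fst).snd (measurableSet_singleton κ))
      (hΦ.comp (hz.prodMk (Measurable.ite (measurableSet_lt ?_ (by fun_prop))
        (by fun_prop) (by fun_prop)))) measurable_const
    exact hfn.comp (hz.prodMk (by fun_prop))
  have hkey := lintegral_of_indep hAm hBm hCm (hU n) hAB hCD hABCD hFm
  rw [hBl, hUl] at hkey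
  calc _ = ∫⁻ ω, F ((A ω, C ω), (B ω, U n ω)) ∂P := by
        refine lintegral_congr fun ω => ?_
        simp only [hF, (hcut ω).1]
        by_cases h : (T (V ω)).2 = κ
        · simp only [if_pos h, (hcut ω).2 h]
          congr 2
          rw [sample_eq]
          have h' : rejections f (V ω).1 (V ω).2 n = κ := h
          simp only [decision, rejectBit, candidate, h']
          simp only [hB, hV, hT]
          split_ifs <;> rfl
        · simp only [if_neg h]
    _ = _ := hkey
    _ = _ := by
        refine lintegral_congr fun ω => ?_
        simp only [hF, (hcut ω).1]
        split_ifs with h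
        · rw [(hcut ω).2 h]
          exact lintegral_keep_or_replace (hfn.comp (measurable_const.prodMk measurable_id))
            (hf01 n _) (hΦ.comp (measurable_const.prodMk measurable_id))
        · simp

/-! ### Exponential moments of the Haar pairings -/

lemma sinh_le_mul_cosh {x : ℝ} (hx : 0 ≤ x) : Real.sinh x ≤ x * Real.cosh x := by
  have hm : MonotoneOn (fun x => x * Real.cosh x - Real.sinh x) (Set.Ici 0) := by
    refine monotoneOn_of_deriv_nonneg (convex_Ici 0) (by fun_prop) (by fun_prop) ?_
    intro y hy
    rw [interior_Ici] at hy
    have h : HasDerivAt (fun x => x * Real.cosh x - Real.sinh x)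
        (1 * Real.cosh y + y * Real.sinh y - Real.cosh y) y :=
      ((hasDerivAt_id y).mul (Real.hasDerivAt_cosh y)).sub (Real.hasDerivAt_sinh y)
    rw [h.deriv]
    have := mul_nonneg hy.le (Real.sinh_nonneg_iff.2 hy.le)
    linarith
  have := hm (Set.mem_Ici.2 le_rfl) (Set.mem_Ici.2 hx) hx
  simp at this
  linarith

/-- Compares the second-order coefficient `cosh θ - 1` with the drift coefficient `sinh θ`: the
former is smaller by a factor `θ/2`. It follows from `sinh y ≤ y cosh y` at the half argument. -/
lemma two_mul_cosh_sub_one_le {x : ℝ} (hx : 0 ≤ x) :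
    2 * (Real.cosh x - 1) ≤ x * Real.sinh x := by
  have h := sinh_le_mul_cosh (x := x / 2) (by linarith)
  have h0 : 0 ≤ Real.sinh (x / 2) := Real.sinh_nonneg_iff.2 (by linarith)
  have h1 : Real.cosh x = Real.cosh (x / 2) ^ 2 + Real.sinh (x / 2) ^ 2 := by
    rw [← Real.cosh_two_mul]; ring_nf
  have h2 : Real.sinh x = 2 * Real.sinh (x / 2) * Real.cosh (x / 2) := by
    rw [← Real.sinh_two_mul]; ring_nf
  rw [h1, h2, Real.cosh_sq]
  nlinarith [mul_le_mul_of_nonneg_left h h0]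

lemma cosh_sub_one_le_sq {x : ℝ} (hx : 0 ≤ x) (hx1 : x ≤ 1) : Real.cosh x - 1 ≤ x ^ 2 := by
  have h1 := Real.cosh_le_exp_half_sq x
  have h2 := Real.abs_exp_sub_one_le (x := x ^ 2 / 2) (by rw [abs_of_nonneg (by positivity)]; nlinarith)
  rw [abs_of_nonneg (by positivity : 0 ≤ x ^ 2 / 2)] at h2
  linarith [le_abs_self (Real.exp (x ^ 2 / 2) - 1)]

/-- Since `H` takes only the values `0, 1, -1`, the second-order expansion in `H` is exact. -/
lemma cosh_add_haar (θ : ℝ) (M : ℤ) (s a : Fin d → ℕ) (x : Pt d) :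
    Real.cosh (θ * (M + haar s a x : ℤ)) = Real.cosh (θ * M) +
      Real.cosh (θ * M) * (Real.cosh θ - 1) * ((haar s a x : ℝ) * haar s a x) +
      Real.sinh (θ * M) * Real.sinh θ * (haar s a x : ℝ) := by
  rcases haar_cases s a x with h | h | h <;> rw [h] <;> push_cast
  · simp
  · rw [mul_add, mul_one, Real.cosh_add]; ring
  · rw [mul_add, mul_neg_one, Real.cosh_add, Real.cosh_neg, Real.sinh_neg]; ring

variable {k : ℕ}

lemma haarDensity_bounds (hd : 1 ≤ d) {β : ℝ} (h0 : 0 < β) (h1 : β ≤ 1) (m : ℕ)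
    (z : Fin k → Pt d) {x : Pt d} (hx : x ∈ cube d) :
    1 / 2 ≤ haarDensity β m z x ∧ haarDensity β m z x ≤ 3 / 2 := by
  have h := abs_le.1 (abs_haarDensity_sub_one_le hd h0.le m z hx)
  constructor <;> linarith [h.1, h.2]

lemma measurable_haarDensity_right (β : ℝ) (m : ℕ) (z : Fin k → Pt d) :
    Measurable fun x => haarDensity β m z x := by
  simp only [haarDensity_eq]
  fun_prop

lemma integrable_mul_haarDensity (hd : 1 ≤ d) {β : ℝ} (h0 : 0 < β) (h1 : β ≤ 1) (m : ℕ)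
    (z : Fin k → Pt d) {g : Pt d → ℝ} (hg : Measurable g) (hg1 : ∀ x, |g x| ≤ 1) :
    Integrable (fun x => g x * haarDensity β m z x) (unifCube d) := by
  have := measurable_haarDensity_right β m z
  refine Integrable.of_bound (C := 3 / 2) (by fun_prop) ?_
  filter_upwards [ae_mem_cube] with x hx
  have h := haarDensity_bounds hd h0 h1 m z hx
  rw [norm_mul, Real.norm_eq_abs, Real.norm_eq_abs, abs_of_nonneg (by linarith : 0 ≤ haarDensity β m z x)]
  nlinarith [hg1 x, abs_nonneg (g x)]

lemma integral_haar_sq_mul_haarDensity_le (hd : 1 ≤ d) {β : ℝ} (h0 : 0 < β) (h1 : β ≤ 1) (m : ℕ)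
    (z : Fin k → Pt d) {s a : Fin d → ℕ} (ha : ∀ i, 2 * a i + 1 ≤ 2 ^ s i) :
    ∫ x, ((haar s a x : ℝ) * haar s a x) * haarDensity β m z x ∂(unifCube d) ≤
      3 / 2 * haarVol s := by
  have h := integral_haar_mul ha ha
  rw [if_pos rfl] at h
  rw [← h, ← integral_const_mul]
  refine integral_mono_ae (integrable_mul_haarDensity hd h0 h1 m z (by fun_prop) fun x => ?_)
    ((integrable_haar_mul _ _ _ _).const_mul _) ?_
  · rcases haar_cases s a x with h | h | h <;> simp [h]
  · filter_upwards [ae_mem_cube] with x hx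
    have h := haarDensity_bounds hd h0 h1 m z hx
    nlinarith [mul_self_nonneg (haar s a x : ℝ)]

/-- The exact expansion is integrated term by term: the density has mass `1`, it is at most `3/2` in
the quadratic term, and the linear term is the drift. -/
lemma integral_cosh_mul_haarDensity_le (hd : 1 ≤ d) {β : ℝ} (h0 : 0 < β) (h1 : β ≤ 1) (m : ℕ)
    (z : Fin k → Pt d) {s a : Fin d → ℕ} (ha : ∀ i, 2 * a i + 1 ≤ 2 ^ s i) (hs : 1 ≤ ∑ i, s i)
    (θ : ℝ) :
    Integrable (fun x => Real.cosh (θ * (haarPairing z s a + haar s a x : ℤ)) * haarDensity β m z x)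
      (unifCube d) ∧
    ∫ x, Real.cosh (θ * (haarPairing z s a + haar s a x : ℤ)) * haarDensity β m z x ∂(unifCube d) ≤
      Real.cosh (θ * haarPairing z s a) * (1 + 3 / 2 * haarVol s * (Real.cosh θ - 1)) +
      Real.sinh (θ * haarPairing z s a) * Real.sinh θ *
        (if ∑ i, s i ≤ Nat.log 2 m then β / (2 * (haarWeight d (Nat.log 2 m) : ℝ)) *
          ((-haarPairing z s a).sign : ℝ) * haarVol s else 0) := by
  set M := haarPairing z s a
  set c := Real.cosh (θ * M)
  have hc : 0 ≤ c := (Real.cosh_pos _).le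
  have hc1 : 0 ≤ Real.cosh θ - 1 := by linarith [Real.one_le_cosh θ]
  have hH : ∀ x, |(haar s a x : ℝ) * haar s a x| ≤ 1 ∧ |(haar s a x : ℝ)| ≤ 1 := fun x => by
    rcases haar_cases s a x with h | h | h <;> simp [h]
  have i1 := integrable_mul_haarDensity hd h0 h1 m z (g := fun _ => 1) (by fun_prop) (by simp)
  have i2 := integrable_mul_haarDensity hd h0 h1 m z
    (g := fun x => (haar s a x : ℝ) * haar s a x) (by fun_prop) fun x => (hH x).1
  have i3 := integrable_mul_haarDensity hd h0 h1 m z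
    (g := fun x => (haar s a x : ℝ)) (by fun_prop) fun x => (hH x).2
  have he : ∀ x, Real.cosh (θ * (M + haar s a x : ℤ)) * haarDensity β m z x =
      c * (1 * haarDensity β m z x) +
      c * (Real.cosh θ - 1) * (((haar s a x : ℝ) * haar s a x) * haarDensity β m z x) +
      Real.sinh (θ * M) * Real.sinh θ * ((haar s a x : ℝ) * haarDensity β m z x) := by
    intro x
    rw [cosh_add_haar]; ring
  simp only [he]
  refine ⟨((i1.const_mul _).add (i2.const_mul _)).add (i3.const_mul _), ?_⟩
  rw [integral_add, integral_add (i1.const_mul _) (i2.const_mul _), integral_const_mul,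
    integral_const_mul, integral_const_mul, integral_const_mul, integral_haar_mul_haarDensity β m z ha hs]
  rotate_left
  · exact (i1.const_mul _).add (i2.const_mul _)
  · exact i3.const_mul _
  simp only [one_mul]
  rw [integral_haarDensity]
  have h2 := mul_le_mul_of_nonneg_left (integral_haar_sq_mul_haarDensity_le hd h0 h1 m z ha)
    (mul_nonneg hc hc1)
  linarith

/-- The restoring force `sinh(θ|M|)` is at least `cosh(θM) - 1`, because `cosh y - sinh y = exp(-y)
≤ 1` for `y ≥ 0`. -/
lemma sinh_mul_sign (θ : ℝ) (hθ : 0 ≤ θ) (M : ℤ) :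
    Real.sinh (θ * M) * ((-M).sign : ℝ) ≤ 1 - Real.cosh (θ * M) := by
  have key : ∀ y : ℝ, 0 ≤ y → Real.cosh y - 1 ≤ Real.sinh y := fun y hy => by
    have h1 := Real.cosh_sub_sinh y
    have h2 : Real.exp (-y) ≤ 1 := Real.exp_le_one_iff.2 (by linarith)
    linarith
  rcases lt_trichotomy M 0 with h | h | h
  · have h' : (M : ℝ) < 0 := by exact_mod_cast h
    rw [Int.sign_eq_one_of_pos (by omega)]
    have := key (-(θ * M)) (by nlinarith)
    rw [Real.cosh_neg, Real.sinh_neg] at this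
    push_cast; linarith
  · simp [h]
  · have h' : (0 : ℝ) < M := by exact_mod_cast h
    rw [Int.sign_eq_neg_one_of_neg (by omega)]
    have := key (θ * M) (by positivity)
    push_cast; linarith

lemma integral_cosh_mul_haarDensity_le_of_lt (hd : 1 ≤ d) {β : ℝ} (h0 : 0 < β) (h1 : β ≤ 1)
    (m : ℕ) (z : Fin k → Pt d) {s a : Fin d → ℕ} (ha : ∀ i, 2 * a i + 1 ≤ 2 ^ s i)
    (hs : 1 ≤ ∑ i, s i) (θ : ℝ) (hsm : Nat.log 2 m < ∑ i, s i) :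
    ∫ x, Real.cosh (θ * (haarPairing z s a + haar s a x : ℤ)) * haarDensity β m z x ∂(unifCube d) ≤
      (1 + 3 / 2 * haarVol s * (Real.cosh θ - 1)) * Real.cosh (θ * haarPairing z s a) := by
  have h := (integral_cosh_mul_haarDensity_le hd h0 h1 m z ha hs θ).2
  rw [if_neg (by omega), mul_zero, add_zero] at h
  linarith

/-- With `c = cosh(θM)`, the drift contributes at most `(1 - c) B` and the quadratic term at most `c
B / 2`. The result is an affine map with fixed point `2`, and `B ≤ 1` makes it increasing. It
matters that `B` does not depend on the past `z`. -/
lemma integral_cosh_mul_haarDensity_le_of_le (hd : 1 ≤ d) {β : ℝ} (h0 : 0 < β) (h1 : β ≤ 1)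
    (m : ℕ) {s a : Fin d → ℕ} (ha : ∀ i, 2 * a i + 1 ≤ 2 ^ s i)
    (hs : 1 ≤ ∑ i, s i) {θ : ℝ} (hθ : 0 ≤ θ) (hsm : ∑ i, s i ≤ Nat.log 2 m)
    (hθW : 3 * (haarWeight d (Nat.log 2 m)) * θ ≤ β) :
    ∃ B : ℝ, 0 ≤ B ∧ B ≤ 1 ∧ ∀ z : Fin k → Pt d,
    ∫ x, Real.cosh (θ * (haarPairing z s a + haar s a x : ℤ)) * haarDensity β m z x ∂(unifCube d) ≤
      (1 - B / 2) * Real.cosh (θ * haarPairing z s a) + B := by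
  set W : ℝ := (haarWeight d (Nat.log 2 m) : ℝ)
  have hW : 1 ≤ W := by
    have : 1 ≤ haarWeight d (Nat.log 2 m) := haarWeight_pos d (hs.trans hsm)
    simp only [W]
    exact_mod_cast this
  have hv := haarVol_pos s
  have hv1 := haarVol_le_one s
  have hsinh : 0 ≤ Real.sinh θ := Real.sinh_nonneg_iff.2 hθ
  have hθ1 : θ ≤ 1 / 3 := by nlinarith
  have hsinh1 : Real.sinh θ ≤ 2 := by
    have h1 : Real.sinh θ ≤ Real.sinh 1 := Real.sinh_le_sinh.2 (by linarith)
    rw [Real.sinh_eq 1] at h1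
    linarith [Real.exp_one_lt_d9, Real.exp_pos (-1)]
  -- This is where `3Wθ ≤ β` is used: it says exactly that `(3/2) θ ≤ β / (2W)`.
  have hA : θ * Real.sinh θ * (3 / 2) ≤ Real.sinh θ * (β / (2 * W)) := by
    have : θ * (3 / 2) ≤ β / (2 * W) := by
      rw [le_div_iff₀ (by linarith)]; linarith
    nlinarith
  have hA1 : Real.sinh θ * (β / (2 * W)) ≤ 1 := by
    have : β / (2 * W) ≤ 1 / 2 := by
      rw [div_le_div_iff₀ (by linarith) (by norm_num)]; linarith
    have h' : 0 ≤ β / (2 * W) := by positivity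
    nlinarith
  refine ⟨Real.sinh θ * (β / (2 * W)) * haarVol s, by positivity, ?_, ?_⟩
  · exact mul_le_one₀ hA1 hv.le hv1
  intro z
  have h := (integral_cosh_mul_haarDensity_le hd h0 h1 m z ha hs θ).2
  rw [if_pos hsm] at h
  set M := haarPairing z s a
  have h3 := sinh_mul_sign θ hθ M
  have h4 : Real.sinh (θ * M) * Real.sinh θ * (β / (2 * W) * ((-M).sign : ℝ) * haarVol s) ≤
      (1 - Real.cosh (θ * M)) * (Real.sinh θ * (β / (2 * W)) * haarVol s) := by
    have : 0 ≤ Real.sinh θ * (β / (2 * W)) * haarVol s := by positivity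
    calc _ = (Real.sinh (θ * M) * ((-M).sign : ℝ)) * (Real.sinh θ * (β / (2 * W)) * haarVol s) := by
          ring
      _ ≤ _ := mul_le_mul_of_nonneg_right h3 this
  have h5 : 3 / 2 * haarVol s * (Real.cosh θ - 1) ≤
      Real.sinh θ * (β / (2 * W)) * haarVol s / 2 := by
    have := two_mul_cosh_sub_one_le hθ
    nlinarith
  have h6 := mul_le_mul_of_nonneg_left h5 (Real.cosh_pos (θ * M)).le
  linarith

/-- The density has integral `1`, so the rejected mass is exactly `β/2` and undoes the shift in the
definition of the strategy. -/
lemma lintegral_sample_haarStrategy (hd : 1 ≤ d) {β : ℝ} (h0 : 0 < β) (h1 : β ≤ 1)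
    {Ω : Type*} [MeasurableSpace Ω] {P : Measure Ω} [IsProbabilityMeasure P]
    {X : ℕ → Ω → Pt d} {U : ℕ → Ω → ℝ}
    (hX : ∀ j, Measurable (X j)) (hU : ∀ j, Measurable (U j))
    (hXl : ∀ j, P.map (X j) = unifCube d) (hUl : ∀ j, P.map (U j) = volume.restrict (Set.Icc 0 1))
    (hXi : iIndepFun X P) (hUi : iIndepFun U P)
    (hXU : IndepFun (fun ω j => X j ω) (fun ω j => U j ω) P) (n : ℕ)
    {Φ : (Fin n → Pt d) × Pt d → ENNReal} (hΦ : Measurable Φ) :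
    ∫⁻ ω, Φ ((thinned (haarStrategy d β) (fun j => X j ω) (fun j => U j ω) n).1,
        sample (haarStrategy d β) (fun j => X j ω) (fun j => U j ω) n) ∂P =
      ∫⁻ ω, ∫⁻ x, Φ ((thinned (haarStrategy d β) (fun j => X j ω) (fun j => U j ω) n).1, x) *
        ENNReal.ofReal (haarDensity β (n + 1)
          (thinned (haarStrategy d β) (fun j => X j ω) (fun j => U j ω) n).1 x)
          ∂(unifCube d) ∂P := by
  have hm : ∀ n, Measurable fun p : (Fin n → Pt d) × Pt d => haarStrategy d β n p.1 p.2 :=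
    fun n => (isThinningStrategy_haarStrategy hd h0 h1 n).1
  have hcube : ∀ n z, ∀ x ∈ cube d, haarStrategy d β n z x ∈ Set.Icc (0 : ℝ) 1 := by
    intro n z x hx
    have h := abs_le.1 (abs_haarDensity_sub_one_le hd h0.le (n + 1) z hx)
    simp only [haarStrategy]
    constructor <;> linarith [h.1, h.2]
  rw [lintegral_sample hm hcube hX hU hXl hUl hXi hUi hXU n hΦ]
  refine lintegral_congr fun ω => ?_
  set z := (thinned (haarStrategy d β) (fun j => X j ω) (fun j => U j ω) n).1
  have hmz := measurable_haarDensity_right β (n + 1) z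
  have hint : Integrable (haarDensity β (n + 1) z) (unifCube d) := by
    simpa using integrable_mul_haarDensity hd h0 h1 (n + 1) z (g := fun _ => 1) (by fun_prop) (by simp)
  have hrej : ∫⁻ y, ENNReal.ofReal (1 - haarStrategy d β n z y) ∂(unifCube d) =
      ENNReal.ofReal (β / 2) := by
    have hi : Integrable (fun y => haarStrategy d β n z y) (unifCube d) :=
      hint.sub (integrable_const _)
    rw [← ofReal_integral_eq_lintegral_ofReal (f := fun y => 1 - haarStrategy d β n z y)
      ((integrable_const 1).sub hi)]
    · rw [integral_sub (integrable_const 1) hi]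
      simp only [haarStrategy]
      rw [integral_sub hint (integrable_const _), integral_haarDensity]
      simp
    · filter_upwards [ae_mem_cube] with x hx
      exact sub_nonneg.2 (hcube n z x hx).2
  rw [hrej]
  refine lintegral_congr_ae ?_
  filter_upwards [ae_mem_cube] with x hx
  rw [← ENNReal.ofReal_add (hcube n z x hx).1 (by linarith), haarStrategy, sub_add_cancel]

lemma haarPairing_snoc {n : ℕ} (z : Fin n → Pt d) (x : Pt d) (s a : Fin d → ℕ) :
    haarPairing (Fin.snoc z x : Fin (n + 1) → Pt d) s a = haarPairing z s a + haar s a x := by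
  simp [haarPairing, Fin.sum_univ_castSucc]

/-- For `k` nonzero entries, `2^k ≤ C(2k, k) ≤ C(h+d, d) = W + 1`, as `k ≤ h` and `k ≤ d`. -/
lemma two_pow_card_support_le {s : Fin d → ℕ} {h : ℕ} (hd : 1 ≤ d) (hs : ∑ i, s i ≤ h) :
    2 ^ (Finset.univ.filter fun i => s i ≠ 0).card ≤ haarWeight d h + 1 := by
  obtain ⟨k, hk⟩ : ∃ k, k = (Finset.univ.filter fun i => s i ≠ 0).card := ⟨_, rfl⟩
  rw [← hk]
  have hkd : k ≤ d := by simpa [hk] using Finset.card_filter_le (Finset.univ : Finset (Fin d)) _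
  have hks : k ≤ h := by
    refine le_trans ?_ hs
    rw [hk, Finset.card_eq_sum_ones]
    refine (Finset.sum_le_sum fun i hi => ?_).trans
      (Finset.sum_le_sum_of_subset (Finset.filter_subset _ _))
    exact Nat.one_le_iff_ne_zero.2 (Finset.mem_filter.1 hi).2
  clear hk
  rw [haarWeight_add_one d h hd]
  calc 2 ^ k ≤ (2 * k).choose k := by
        induction k with
        | zero => simp
        | succ k ih =>
          have h1 := Nat.succ_mul_centralBinom_succ k
          simp only [Nat.centralBinom] at h1
          have h2 := ih (by omega) (by omega)
          rw [pow_succ]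
          nlinarith
    _ ≤ (h + k).choose k := Nat.choose_le_choose _ (by omega)
    _ = (h + k).choose h := by rw [Nat.choose_symm_add]
    _ ≤ (h + d).choose h := Nat.choose_le_choose _ (by omega)
    _ = (h + d).choose d := by rw [Nat.choose_symm_add]

/-- The pairing of a Haar function with the first `n` samples of the Haar strategy. -/
noncomputable def samplePairing (β : ℝ) (X : ℕ → Pt d) (U : ℕ → ℝ) (s a : Fin d → ℕ) (n : ℕ) : ℤ :=
  haarPairing (thinned (haarStrategy d β) X U n).1 s a

lemma samplePairing_succ (β : ℝ) (X : ℕ → Pt d) (U : ℕ → ℝ) (s a : Fin d → ℕ) (n : ℕ) :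
    samplePairing β X U s a (n + 1) =
      samplePairing β X U s a n + haar s a (sample (haarStrategy d β) X U n) := by
  rw [samplePairing, thinned_succ]
  exact haarPairing_snoc _ _ _ _

@[fun_prop]
lemma measurable_haarPairing {k : ℕ} (s a : Fin d → ℕ) :
    Measurable fun z : Fin k → Pt d => haarPairing z s a := by
  unfold haarPairing
  fun_prop

/-- Up to time `2 ^ order`, the time multiplied by the volume of the support is at most `2^k`, with
`k` the number of nonzero orders. As `2^k ≤ W + 1 ≤ 2W` and `cosh θ - 1 ≤ θ²` with `θ ≤ 1/(3W)`, the
exponent of the growth is below `log 2`. -/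
lemma growth_before_drift {s : Fin d → ℕ} {h : ℕ} (hd : 1 ≤ d) (h1s : 1 ≤ ∑ i, s i)
    (hsh : ∑ i, s i ≤ h) {θ : ℝ} (hθ : 0 ≤ θ) (hθW : 3 * (haarWeight d h) * θ ≤ 1) {j : ℕ}
    (hj : j ≤ 2 ^ ∑ i, s i) :
    (1 + 3 / 2 * haarVol s * (Real.cosh θ - 1)) ^ j ≤ 2 := by
  set W : ℝ := (haarWeight d h : ℝ) with hW
  set k := (Finset.univ.filter fun i => s i ≠ 0).card with hk
  have hk1 : 1 ≤ k := by
    rw [hk, Nat.one_le_iff_ne_zero, Finset.card_ne_zero]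
    by_contra hne
    rw [Finset.not_nonempty_iff_eq_empty, Finset.filter_eq_empty_iff] at hne
    have : ∑ i, s i = 0 := Finset.sum_eq_zero fun i hi => by simpa using hne hi
    omega
  have hkW : (2 : ℝ) ^ k ≤ W + 1 := by
    rw [hW]; exact_mod_cast two_pow_card_support_le hd hsh
  have h2k : (2 : ℝ) ≤ 2 ^ k := by
    calc (2 : ℝ) = 2 ^ 1 := by norm_num
      _ ≤ 2 ^ k := pow_le_pow_right₀ (by norm_num) hk1
  have hW1 : 1 ≤ W := by linarith
  have hθ1 : θ ≤ 1 := by nlinarith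
  have hc := cosh_sub_one_le_sq hθ hθ1
  have hc0 : 0 ≤ Real.cosh θ - 1 := by linarith [Real.one_le_cosh θ]
  have hv := haarVol_pos s
  have hvol : (2 : ℝ) ^ (∑ i, s i) * haarVol s = 2 ^ k := by
    rw [haarVol_eq]; field_simp; rw [hk]
  have hjv : (j : ℝ) * haarVol s ≤ 2 ^ k := by
    rw [← hvol]
    have : (j : ℝ) ≤ 2 ^ ∑ i, s i := by exact_mod_cast hj
    gcongr
  have hmain : (j : ℝ) * (3 / 2 * haarVol s * (Real.cosh θ - 1)) ≤ 2 / 3 := by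
    have h1 : (2 : ℝ) ^ k * θ ≤ 2 / 3 := by nlinarith
    calc (j : ℝ) * (3 / 2 * haarVol s * (Real.cosh θ - 1))
        = 3 / 2 * ((j : ℝ) * haarVol s) * (Real.cosh θ - 1) := by ring
      _ ≤ 3 / 2 * 2 ^ k * θ ^ 2 := by gcongr
      _ = 3 / 2 * (2 ^ k * θ) * θ := by ring
      _ ≤ 3 / 2 * (2 / 3) * (1 / 3) := by
          have : θ ≤ 1 / 3 := by nlinarith
          gcongr
      _ ≤ 2 / 3 := by norm_num
  calc (1 + 3 / 2 * haarVol s * (Real.cosh θ - 1)) ^ j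
      ≤ (Real.exp (3 / 2 * haarVol s * (Real.cosh θ - 1))) ^ j := by
        gcongr
        rw [add_comm]
        exact Real.add_one_le_exp _
    _ = Real.exp (j * (3 / 2 * haarVol s * (Real.cosh θ - 1))) := by rw [← Real.exp_nat_mul]
    _ ≤ Real.exp (Real.log 2) := Real.exp_le_exp.2 (by linarith [Real.log_two_gt_d9])
    _ = 2 := Real.exp_log (by norm_num)

section

variable {Ω : Type*} [MeasurableSpace Ω] {P : Measure Ω} [IsProbabilityMeasure P]
    {X : ℕ → Ω → Pt d} {U : ℕ → Ω → ℝ}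

lemma measurable_samplePairing (hd : 1 ≤ d) {β : ℝ} (h0 : 0 < β) (h1 : β ≤ 1)
    (hX : ∀ j, Measurable (X j)) (hU : ∀ j, Measurable (U j)) (s a : Fin d → ℕ) (n : ℕ) :
    Measurable fun ω => samplePairing β (fun j => X j ω) (fun j => U j ω) s a n := by
  have hV : Measurable fun ω => ((fun j => X j ω : ℕ → Pt d), (fun j => U j ω : ℕ → ℝ)) := by
    fun_prop
  exact (measurable_haarPairing s a).comp
    (((measurable_thinned fun n => (isThinningStrategy_haarStrategy hd h0 h1 n).1) n).comp hV).fst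

/-- The exponential moment of a pairing. -/
noncomputable def coshMoment (P : Measure Ω) (X : ℕ → Ω → Pt d) (U : ℕ → Ω → ℝ) (β θ : ℝ)
    (s a : Fin d → ℕ) (n : ℕ) : ENNReal :=
  ∫⁻ ω, ENNReal.ofReal
    (Real.cosh (θ * samplePairing β (fun j => X j ω) (fun j => U j ω) s a n)) ∂P

/-- Passes from a one-step bound that is uniform in the past to the unconditional moment. -/
lemma coshMoment_succ_le (hd : 1 ≤ d) {β : ℝ} (h0 : 0 < β) (h1 : β ≤ 1)
    (hX : ∀ j, Measurable (X j)) (hU : ∀ j, Measurable (U j))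
    (hXl : ∀ j, P.map (X j) = unifCube d) (hUl : ∀ j, P.map (U j) = volume.restrict (Set.Icc 0 1))
    (hXi : iIndepFun X P) (hUi : iIndepFun U P)
    (hXU : IndepFun (fun ω j => X j ω) (fun ω j => U j ω) P) (n : ℕ)
    {s a : Fin d → ℕ} (ha : ∀ i, 2 * a i + 1 ≤ 2 ^ s i) (hs : 1 ≤ ∑ i, s i) (θ : ℝ) {A B : ℝ}
    (hA : 0 ≤ A) (hB : 0 ≤ B)
    (hAB : ∀ z : Fin n → Pt d,
      ∫ x, Real.cosh (θ * (haarPairing z s a + haar s a x : ℤ)) * haarDensity β (n + 1) z x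
        ∂(unifCube d) ≤ A * Real.cosh (θ * haarPairing z s a) + B) :
    coshMoment P X U β θ s a (n + 1) ≤
      ENNReal.ofReal A * coshMoment P X U β θ s a n + ENNReal.ofReal B := by
  have hm : Measurable fun p : (Fin n → Pt d) × Pt d => ENNReal.ofReal
      (Real.cosh (θ * (haarPairing p.1 s a + haar s a p.2 : ℤ))) := by fun_prop
  have key := lintegral_sample_haarStrategy hd h0 h1 hX hU hXl hUl hXi hUi hXU n hm
  simp only [coshMoment, samplePairing_succ]
  simp only [samplePairing]
  rw [key, ← lintegral_const_mul']
  swap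
  · exact ENNReal.ofReal_ne_top
  rw [← mul_one (ENNReal.ofReal B), ← measure_univ (μ := P), ← lintegral_const,
    ← lintegral_add_right _ measurable_const]
  refine lintegral_mono fun ω => ?_
  set z := (thinned (haarStrategy d β) (fun j => X j ω) (fun j => U j ω) n).1
  simp only
  have hi := (integral_cosh_mul_haarDensity_le hd h0 h1 (n + 1) z ha hs θ).1
  have hnn : 0 ≤ᵐ[unifCube d] fun x =>
      Real.cosh (θ * (haarPairing z s a + haar s a x : ℤ)) * haarDensity β (n + 1) z x := by
    filter_upwards [ae_mem_cube] with x hx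
    have := haarDensity_bounds hd h0 h1 (n + 1) z hx
    exact mul_nonneg (Real.cosh_pos _).le (by linarith)
  simp only [← ENNReal.ofReal_mul (Real.cosh_pos _).le]
  rw [← ofReal_integral_eq_lintegral_ofReal hi hnn, ← ENNReal.ofReal_mul hA,
    ← ENNReal.ofReal_add (mul_nonneg hA (Real.cosh_pos _).le) hB]
  exact ENNReal.ofReal_le_ofReal (hAB z)

/-- There are two regimes. Until the drift on `H` sets in, the moment is multiplied by at most `1 +
y` per step; afterwards the bound `2` is reproduced by an affine map fixing `2`. -/
theorem coshMoment_le_two (hd : 1 ≤ d) {β : ℝ} (h0 : 0 < β) (h1 : β ≤ 1)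
    (hX : ∀ j, Measurable (X j)) (hU : ∀ j, Measurable (U j))
    (hXl : ∀ j, P.map (X j) = unifCube d) (hUl : ∀ j, P.map (U j) = volume.restrict (Set.Icc 0 1))
    (hXi : iIndepFun X P) (hUi : iIndepFun U P)
    (hXU : IndepFun (fun ω j => X j ω) (fun ω j => U j ω) P) {n : ℕ}
    {s a : Fin d → ℕ} (ha : ∀ i, 2 * a i + 1 ≤ 2 ^ s i) (hs : 1 ≤ ∑ i, s i)
    (hsn : ∑ i, s i ≤ Nat.log 2 n) {θ : ℝ} (hθ : 0 ≤ θ)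
    (hθW : 3 * (haarWeight d (Nat.log 2 n)) * θ ≤ β) :
    coshMoment P X U β θ s a n ≤ 2 := by
  set y := 3 / 2 * haarVol s * (Real.cosh θ - 1) with hy
  have hy0 : 0 ≤ y := by
    have := haarVol_pos s
    have : 0 ≤ Real.cosh θ - 1 := by linarith [Real.one_le_cosh θ]
    positivity
  -- The second conjunct carries the explicit growth through the first regime. The step from `j` to
  -- `j + 1` uses the density at time `j + 1`, hence the condition `j + 1 ≤ 2 ^ order`.
  have key : ∀ j ≤ n, coshMoment P X U β θ s a j ≤ 2 ∧ (j + 1 ≤ 2 ^ ∑ i, s i →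
      coshMoment P X U β θ s a j ≤ ENNReal.ofReal ((1 + y) ^ j)) := by
    intro j
    induction j with
    | zero =>
      intro _
      have : coshMoment P X U β θ s a 0 = 1 := by
        simp [coshMoment, samplePairing, haarPairing]
      rw [this]
      simp
    | succ j ih =>
      intro hj
      obtain ⟨ih1, ih2⟩ := ih (by omega)
      by_cases hlt : Nat.log 2 (j + 1) < ∑ i, s i
      · have hlt' : j + 1 < 2 ^ ∑ i, s i := Nat.lt_pow_of_log_lt (by norm_num) hlt
        have hstep : coshMoment P X U β θ s a (j + 1) ≤ ENNReal.ofReal ((1 + y) ^ (j + 1)) := by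
          refine (coshMoment_succ_le hd h0 h1 hX hU hXl hUl hXi hUi hXU j ha hs θ
            (A := 1 + y) (B := 0) (by linarith) le_rfl fun z => ?_).trans ?_
          · have := integral_cosh_mul_haarDensity_le_of_lt hd h0 h1 (j + 1) z ha hs θ hlt
            rwa [add_zero]
          · rw [ENNReal.ofReal_zero, add_zero, pow_succ', ENNReal.ofReal_mul (by linarith)]
            gcongr
            exact ih2 hlt'.le
        refine ⟨hstep.trans ?_, fun _ => hstep⟩
        rw [← ENNReal.ofReal_ofNat]
        exact ENNReal.ofReal_le_ofReal
          (growth_before_drift hd hs hsn hθ (hθW.trans h1) hlt'.le)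
      · push Not at hlt
        have hpow : 2 ^ ∑ i, s i ≤ j + 1 :=
          (Nat.pow_le_pow_right (by norm_num) hlt).trans (Nat.pow_log_le_self 2 (by omega))
        refine ⟨?_, fun h => by omega⟩
        have hW : 3 * (haarWeight d (Nat.log 2 (j + 1))) * θ ≤ β := by
          refine le_trans ?_ hθW
          have : haarWeight d (Nat.log 2 (j + 1)) ≤ haarWeight d (Nat.log 2 n) :=
            haarWeight_mono d (Nat.log_mono_right hj)
          gcongr
        obtain ⟨B, hB0, hB1, hB⟩ := integral_cosh_mul_haarDensity_le_of_le (k := j)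
          hd h0 h1 (j + 1) ha hs hθ hlt hW
        refine (coshMoment_succ_le hd h0 h1 hX hU hXl hUl hXi hUi hXU j ha hs θ
          (by linarith) hB0 hB).trans ?_
        calc ENNReal.ofReal (1 - B / 2) * coshMoment P X U β θ s a j + ENNReal.ofReal B
            ≤ ENNReal.ofReal (1 - B / 2) * ENNReal.ofReal 2 + ENNReal.ofReal B := by
              gcongr
              rwa [ENNReal.ofReal_ofNat]
          _ = ENNReal.ofReal ((1 - B / 2) * 2 + B) := by
              rw [← ENNReal.ofReal_mul (by linarith), ← ENNReal.ofReal_add (by linarith) hB0]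
          _ = 2 := by
              rw [show (1 - B / 2) * 2 + B = 2 by ring, ENNReal.ofReal_ofNat]
  exact (key n le_rfl).1

/-- Markov's inequality for `cosh(θM)`, together with `2 / cosh y ≤ 4 exp(-y)`. -/
theorem measure_samplePairing_ge_le (hd : 1 ≤ d) {β : ℝ} (h0 : 0 < β) (h1 : β ≤ 1)
    (hX : ∀ j, Measurable (X j)) (hU : ∀ j, Measurable (U j))
    (hXl : ∀ j, P.map (X j) = unifCube d) (hUl : ∀ j, P.map (U j) = volume.restrict (Set.Icc 0 1))
    (hXi : iIndepFun X P) (hUi : iIndepFun U P)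
    (hXU : IndepFun (fun ω j => X j ω) (fun ω j => U j ω) P) {n : ℕ}
    {s a : Fin d → ℕ} (ha : ∀ i, 2 * a i + 1 ≤ 2 ^ s i) (hs : 1 ≤ ∑ i, s i)
    (hsn : ∑ i, s i ≤ Nat.log 2 n) {θ : ℝ} (hθ : 0 ≤ θ)
    (hθW : 3 * (haarWeight d (Nat.log 2 n)) * θ ≤ β) {t : ℝ} (ht : 0 ≤ t) :
    P {ω | t ≤ |(samplePairing β (fun j => X j ω) (fun j => U j ω) s a n : ℝ)|} ≤
      ENNReal.ofReal (4 * Real.exp (-(θ * t))) := by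
  have hm := measurable_samplePairing hd h0 h1 hX hU s a n
  have hmom := coshMoment_le_two hd h0 h1 hX hU hXl hUl hXi hUi hXU ha hs hsn hθ hθW
  have hc := Real.cosh_pos (θ * t)
  have hsub : {ω | t ≤ |(samplePairing β (fun j => X j ω) (fun j => U j ω) s a n : ℝ)|} ⊆
      {ω | ENNReal.ofReal (Real.cosh (θ * t)) ≤ ENNReal.ofReal (Real.cosh
        (θ * samplePairing β (fun j => X j ω) (fun j => U j ω) s a n))} := by
    intro ω hω
    refine ENNReal.ofReal_le_ofReal (Real.cosh_le_cosh.2 ?_)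
    rw [abs_mul, abs_mul, abs_of_nonneg ht]
    exact mul_le_mul_of_nonneg_left hω (abs_nonneg θ)
  refine (measure_mono hsub).trans ((meas_ge_le_lintegral_div
    ((measurable_of_countable fun i : ℤ =>
      ENNReal.ofReal (Real.cosh (θ * i))).comp hm).aemeasurable
    (by simpa using hc) ENNReal.ofReal_ne_top).trans ?_)
  refine (ENNReal.div_le_div_right hmom _).trans ?_
  rw [← ENNReal.ofReal_ofNat, ← ENNReal.ofReal_div_of_pos hc]
  refine ENNReal.ofReal_le_ofReal ?_
  rw [div_le_iff₀ hc, Real.cosh_eq]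
  have h1 : Real.exp (-(θ * t)) * Real.exp (θ * t) = 1 := by rw [← Real.exp_add]; simp
  nlinarith [Real.exp_pos (-(θ * t)), mul_self_nonneg (Real.exp (-(θ * t)))]

end

/-! ### From Haar pairings to the discrepancy -/

lemma haarOne_zero_zero {x : ℝ} (hx : x ∈ Set.Ico (0 : ℝ) 1) : haarOne 0 0 x = 1 := by
  rw [haarOne_eq 0 0 hx.1, dyadic_zero hx]; simp

/-- The Haar expansion of the indicator function of a dyadic interval has coefficients of total
absolute value at most one. -/
lemma exists_haar_expansion (s : ℕ) : ∀ k < 2 ^ s, ∃ (c : ℕ → ℝ) (a : ℕ → ℕ),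
    c 0 = 1 / 2 ^ s ∧ a 0 = 0 ∧ (∀ j ≤ s, 2 * a j + 1 ≤ 2 ^ j) ∧
    ∑ j ∈ Finset.range (s + 1), |c j| ≤ 1 ∧
    ∀ x ∈ Set.Ico (0 : ℝ) 1, (if dyadic s x = k then (1 : ℝ) else 0) =
      ∑ j ∈ Finset.range (s + 1), c j * haarOne j (a j) x := by
  induction s with
  | zero =>
    intro k hk
    obtain rfl : k = 0 := by simpa using hk
    refine ⟨fun _ => 1, fun _ => 0, by simp, rfl, by simp, by simp, fun x hx => ?_⟩
    simp [dyadic_zero hx, haarOne_zero_zero hx]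
  | succ s ih =>
    intro k hk
    obtain ⟨c, a, h0, ha0, ha, hc, hx⟩ := ih (k / 2) (by rw [pow_succ] at hk; omega)
    -- The indicator of a half is half the sum of the indicator of its parent and the signed Haar
    -- function of the parent; the parity of `k` gives the sign. The old coefficients are halved and
    -- a new one of size `1/2` appears, so the total stays at most `1`.
    refine ⟨fun j => if j = s + 1 then (-1) ^ k / 2 else c j / 2,
      fun j => if j = s + 1 then k / 2 else a j, ?_, ?_, ?_, ?_, ?_⟩
    · simp only [(Nat.succ_ne_zero s).symm, if_false, h0, pow_succ]
      field_simp
    · simp [ha0]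
    · intro j hj
      simp only
      split_ifs with h
      · subst h
        rw [pow_succ] at hk ⊢
        omega
      · exact ha j (by omega)
    · rw [Finset.sum_range_succ, Finset.sum_congr rfl (g := fun j => |c j| / 2)]
      · simp only [if_true, ← Finset.sum_div, abs_div, abs_pow, abs_neg, abs_one, one_pow]
        norm_num
        linarith
      · intro j hj
        have hj' : j ≠ s + 1 := by have := Finset.mem_range.1 hj; omega
        simp only [if_neg hj']
        rw [abs_div, abs_two]
    · intro x hx'
      rw [Finset.sum_range_succ, Finset.sum_congr rfl
        (g := fun j => c j * haarOne j (a j) x / 2)]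
      · rw [← Finset.sum_div, ← hx x hx']
        simp only [if_true]
        rw [haarOne_eq (s + 1) (k / 2) hx'.1, dyadic_succ_div_two]
        have h2 := dyadic_succ_div_two s x
        by_cases h : dyadic s x = k / 2
        · rw [if_pos h, if_pos h.symm]
          by_cases hk' : dyadic (s + 1) x = k
          · rw [if_pos hk', hk']
            push_cast
            rw [div_mul_eq_mul_div, ← pow_add, ← two_mul, pow_mul]
            norm_num
          · rw [if_neg hk']
            have hsum : Odd (k + dyadic (s + 1) x) := by
              rw [Nat.odd_iff]; omega
            push_cast
            rw [div_mul_eq_mul_div, ← pow_add, hsum.neg_one_pow]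
            norm_num
        · rw [if_neg h, if_neg (Ne.symm h), if_neg (by rintro rfl; exact h h2.symm)]
          simp
      · intro j hj
        have hj' : j ≠ s + 1 := by have := Finset.mem_range.1 hj; omega
        simp only [if_neg hj']
        ring

/-- The error made when the number of points in a product set with indicator functions `g i` is
estimated by the volume of a product with side lengths `v i`. -/
noncomputable def countErr (z : ℕ → Pt d) (n : ℕ) (g : Fin d → ℝ → ℝ) (v : Fin d → ℝ) : ℝ :=
  ∑ j ∈ Finset.range n, ∏ i, g i (z j i) - n * ∏ i, v i

/-- `g` is the indicator function of a dyadic interval of length `v = 2⁻ˢ`. -/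
def IsDyadicInd (s : ℕ) (g : ℝ → ℝ) (v : ℝ) : Prop :=
  ∃ k < 2 ^ s, (∀ x ∈ Set.Ico (0 : ℝ) 1, g x = if dyadic s x = k then 1 else 0) ∧ v = 1 / 2 ^ s

/-- `g` is the indicator function of an interval of length `v`. -/
def IsIntervalInd (g : ℝ → ℝ) (v : ℝ) : Prop :=
  ∃ a b : ℝ, 0 ≤ a ∧ a ≤ b ∧ b ≤ 1 ∧
    (∀ x ∈ Set.Ico (0 : ℝ) 1, g x = if a ≤ x ∧ x < b then 1 else 0) ∧ v = b - a

variable {z : ℕ → Pt d} {n h : ℕ} {t : ℝ}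

/-- Expanding the product of the one-dimensional expansions, the term of order `0` is exactly `n`
times the volume. Each other pairing is at most `t`, and the coefficients have total absolute value
at most `1`. -/
lemma abs_countErr_dyadic_le (hz : ∀ j < n, z j ∈ cube d) (ht : 0 ≤ t)
    (hM : ∀ s a : Fin d → ℕ, (∀ i, 2 * a i + 1 ≤ 2 ^ s i) → 1 ≤ ∑ i, s i → ∑ i, s i ≤ h →
      |((∑ j ∈ Finset.range n, haar s a (z j) : ℤ) : ℝ)| ≤ t)
    {g : Fin d → ℝ → ℝ} {v : Fin d → ℝ} {s : Fin d → ℕ}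
    (hg : ∀ i, IsDyadicInd (s i) (g i) (v i)) (hs : ∑ i, s i ≤ h) : |countErr z n g v| ≤ t := by
  choose k hk hgk hv using hg
  choose c a hc0 ha0 ha hc hx using fun i => exists_haar_expansion (s i) (k i) (hk i)
  set S : Finset (Fin d → ℕ) := Fintype.piFinset fun i => Finset.range (s i + 1) with hS
  set M : (Fin d → ℕ) → ℝ := fun p =>
    ((∑ j ∈ Finset.range n, haar p (fun i => a i (p i)) (z j) : ℤ) : ℝ) with hMdef
  have h1 : ∑ j ∈ Finset.range n, ∏ i, g i (z j i) = ∑ p ∈ S, (∏ i, c i (p i)) * M p := by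
    simp only [hMdef, Int.cast_sum, Finset.mul_sum]
    rw [Finset.sum_comm]
    refine Finset.sum_congr rfl fun j hj => ?_
    have hzj := mem_cube.1 (hz j (Finset.mem_range.1 hj))
    rw [Finset.prod_congr rfl fun i _ => (hgk i _ (hzj i)).trans (hx i _ (hzj i)),
      Finset.prod_univ_sum]
    refine Finset.sum_congr rfl fun p _ => ?_
    rw [Finset.prod_mul_distrib, haar, Int.cast_prod]
  have h0S : (0 : Fin d → ℕ) ∈ S := by simp [hS]
  have h0 : (∏ i, c i ((0 : Fin d → ℕ) i)) * M 0 = n * ∏ i, v i := by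
    have hM0 : M 0 = n := by
      simp only [hMdef]
      rw [Finset.sum_congr rfl (g := fun _ => (1 : ℤ))]
      · simp
      · intro j hj
        have hzj := mem_cube.1 (hz j (Finset.mem_range.1 hj))
        refine Finset.prod_eq_one fun i _ => ?_
        simp only [Pi.zero_apply, ha0]
        exact haarOne_zero_zero (hzj i)
    rw [hM0, mul_comm]
    simp only [Pi.zero_apply, hc0, hv]
  rw [countErr, h1, ← Finset.add_sum_erase _ _ h0S, h0, add_sub_cancel_left]
  calc |∑ p ∈ S.erase 0, (∏ i, c i (p i)) * M p|
      ≤ ∑ p ∈ S.erase 0, |(∏ i, c i (p i)) * M p| := Finset.abs_sum_le_sum_abs _ _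
    _ ≤ ∑ p ∈ S.erase 0, (∏ i, |c i (p i)|) * t := by
        refine Finset.sum_le_sum fun p hp => ?_
        rw [abs_mul, Finset.abs_prod]
        refine mul_le_mul_of_nonneg_left ?_ (Finset.prod_nonneg fun _ _ => abs_nonneg _)
        have hpS := Fintype.mem_piFinset.1 (Finset.mem_of_mem_erase hp)
        have hps : ∀ i, p i ≤ s i := fun i => Nat.lt_succ_iff.1 (Finset.mem_range.1 (hpS i))
        refine hM p _ (fun i => ha i _ (hps i)) ?_
          ((Finset.sum_le_sum fun i _ => hps i).trans hs)
        rw [Nat.one_le_iff_ne_zero]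
        intro h0
        refine Finset.ne_of_mem_erase hp (funext fun i => ?_)
        simpa using (Finset.sum_eq_zero_iff.1 h0) i (Finset.mem_univ i)
    _ ≤ ∑ p ∈ S, (∏ i, |c i (p i)|) * t :=
        Finset.sum_le_sum_of_subset_of_nonneg (Finset.erase_subset _ _) fun _ _ _ =>
          mul_nonneg (Finset.prod_nonneg fun _ _ => abs_nonneg _) ht
    _ = (∏ i, ∑ j ∈ Finset.range (s i + 1), |c i j|) * t := by
        rw [Finset.prod_univ_sum, Finset.sum_mul]
    _ ≤ 1 * t := mul_le_mul_of_nonneg_right (Finset.prod_le_one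
        (fun i _ => Finset.sum_nonneg fun _ _ => abs_nonneg _) fun i _ => hc i) ht
    _ = t := one_mul t

/-- Displays the error as a linear function of the pair `(φ, w)` in the coordinate `i`, so that an
interval can be cut in this coordinate. -/
lemma countErr_update (g : Fin d → ℝ → ℝ) (v : Fin d → ℝ) (i : Fin d) (φ : ℝ → ℝ) (w : ℝ) :
    countErr z n (Function.update g i φ) (Function.update v i w) =
      ∑ j ∈ Finset.range n, φ (z j i) * ∏ l ∈ Finset.univ.erase i, g l (z j l) -
        n * (w * ∏ l ∈ Finset.univ.erase i, v l) := by
  rw [countErr, ← Finset.mul_prod_erase _ (Function.update v i w) (Finset.mem_univ i),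
    Function.update_self]
  congr 1
  · refine Finset.sum_congr rfl fun j _ => ?_
    rw [← Finset.mul_prod_erase _ _ (Finset.mem_univ i), Function.update_self]
    congr 1
    exact Finset.prod_congr rfl fun l hl => by
      rw [Function.update_of_ne (Finset.ne_of_mem_erase hl)]
  · congr 2
    exact Finset.prod_congr rfl fun l hl => by
      rw [Function.update_of_ne (Finset.ne_of_mem_erase hl)]

/-- The binary digits of `b` cut the initial interval: level `l` contributes one interval precisely
when the digit is `1`, namely the left sibling of the interval containing `b`. Level `0` takes care
of `b = 1`. -/
lemma ind_lt_dyadic_eq_sum {b : ℝ} (hb : b ≤ 1) (r : ℕ) {x : ℝ} (hx : x ∈ Set.Ico (0 : ℝ) 1) :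
    (if dyadic r x < dyadic r b then (1 : ℝ) else 0) = ∑ l ∈ Finset.range (r + 1),
      (dyadic l b % 2 : ℕ) * (if dyadic l x = 2 * (dyadic l b / 2) then (1 : ℝ) else 0) := by
  induction r with
  | zero =>
    have h1 : dyadic 0 b ≤ 1 := by
      rw [dyadic, pow_zero, mul_one]
      exact Nat.floor_le_of_le (by simpa using hb)
    simp only [Finset.sum_range_succ, Finset.sum_range_zero, dyadic_zero hx, zero_add]
    interval_cases dyadic 0 b <;> simp
  | succ r ih =>
    rw [Finset.sum_range_succ, ← ih]
    have h1 := dyadic_succ_div_two r x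
    have h2 := dyadic_succ_div_two r b
    rcases Nat.mod_two_eq_zero_or_one (dyadic (r + 1) b) with h | h <;> rw [h] <;>
      split_ifs <;> first | omega | norm_num

lemma dyadic_div_eq_sum {b : ℝ} (hb : b ≤ 1) (r : ℕ) :
    (dyadic r b : ℝ) / 2 ^ r = ∑ l ∈ Finset.range (r + 1), (dyadic l b % 2 : ℕ) * (1 / 2 ^ l : ℝ) := by
  induction r with
  | zero =>
    have h1 : dyadic 0 b ≤ 1 := by
      rw [dyadic, pow_zero, mul_one]
      exact Nat.floor_le_of_le (by simpa using hb)
    simp only [Finset.sum_range_succ, Finset.sum_range_zero]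
    interval_cases dyadic 0 b <;> simp
  | succ r ih =>
    rw [Finset.sum_range_succ, ← ih]
    have h : dyadic (r + 1) b = 2 * dyadic r b + dyadic (r + 1) b % 2 := by
      have := dyadic_succ_div_two r b
      omega
    have h' : (dyadic (r + 1) b : ℝ) = 2 * dyadic r b + (dyadic (r + 1) b % 2 : ℕ) := by
      exact_mod_cast h
    rw [h', pow_succ]
    field_simp

lemma dyadic_mono (r : ℕ) {x y : ℝ} (h : x ≤ y) : dyadic r x ≤ dyadic r y :=
  Nat.floor_le_floor (by gcongr)

lemma dyadic_le {b : ℝ} (hb : b ≤ 1) (r : ℕ) : dyadic r b ≤ 2 ^ r := by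
  have h := dyadic_mono r hb
  rw [dyadic, dyadic, one_mul] at h
  have : ⌊(2 : ℝ) ^ r⌋₊ = 2 ^ r := by
    rw [show (2 : ℝ) ^ r = ((2 ^ r : ℕ) : ℝ) by push_cast; rfl, Nat.floor_natCast]
  rwa [this] at h

/-- Cutting `[0, b)` along the digits of `b` leaves at most one dyadic interval on each level `l ≤
r`, and a remainder inside a single interval of level `r`. The bounds for these pieces are left as
hypotheses, to be supplied by the induction over the coordinates. -/
lemma abs_countErr_anchored_le (hz : ∀ j < n, z j ∈ cube d) (g : Fin d → ℝ → ℝ) (v : Fin d → ℝ)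
    (i : Fin d) {b : ℝ} (hb0 : 0 ≤ b) (hb : b ≤ 1) (r : ℕ) (N : ℕ → ℝ) (N' : ℝ)
    (hN0 : ∀ l ≤ r, 0 ≤ N l)
    (hN : ∀ l ≤ r, ∀ k < 2 ^ l, |countErr z n
      (Function.update g i fun x => if dyadic l x = k then 1 else 0)
      (Function.update v i (1 / 2 ^ l))| ≤ N l)
    (hN' : ∀ k < 2 ^ r, ∀ (φ : ℝ → ℝ) (w : ℝ), (∀ x ∈ Set.Ico (0 : ℝ) 1, 0 ≤ φ x ∧
      φ x ≤ if dyadic r x = k then 1 else 0) → 0 ≤ w → w ≤ 1 / 2 ^ r →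
      |countErr z n (Function.update g i φ) (Function.update v i w)| ≤ N') :
    |countErr z n (Function.update g i fun x => if x < b then 1 else 0) (Function.update v i b)| ≤
      ∑ l ∈ Finset.range (r + 1), N l + N' := by
  set φ : ℝ → ℝ := fun x => (if x < b then 1 else 0) - if dyadic r x < dyadic r b then 1 else 0
    with hφ
  set w : ℝ := b - dyadic r b / 2 ^ r with hw
  have hsplit : countErr z n (Function.update g i fun x => if x < b then 1 else 0)
      (Function.update v i b) =
      ∑ l ∈ Finset.range (r + 1), (dyadic l b % 2 : ℕ) * countErr z n
        (Function.update g i fun x => if dyadic l x = 2 * (dyadic l b / 2) then 1 else 0)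
        (Function.update v i (1 / 2 ^ l)) +
      countErr z n (Function.update g i φ) (Function.update v i w) := by
    simp only [countErr_update, mul_sub, Finset.sum_sub_distrib, Finset.mul_sum, hφ, sub_mul]
    rw [Finset.sum_comm]
    have h1 : ∑ j ∈ Finset.range n, (if dyadic r (z j i) < dyadic r b then (1 : ℝ) else 0) *
        ∏ l ∈ Finset.univ.erase i, g l (z j l) =
        ∑ j ∈ Finset.range n, ∑ l ∈ Finset.range (r + 1), ((dyadic l b % 2 : ℕ) : ℝ) *
          ((if dyadic l (z j i) = 2 * (dyadic l b / 2) then 1 else 0) *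
            ∏ l ∈ Finset.univ.erase i, g l (z j l)) := by
      refine Finset.sum_congr rfl fun j hj => ?_
      rw [ind_lt_dyadic_eq_sum hb r (mem_cube.1 (hz j (Finset.mem_range.1 hj)) i), Finset.sum_mul]
      exact Finset.sum_congr rfl fun l _ => by ring
    have h2 : (n : ℝ) * (w * ∏ l ∈ Finset.univ.erase i, v l) =
        n * (b * ∏ l ∈ Finset.univ.erase i, v l) - ∑ l ∈ Finset.range (r + 1),
        ((dyadic l b % 2 : ℕ) : ℝ) * (n * (1 / 2 ^ l * ∏ l ∈ Finset.univ.erase i, v l)) := by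
      rw [hw, dyadic_div_eq_sum hb r, sub_mul, mul_sub, Finset.sum_mul, Finset.mul_sum]
      congr 1
      exact Finset.sum_congr rfl fun l _ => by ring
    rw [h1, h2]
    ring
  rw [hsplit]
  refine (abs_add_le _ _).trans (add_le_add ((Finset.abs_sum_le_sum_abs _ _).trans
    (Finset.sum_le_sum fun l hl => ?_)) ?_)
  · have hl' : l ≤ r := Nat.lt_succ_iff.1 (Finset.mem_range.1 hl)
    rcases Nat.mod_two_eq_zero_or_one (dyadic l b) with h | h
    · rw [h]; simpa using hN0 l hl'
    · rw [h, Nat.cast_one, one_mul]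
      refine hN l hl' _ ?_
      have := dyadic_le hb l
      omega
  · have hpow : (0 : ℝ) < 2 ^ r := by positivity
    have hfl : (dyadic r b : ℝ) ≤ b * 2 ^ r := Nat.floor_le (by positivity)
    have hfl' : b * 2 ^ r < dyadic r b + 1 := Nat.lt_floor_add_one _
    have hle : ∀ x, x < b → dyadic r x ≤ dyadic r b := fun x hx => dyadic_mono r hx.le
    have hlt : ∀ x, dyadic r x < dyadic r b → x < b := fun x hx => by
      by_contra hc
      exact absurd (dyadic_mono r (not_lt.1 hc)) (not_le.2 hx)
    have hdl := dyadic_le hb r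
    -- For `b = 1` the index `dyadic r b` is out of range, but then the remainder vanishes on `[0,
    -- 1)` and any index will do.
    refine hN' (if dyadic r b < 2 ^ r then dyadic r b else 0) ?_ φ w (fun x hx => ?_) ?_ ?_
    · split_ifs with h
      · exact h
      · positivity
    · have h1 := hle x
      have h2 := hlt x
      have h3 := dyadic_lt r hx
      simp only [hφ]
      by_cases hxb : x < b
      · have h4 := h1 hxb
        rw [if_pos hxb]
        by_cases h5 : dyadic r x < dyadic r b
        · rw [if_pos h5]
          split_ifs <;> norm_num
        · rw [if_neg h5, if_pos (show dyadic r b < 2 ^ r by omega), if_pos (show _ = _ by omega)]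
          norm_num
      · rw [if_neg hxb, if_neg (fun h => hxb (h2 h))]
        split_ifs <;> norm_num
    · rw [hw, sub_nonneg, div_le_iff₀ hpow]
      exact hfl
    · rw [hw, sub_le_iff_le_add, ← add_div, le_div_iff₀ hpow]
      linarith

/-- The hockey-stick identity that closes the induction over the coordinates; the leading `1` pays
for the remainder of the digit expansion. -/
lemma one_add_sum_choose (r m : ℕ) :
    1 + ∑ l ∈ Finset.range (r + 1), (r - l + 1 + m).choose m = (r + 1 + (m + 1)).choose (m + 1) := by
  rw [← Finset.sum_range_reflect]
  rw [Finset.sum_congr rfl (g := fun l => (l + 1 + m).choose m)]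
  · have h := Nat.sum_range_add_choose (r + 1) m
    rw [Finset.sum_range_succ'] at h
    simp only [zero_add, Nat.choose_self] at h
    rw [add_comm 1, h]
    congr 1
  · intro l hl
    have := Finset.mem_range.1 hl
    congr 1
    omega

/-- Induction on the set `J` of sides that are not yet dyadic. The number `r = h - ∑ s i` is the
order still available: a side cut at level `l` leaves `r - l` for the others. Each side costs a
factor `2`, because `[a, b)` is the difference of `[0, b)` and `[0, a)`. -/
theorem abs_countErr_le (hz : ∀ j < n, z j ∈ cube d) (ht : 0 ≤ t) (hn : n ≤ 2 ^ (h + 1))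
    (hM : ∀ s a : Fin d → ℕ, (∀ i, 2 * a i + 1 ≤ 2 ^ s i) → 1 ≤ ∑ i, s i → ∑ i, s i ≤ h →
      |((∑ j ∈ Finset.range n, haar s a (z j) : ℤ) : ℝ)| ≤ t) (J : Finset (Fin d)) :
    ∀ (g : Fin d → ℝ → ℝ) (v : Fin d → ℝ) (s : Fin d → ℕ),
      (∀ i ∉ J, IsDyadicInd (s i) (g i) (v i)) →
      (∀ i ∈ J, s i = 0 ∧ IsIntervalInd (g i) (v i)) → ∑ i, s i ≤ h →
      |countErr z n g v| ≤
        2 ^ J.card * ((h - ∑ i, s i + 1 + J.card).choose J.card : ℝ) * (t + 2) := by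
  induction J using Finset.induction_on with
  | empty =>
    intro g v s hg _ hs
    have := abs_countErr_dyadic_le hz ht hM (fun i => hg i (by simp)) hs
    simp
    linarith
  | insert i J hiJ ih =>
    intro g v s hg hgJ hs
    obtain ⟨hsi, a, b, ha, hab, hb, hgi, hvi⟩ := hgJ i (Finset.mem_insert_self i J)
    set r := h - ∑ i, s i with hr
    have hsupd : ∀ l, ∑ i', Function.update s i l i' = ∑ i, s i + l := by
      intro l
      rw [← Finset.add_sum_erase _ _ (Finset.mem_univ i), Function.update_self,
        ← Finset.add_sum_erase _ s (Finset.mem_univ i), hsi, zero_add, add_comm]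
      congr 1
      exact Finset.sum_congr rfl fun j hj => by
        rw [Function.update_of_ne (Finset.ne_of_mem_erase hj)]
    have hanchor : ∀ b : ℝ, 0 ≤ b → b ≤ 1 →
        |countErr z n (Function.update g i fun x => if x < b then 1 else 0)
          (Function.update v i b)| ≤
        2 ^ J.card * ((r + 1 + (J.card + 1)).choose (J.card + 1) : ℝ) * (t + 2) := by
      intro b hb0 hb1
      refine (abs_countErr_anchored_le hz g v i hb0 hb1 r
        (fun l => 2 ^ J.card * ((r - l + 1 + J.card).choose J.card : ℝ) * (t + 2)) (t + 2)
        (fun l _ => by positivity) ?_ ?_).trans ?_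
      · intro l hl k hk
        have h1 := ih (Function.update g i fun x => if dyadic l x = k then 1 else 0)
          (Function.update v i (1 / 2 ^ l)) (Function.update s i l) ?_ ?_ ?_
        · rw [hsupd] at h1
          have : h - (∑ i, s i + l) = r - l := by omega
          rwa [this] at h1
        · intro i' hi'
          by_cases h : i' = i
          · subst h
            simp only [Function.update_self]
            exact ⟨k, hk, fun _ _ => rfl, rfl⟩
          · simp only [Function.update_of_ne h]
            exact hg i' (by simp [h, hi'])
        · intro i' hi'
          have h : i' ≠ i := by rintro rfl; exact hiJ hi'
          simp only [Function.update_of_ne h]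
          exact hgJ i' (Finset.mem_insert_of_mem hi')
        · rw [hsupd]; omega
      · intro k hk φ w hφ hw0 hw
        -- The remainder in the coordinate `i` is enlarged to its dyadic interval, and the sides
        -- that are still arbitrary to `[0, 1)`. This gives a dyadic box of order exactly `h`.
        set g' : Fin d → ℝ → ℝ := fun i' => if i' ∈ J then fun _ => 1 else
          Function.update g i (fun x => if dyadic r x = k then 1 else 0) i' with hg'
        set v' : Fin d → ℝ := fun i' => if i' ∈ J then 1 else
          Function.update v i (1 / 2 ^ r) i' with hv'
        have hs' : ∑ i', Function.update s i r i' = h := by rw [hsupd]; omega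
        have hdy : ∀ i', IsDyadicInd (Function.update s i r i') (g' i') (v' i') := by
          intro i'
          simp only [hg', hv']
          by_cases hJ : i' ∈ J
          · have h : i' ≠ i := by rintro rfl; exact hiJ hJ
            rw [if_pos hJ, if_pos hJ, Function.update_of_ne h,
              (hgJ i' (Finset.mem_insert_of_mem hJ)).1]
            exact ⟨0, by simp, fun x hx => by simp [dyadic_zero hx], by simp⟩
          · rw [if_neg hJ, if_neg hJ]
            by_cases h : i' = i
            · subst h
              simp only [Function.update_self]
              exact ⟨k, hk, fun _ _ => rfl, rfl⟩
            · simp only [Function.update_of_ne h]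
              exact hg i' (by simp [h, hJ])
        have hbox := abs_countErr_dyadic_le hz ht hM hdy hs'.le
        have hv'prod : ∏ i', v' i' = 1 / 2 ^ h := by
          rw [← hs', ← Finset.prod_pow_eq_pow_sum, one_div, ← Finset.prod_inv_distrib]
          refine Finset.prod_congr rfl fun i' _ => ?_
          obtain ⟨_, _, _, h⟩ := hdy i'
          rw [h, one_div]
        -- Here `n ≤ 2 ^ (h + 1)` enters: a box of volume `2 ^ (-h)` has at most two expected
        -- points. Count and volume of the remainder lie between `0` and those of the enlarged box,
        -- so its error is at most `t + 2`.
        have hn2 : (n : ℝ) * ∏ i', v' i' ≤ 2 := by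
          rw [hv'prod, mul_one_div, div_le_iff₀ (by positivity)]
          have : (n : ℝ) ≤ 2 ^ (h + 1) := by exact_mod_cast hn
          rw [pow_succ] at this
          linarith
        have hgcmp : ∀ i', ∀ x ∈ Set.Ico (0 : ℝ) 1,
            0 ≤ Function.update g i φ i' x ∧ Function.update g i φ i' x ≤ g' i' x := by
          intro i' x hx
          simp only [hg']
          by_cases h : i' = i
          · subst h
            rw [if_neg hiJ, Function.update_self, Function.update_self]
            exact hφ x hx
          · rw [Function.update_of_ne h, Function.update_of_ne h]
            by_cases hJ : i' ∈ J
            · rw [if_pos hJ]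
              obtain ⟨_, a', b', _, _, _, hg1, _⟩ := hgJ i' (Finset.mem_insert_of_mem hJ)
              rw [hg1 x hx]
              split_ifs <;> norm_num
            · rw [if_neg hJ]
              obtain ⟨k', _, hg1, _⟩ := hg i' (by simp [h, hJ])
              rw [hg1 x hx]
              split_ifs <;> norm_num
        have hvcmp : ∀ i', 0 ≤ Function.update v i w i' ∧ Function.update v i w i' ≤ v' i' := by
          intro i'
          simp only [hv']
          by_cases h : i' = i
          · subst h
            rw [if_neg hiJ, Function.update_self, Function.update_self]
            exact ⟨hw0, hw⟩
          · rw [Function.update_of_ne h, Function.update_of_ne h]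
            by_cases hJ : i' ∈ J
            · rw [if_pos hJ]
              obtain ⟨_, a', b', h1, h2, h3, _, h4⟩ := hgJ i' (Finset.mem_insert_of_mem hJ)
              rw [h4]
              constructor <;> linarith
            · rw [if_neg hJ]
              obtain ⟨k', _, _, h4⟩ := hg i' (by simp [h, hJ])
              rw [h4]
              exact ⟨by positivity, le_rfl⟩
        have hc0 : 0 ≤ ∑ j ∈ Finset.range n, ∏ i', Function.update g i φ i' (z j i') :=
          Finset.sum_nonneg fun j hj => Finset.prod_nonneg fun i' _ =>
            (hgcmp i' _ (mem_cube.1 (hz j (Finset.mem_range.1 hj)) i')).1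
        have hc1 : ∑ j ∈ Finset.range n, ∏ i', Function.update g i φ i' (z j i') ≤
            ∑ j ∈ Finset.range n, ∏ i', g' i' (z j i') :=
          Finset.sum_le_sum fun j hj => Finset.prod_le_prod
            (fun i' _ => (hgcmp i' _ (mem_cube.1 (hz j (Finset.mem_range.1 hj)) i')).1)
            (fun i' _ => (hgcmp i' _ (mem_cube.1 (hz j (Finset.mem_range.1 hj)) i')).2)
        have hv0 : 0 ≤ ∏ i', Function.update v i w i' :=
          Finset.prod_nonneg fun i' _ => (hvcmp i').1
        have hv1 : (n : ℝ) * ∏ i', Function.update v i w i' ≤ n * ∏ i', v' i' :=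
          mul_le_mul_of_nonneg_left (Finset.prod_le_prod (fun i' _ => (hvcmp i').1)
            (fun i' _ => (hvcmp i').2)) (Nat.cast_nonneg n)
        have hv2 : 0 ≤ (n : ℝ) * ∏ i', Function.update v i w i' := by positivity
        rw [countErr] at hbox ⊢
        rw [abs_le] at hbox ⊢
        constructor <;> linarith [hbox.1, hbox.2]
      · have h1 := one_add_sum_choose r J.card
        have h2 : (1 : ℝ) + ∑ l ∈ Finset.range (r + 1), ((r - l + 1 + J.card).choose J.card : ℝ) =
            ((r + 1 + (J.card + 1)).choose (J.card + 1) : ℝ) := by exact_mod_cast h1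
        rw [← h2, ← Finset.sum_mul, ← Finset.mul_sum]
        have h3 : (1 : ℝ) ≤ 2 ^ J.card := one_le_pow₀ (by norm_num)
        nlinarith
    have heq : countErr z n g v =
        countErr z n (Function.update g i fun x => if x < b then 1 else 0) (Function.update v i b) -
        countErr z n (Function.update g i fun x => if x < a then 1 else 0)
          (Function.update v i a) := by
      conv_lhs => rw [← Function.update_eq_self i g, ← Function.update_eq_self i v]
      simp only [countErr_update]
      rw [hvi, Finset.sum_congr rfl (g := fun j =>
        (if z j i < b then (1 : ℝ) else 0) * ∏ l ∈ Finset.univ.erase i, g l (z j l) -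
        (if z j i < a then (1 : ℝ) else 0) * ∏ l ∈ Finset.univ.erase i, g l (z j l))]
      · rw [Finset.sum_sub_distrib]
        ring
      · intro j hj
        rw [hgi _ (mem_cube.1 (hz j (Finset.mem_range.1 hj)) i), ← sub_mul]
        congr 1
        by_cases h1 : z j i < a
        · rw [if_neg fun h => absurd h1 (not_lt.2 h.1), if_pos (h1.trans_le hab), if_pos h1, sub_self]
        · by_cases h2 : z j i < b
          · rw [if_pos ⟨not_lt.1 h1, h2⟩, if_pos h2, if_neg h1, sub_zero]
          · rw [if_neg fun h => h2 h.2, if_neg h2, if_neg h1, sub_zero]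
    have e1 := hanchor b (ha.trans hab) hb
    have e2 := hanchor a ha (hab.trans hb)
    rw [heq, Finset.card_insert_of_notMem hiJ, pow_succ]
    refine (abs_sub _ _).trans ?_
    linarith

theorem disc_le (hz : ∀ j < n, z j ∈ cube d) (ht : 0 ≤ t) (hn : n ≤ 2 ^ (h + 1))
    (hM : ∀ s a : Fin d → ℕ, (∀ i, 2 * a i + 1 ≤ 2 ^ s i) → 1 ≤ ∑ i, s i → ∑ i, s i ≤ h →
      |((∑ j ∈ Finset.range n, haar s a (z j) : ℤ) : ℝ)| ≤ t) :
    disc z n ≤ 2 ^ d * ((h + 1 + d).choose d : ℝ) * (t + 2) := by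
  refine Real.sSup_le ?_ (by positivity)
  rintro _ ⟨a, b, hab, rfl⟩
  have key := abs_countErr_le hz ht hn hM Finset.univ
    (fun i x => if a i ≤ x ∧ x < b i then 1 else 0) (fun i => b i - a i) (fun _ => 0)
    (by simp) (fun i _ => ⟨rfl, a i, b i, (hab i).1, (hab i).2.1.le, (hab i).2.2,
      fun _ _ => rfl, rfl⟩) (by simp)
  simp only [Finset.card_univ, Fintype.card_fin, Finset.sum_const_zero, Nat.sub_zero] at key
  convert key using 2
  rw [countErr]
  congr 1
  · refine Finset.sum_congr rfl fun j _ => ?_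
    rw [Finset.prod_ite_zero]
    have hmem : z j ∈ box a b ↔ ∀ i ∈ Finset.univ, a i ≤ z j i ∧ z j i < b i := by simp [box]
    rw [Finset.prod_const_one]
    by_cases hb : z j ∈ box a b
    · rw [Set.indicator_of_mem hb, if_pos (hmem.1 hb)]
    · rw [Set.indicator_of_notMem hb, if_neg fun h => hb (hmem.2 h)]
  · congr 1
    rw [measureReal_def, box, volume_pi, Measure.pi_pi, ENNReal.toReal_prod]
    exact Finset.prod_congr rfl fun i _ => by
      rw [Real.volume_Ico, ENNReal.toReal_ofReal (by linarith [(hab i).2.1])]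

lemma disc_le_card (z : ℕ → Pt d) (n : ℕ) : disc z n ≤ n := by
  refine Real.sSup_le ?_ (by positivity)
  rintro _ ⟨a, b, hab, rfl⟩
  have h1 : 0 ≤ ∑ i ∈ Finset.range n, (box a b).indicator (fun _ => (1 : ℝ)) (z i) :=
    Finset.sum_nonneg fun i _ => Set.indicator_nonneg (fun _ _ => zero_le_one) _
  have h2 : ∑ i ∈ Finset.range n, (box a b).indicator (fun _ => (1 : ℝ)) (z i) ≤ n := by
    refine (Finset.sum_le_card_nsmul _ _ 1 fun i _ => ?_).trans (by simp)
    exact Set.indicator_le_self' (fun _ _ => zero_le_one) _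
  have h3 : volume.real (box a b) ≤ 1 := by
    rw [measureReal_def, box, volume_pi, Measure.pi_pi, ENNReal.toReal_prod]
    refine Finset.prod_le_one (fun _ _ => ENNReal.toReal_nonneg) fun i _ => ?_
    rw [Real.volume_Ico, ENNReal.toReal_ofReal (by linarith [(hab i).2.1])]
    linarith [(hab i).1, (hab i).2.2]
  have h4 : 0 ≤ volume.real (box a b) := measureReal_nonneg
  have h5 : (0 : ℝ) ≤ n := Nat.cast_nonneg n
  rw [abs_le]
  constructor <;> nlinarith

/-! ### The tail bound for the discrepancy -/

/-- Raising `d` by one multiplies the left side by at most `h²`. The condition `9 ≤ h` is what this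
needs at `d = 1`, where `3 (h + 3) ≤ 4 h` is used. -/
lemma choose_mul_choose_le {h : ℕ} (hh : 9 ≤ h) (hd : 1 ≤ d) :
    2 ^ d * (h + 1 + d).choose d * (h + d).choose d ≤ 3 * h ^ (2 * d) := by
  induction d, hd using Nat.le_induction with
  | base => simp; nlinarith
  | succ d hd ih =>
    have e1 := Nat.add_one_mul_choose_eq (h + 1 + d) d
    have e2 := Nat.add_one_mul_choose_eq (h + d) d
    rw [← add_assoc, ← add_assoc]
    set A := (h + 1 + d + 1).choose (d + 1)
    set B := (h + d + 1).choose (d + 1)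
    set A' := (h + 1 + d).choose d
    set B' := (h + d).choose d
    have hf : 2 * ((h + 1 + d + 1) * (h + d + 1)) ≤ h ^ 2 * (d + 1) ^ 2 := by
      have h1 : 3 * (h + 1 + d + 1) ≤ 2 * (h * (d + 1)) := by nlinarith
      have h2 : 3 * (h + d + 1) ≤ 2 * (h * (d + 1)) := by nlinarith
      have h3 := Nat.mul_le_mul h1 h2
      nlinarith
    refine Nat.le_of_mul_le_mul_right ?_ (show 0 < (d + 1) ^ 2 by positivity)
    calc 2 ^ (d + 1) * A * B * (d + 1) ^ 2
        = 2 ^ d * 2 * (A * (d + 1)) * (B * (d + 1)) := by ring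
      _ = (2 * ((h + 1 + d + 1) * (h + d + 1))) * (2 ^ d * A' * B') := by
          rw [← e1, ← e2]; ring
      _ ≤ (h ^ 2 * (d + 1) ^ 2) * (3 * h ^ (2 * d)) := Nat.mul_le_mul hf ih
      _ = 3 * h ^ (2 * (d + 1)) * (d + 1) ^ 2 := by ring

lemma card_haarIndex_le {n : ℕ} (hn : n ≠ 0) :
    (haarIndex d 1 (Nat.log 2 n)).card ≤ n ^ (2 * d) := by
  refine (Finset.card_filter_le _ _).trans ?_
  rw [Finset.card_product, Fintype.card_piFinset_const, Fintype.card_piFinset_const,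
    Finset.card_range, Finset.card_range, two_mul, pow_add]
  have h1 : 2 ^ Nat.log 2 n ≤ n := Nat.pow_log_le_self 2 hn
  have h2 : Nat.log 2 n + 1 ≤ n := (Nat.lt_two_pow_self).trans_le h1
  gcongr

lemma samplePairing_eq (β : ℝ) (X : ℕ → Pt d) (U : ℕ → ℝ) (s a : Fin d → ℕ) (n : ℕ) :
    samplePairing β X U s a n =
      ∑ j ∈ Finset.range n, haar s a (sample (haarStrategy d β) X U j) := by
  rw [samplePairing, haarPairing, thinned_fst]
  exact Fin.sum_univ_eq_sum_range (fun j => haar s a (sample (haarStrategy d β) X U j)) n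

/-- Arithmetic of the constants. With `t = 3WA/β` and `2^d C(h+1+d, d) (W + 1) ≤ 3 log^{2d} n`, the
discrepancy bound is at most `β⁻¹ log^{2d} n (9A + 3)`. -/
lemma threshold_lt (hd : 1 ≤ d) {β : ℝ} (h0 : 0 < β) (h1 : β ≤ 1) {n h : ℕ} (hh9 : 9 ≤ h)
    (hn : 2 ≤ n) (hhL : (h : ℝ) ≤ Real.logb 2 n) {Δ : ℝ} (hΔ : 0 < Δ) :
    2 ^ d * ((h + 1 + d).choose d : ℝ) * ((Δ / 50 + 2 * d * Real.log n + Real.log 4) /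
      (β / (3 * (haarWeight d h : ℝ))) + 2) <
      β⁻¹ * Real.logb 2 n ^ (2 * d) * (Δ + 1000 + 100 * (d : ℝ) ^ 2 * Real.logb 2 n) := by
  set L := Real.logb 2 n with hL
  have hn' : (2 : ℝ) ≤ n := by exact_mod_cast hn
  have hL1 : 1 ≤ L := by
    rw [hL, Real.le_logb_iff_rpow_le (by norm_num) (by linarith)]
    simpa using hn'
  have hβ1 : 1 ≤ β⁻¹ := (one_le_inv₀ h0).2 h1
  have hLd : 1 ≤ L ^ (2 * d) := one_le_pow₀ hL1
  have hC1 : 1 ≤ β⁻¹ * L ^ (2 * d) := one_le_mul_of_one_le_of_one_le hβ1 hLd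
  have hd' : (1 : ℝ) ≤ d := by exact_mod_cast hd
  set W : ℝ := (haarWeight d h : ℝ) with hW
  have hW1 : 1 ≤ W := by
    have : 1 ≤ haarWeight d h := haarWeight_pos d (by omega)
    rw [hW]; exact_mod_cast this
  set θ := β / (3 * W) with hθ
  have hθ0 : 0 < θ := by positivity
  set A := Δ / 50 + 2 * d * Real.log n + Real.log 4 with hA
  have hlogn : 0 ≤ Real.log n := Real.log_nonneg (by linarith)
  have hlog4 : 0 ≤ Real.log 4 := Real.log_nonneg (by norm_num)
  have hA0 : 0 < A := by positivity
  set t := A / θ with ht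
  have ht0 : 0 < t := by positivity
  set D : ℝ := 2 ^ d * ((h + 1 + d).choose d : ℝ) with hD
  have hD0 : 0 ≤ D := by positivity
  have hDW : D * (W + 1) ≤ 3 * L ^ (2 * d) := by
    have e1 := choose_mul_choose_le (d := d) hh9 hd
    rw [← haarWeight_add_one d h hd] at e1
    have e2 : D * (W + 1) ≤ 3 * (h : ℝ) ^ (2 * d) := by
      rw [hD, hW]; exact_mod_cast e1
    have e3 : (h : ℝ) ^ (2 * d) ≤ L ^ (2 * d) := by gcongr
    linarith
  have hDt : D * t ≤ β⁻¹ * L ^ (2 * d) * (9 * A) := by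
    have e1 : D * t = β⁻¹ * (D * W) * (3 * A) := by rw [ht, hθ]; field_simp
    rw [e1]
    have e2 : D * W ≤ 3 * L ^ (2 * d) := by nlinarith
    calc β⁻¹ * (D * W) * (3 * A) ≤ β⁻¹ * (3 * L ^ (2 * d)) * (3 * A) := by gcongr
      _ = _ := by ring
  have hD2 : D * 2 ≤ β⁻¹ * L ^ (2 * d) * 3 := by
    have e2 : D * 2 ≤ 3 * L ^ (2 * d) := by nlinarith
    nlinarith
  have hlog : Real.log n ≤ 0.7 * L := by
    have : Real.log n = L * Real.log 2 := by
      rw [hL, Real.logb]; field_simp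
    rw [this]
    nlinarith [Real.log_two_lt_d9]
  have hlog4' : Real.log 4 ≤ 1.4 := by
    rw [show (4 : ℝ) = 2 ^ 2 by norm_num, Real.log_pow]
    push_cast
    linarith [Real.log_two_lt_d9]
  -- The three terms of `9A` are compared separately: `9/50 < 1` for `Δ`, `18 · 0.7 = 12.6 < 100`
  -- for `d log n`, and the rest is well below `1000`.
  have hfin : 9 * A + 3 < Δ + 1000 + 100 * (d : ℝ) ^ 2 * L := by
    have e1 : (d : ℝ) * Real.log n ≤ d * (0.7 * L) := by gcongr
    have e2 : (d : ℝ) * L ≤ d ^ 2 * L := by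
      have : (d : ℝ) ≤ d ^ 2 := by nlinarith
      gcongr
    have e3 : 0 ≤ (d : ℝ) * L := by positivity
    rw [hA]
    linarith
  calc D * (t + 2) = D * t + D * 2 := by ring
    _ ≤ β⁻¹ * L ^ (2 * d) * (9 * A + 3) := by linarith
    _ < _ := mul_lt_mul_of_pos_left hfin (by linarith)

theorem measureReal_disc_ge_le (hd : 1 ≤ d) {β : ℝ} (h0 : 0 < β) (h1 : β ≤ 1)
    {Ω : Type*} [MeasurableSpace Ω] {P : Measure Ω} [IsProbabilityMeasure P]
    {X : ℕ → Ω → Pt d} {U : ℕ → Ω → ℝ}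
    (hX : ∀ j, Measurable (X j)) (hU : ∀ j, Measurable (U j))
    (hXl : ∀ j, P.map (X j) = unifCube d) (hUl : ∀ j, P.map (U j) = volume.restrict (Set.Icc 0 1))
    (hXi : iIndepFun X P) (hUi : iIndepFun U P)
    (hXU : IndepFun (fun ω j => X j ω) (fun ω j => U j ω) P) {n : ℕ} (hn : 2 ≤ n) {Δ : ℝ}
    (hΔ : 0 < Δ) :
    P.real {ω | β⁻¹ * Real.logb 2 n ^ (2 * d) * (Δ + 1000 + 100 * (d : ℝ) ^ 2 * Real.logb 2 n) ≤
        disc (sample (haarStrategy d β) (fun j => X j ω) (fun j => U j ω)) n} ≤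
      (β ^ 2)⁻¹ * Real.exp (-(Δ / 50)) := by
  set L := Real.logb 2 n with hL
  have hn' : (2 : ℝ) ≤ n := by exact_mod_cast hn
  have hL1 : 1 ≤ L := by
    rw [hL, Real.le_logb_iff_rpow_le (by norm_num) (by linarith)]
    simpa using hn'
  have hβ1 : 1 ≤ β⁻¹ := (one_le_inv₀ h0).2 h1
  have hLd : 1 ≤ L ^ (2 * d) := one_le_pow₀ hL1
  have hC1 : 1 ≤ β⁻¹ * L ^ (2 * d) := one_le_mul_of_one_le_of_one_le hβ1 hLd
  have hd' : (1 : ℝ) ≤ d := by exact_mod_cast hd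
  have hK : 0 ≤ 100 * (d : ℝ) ^ 2 * L := by positivity
  -- For `n < 1000` the threshold exceeds `n`, and the discrepancy never does; otherwise `h ≥ 9`,
  -- since `2 ^ 9 ≤ 1000`.
  rcases lt_or_ge n 1000 with hsmall | hbig
  · have hempty : {ω | β⁻¹ * L ^ (2 * d) * (Δ + 1000 + 100 * (d : ℝ) ^ 2 * L) ≤
        disc (sample (haarStrategy d β) (fun j => X j ω) (fun j => U j ω)) n} = ∅ := by
      refine Set.eq_empty_of_forall_notMem fun ω hω => ?_
      have h2 := disc_le_card (sample (haarStrategy d β) (fun j => X j ω) (fun j => U j ω)) n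
      have h3 : (n : ℝ) < 1000 := by exact_mod_cast hsmall
      have h4 := hω.trans h2
      nlinarith
    rw [hempty]
    simp only [measureReal_empty]
    positivity
  set h := Nat.log 2 n with hh
  have hh9 : 9 ≤ h := Nat.le_log_of_pow_le (by norm_num) (by omega)
  have hnpow : n ≤ 2 ^ (h + 1) := (Nat.lt_pow_succ_log_self (by norm_num) n).le
  have hhL : (h : ℝ) ≤ L := by
    rw [hL, Real.le_logb_iff_rpow_le (by norm_num) (by linarith), Real.rpow_natCast]
    exact_mod_cast Nat.pow_log_le_self 2 (by omega)
  set W : ℝ := (haarWeight d h : ℝ) with hW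
  have hW1 : 1 ≤ W := by
    have : 1 ≤ haarWeight d h := haarWeight_pos d (by omega)
    rw [hW]; exact_mod_cast this
  -- The largest `θ` that the moment bound allows.
  set θ := β / (3 * W) with hθ
  have hθ0 : 0 < θ := by positivity
  have hθW : 3 * W * θ ≤ β := by rw [hθ]; field_simp; exact le_rfl
  -- Chosen so that the union bound `n ^ (2d) · 4 exp(-A)` equals `exp(-Δ/50)`.
  set A := Δ / 50 + 2 * d * Real.log n + Real.log 4 with hA
  have hlogn : 0 ≤ Real.log n := Real.log_nonneg (by linarith)
  have hlog4 : 0 ≤ Real.log 4 := Real.log_nonneg (by norm_num)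
  have hA0 : 0 < A := by positivity
  set t := A / θ with ht
  have ht0 : 0 < t := by positivity
  have hbad : ∀ p ∈ haarIndex d 1 h,
      P {ω | t ≤ |(samplePairing β (fun j => X j ω) (fun j => U j ω) p.1 p.2 n : ℝ)|} ≤
        ENNReal.ofReal (4 * Real.exp (-A)) := by
    intro p hp
    rw [mem_haarIndex] at hp
    have := measure_samplePairing_ge_le hd h0 h1 hX hU hXl hUl hXi hUi hXU hp.1 hp.2.1 hp.2.2
      hθ0.le hθW ht0.le
    rwa [show θ * t = A by rw [ht]; field_simp] at this
  have hcube : ∀ᵐ ω ∂P, ∀ j, X j ω ∈ cube d := by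
    rw [ae_all_iff]
    intro j
    have h2 : ∀ᵐ x ∂(P.map (X j)), x ∈ cube d := by rw [hXl]; exact ae_mem_cube
    exact ae_of_ae_map (hX j).aemeasurable h2
  have hgood : ∀ ω, (∀ j, X j ω ∈ cube d) →
      (∀ p ∈ haarIndex d 1 h,
        |(samplePairing β (fun j => X j ω) (fun j => U j ω) p.1 p.2 n : ℝ)| < t) →
      disc (sample (haarStrategy d β) (fun j => X j ω) (fun j => U j ω)) n <
        β⁻¹ * L ^ (2 * d) * (Δ + 1000 + 100 * (d : ℝ) ^ 2 * L) := by
    intro ω hω hp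
    have hdisc := disc_le (z := sample (haarStrategy d β) (fun j => X j ω) (fun j => U j ω))
      (n := n) (h := h) (t := t) (fun j _ => hω _) ht0.le hnpow fun s a ha hs1 hs2 => by
        have := (hp (s, a) (mem_haarIndex.2 ⟨ha, hs1, hs2⟩)).le
        rwa [samplePairing_eq] at this
    refine hdisc.trans_lt ?_
    exact threshold_lt hd h0 h1 hh9 (by omega) hhL hΔ
  have hle : P {ω | β⁻¹ * L ^ (2 * d) * (Δ + 1000 + 100 * (d : ℝ) ^ 2 * L) ≤
      disc (sample (haarStrategy d β) (fun j => X j ω) (fun j => U j ω)) n} ≤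
      ENNReal.ofReal (Real.exp (-(Δ / 50))) := by
    calc _ ≤ P ({ω | ¬ ∀ j, X j ω ∈ cube d} ∪ ⋃ p ∈ haarIndex d 1 h,
          {ω | t ≤ |(samplePairing β (fun j => X j ω) (fun j => U j ω) p.1 p.2 n : ℝ)|}) := by
          refine measure_mono fun ω hω => ?_
          by_contra hc
          simp only [Set.mem_union, Set.mem_iUnion, Set.mem_ofPred_eq, not_or, not_not, not_exists,
            not_le] at hc
          exact absurd (hgood ω hc.1 hc.2) (not_lt.2 hω)
      _ ≤ 0 + ∑ p ∈ haarIndex d 1 h, ENNReal.ofReal (4 * Real.exp (-A)) := by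
          refine (measure_union_le _ _).trans (add_le_add (le_of_eq hcube) ?_)
          exact (measure_biUnion_finset_le _ _).trans (Finset.sum_le_sum hbad)
      _ = ENNReal.ofReal ((haarIndex d 1 h).card * (4 * Real.exp (-A))) := by
          rw [zero_add, Finset.sum_const, nsmul_eq_mul,
            ENNReal.ofReal_mul (Nat.cast_nonneg _), ENNReal.ofReal_natCast]
      _ ≤ ENNReal.ofReal ((n : ℝ) ^ (2 * d) * (4 * Real.exp (-A))) := by
          have : ((haarIndex d 1 h).card : ℝ) ≤ (n : ℝ) ^ (2 * d) := by
            exact_mod_cast card_haarIndex_le (d := d) (n := n) (by omega)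
          gcongr
      _ = ENNReal.ofReal (Real.exp (-(Δ / 50))) := by
          congr 1
          have e1 : (n : ℝ) ^ (2 * d) = Real.exp (2 * d * Real.log n) := by
            rw [← Real.exp_log (show (0 : ℝ) < n by linarith), ← Real.exp_nat_mul,
              Real.exp_log (show (0 : ℝ) < n by linarith)]
            push_cast; rfl
          have e2 : (4 : ℝ) = Real.exp (Real.log 4) := (Real.exp_log (by norm_num)).symm
          calc (n : ℝ) ^ (2 * d) * (4 * Real.exp (-A))
              = Real.exp (2 * d * Real.log n) * (Real.exp (Real.log 4) * Real.exp (-A)) := by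
                rw [e1, ← e2]
            _ = _ := by
                rw [← Real.exp_add, ← Real.exp_add, hA]
                congr 1
                ring
  rw [measureReal_def]
  refine (ENNReal.toReal_le_of_le_ofReal (Real.exp_pos _).le hle).trans ?_
  -- The bound obtained so far is `exp(-Δ/50)`; the factor `β⁻²` only weakens it.
  have hβ2 : 1 ≤ (β ^ 2)⁻¹ := (one_le_inv₀ (by positivity)).2 (by nlinarith)
  nlinarith [Real.exp_pos (-(Δ / 50))]

/-! ### Reasoning about programs -/

/-- Started with memory `σ`, the program `p` halts within `c` time units in a memory satisfying `Q`,
and it touches only cells whose address is less than `S`. -/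
def Halts (S : ℕ) (p : Prog) (σ : Mem) (c : ℕ) (Q : Mem → Prop) : Prop :=
  ∃ τ t, Exec S p σ τ t ∧ t ≤ c ∧ Q τ

namespace Halts

variable {S : ℕ} {p q : Prog} {σ : Mem} {c c' : ℕ} {Q Q' : Mem → Prop}

lemma mono (h : Halts S p σ c Q) (hc : c ≤ c') (hQ : ∀ τ, Q τ → Q' τ) : Halts S p σ c' Q' := by
  obtain ⟨τ, t, h1, h2, h3⟩ := h
  exact ⟨τ, t, h1, h2.trans hc, hQ τ h3⟩

lemma skip (h : Q σ) : Halts S .skip σ 0 Q := ⟨σ, 0, .skip σ, le_rfl, h⟩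

lemma instr {i : Instr} (hv : i.Valid S σ) (h : Q (i.run σ)) : Halts S (.instr i) σ 1 Q :=
  ⟨_, 1, .instr i σ hv, le_rfl, h⟩

lemma seq (h : Halts S p σ c fun τ => Halts S q τ c' Q) : Halts S (.seq p q) σ (c + c') Q := by
  obtain ⟨τ, t, h1, h2, ρ, u, h3, h4, h5⟩ := h
  exact ⟨ρ, t + u, .seq h1 h3, by omega, h5⟩

lemma ite {b : Test} (hb : b.Valid S) (h1 : b.Holds σ → Halts S p σ c Q)
    (h2 : ¬ b.Holds σ → Halts S q σ c Q) : Halts S (.ite b p q) σ (c + 1) Q := by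
  by_cases h : b.Holds σ
  · obtain ⟨τ, t, h3, h4, h5⟩ := h1 h
    exact ⟨τ, t + 1, .ite_true hb h h3, by omega, h5⟩
  · obtain ⟨τ, t, h3, h4, h5⟩ := h2 h
    exact ⟨τ, t + 1, .ite_false hb h h3, by omega, h5⟩

/-- The invariant is indexed by the number of completed iterations, which is required to end at `m`.
Each of the `k` remaining iterations pays for its test, and one more test ends the loop. -/
lemma while_loop {b : Test} (hb : b.Valid S) (I : ℕ → Mem → Prop) (m : ℕ)
    (hstep : ∀ s σ, s < m → I s σ → b.Holds σ ∧ Halts S p σ c (I (s + 1)))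
    (hend : ∀ σ, I m σ → ¬ b.Holds σ) (k : ℕ) :
    ∀ s σ, s + k = m → I s σ → Halts S (.while b p) σ (k * (c + 1) + 1) (I m) := by
  induction k with
  | zero =>
    intro s σ hs h
    obtain rfl : s = m := by omega
    exact ⟨σ, 1, .while_false hb (hend σ h), by omega, h⟩
  | succ k ih =>
    intro s σ hs h
    obtain ⟨hh, τ, t, h1, h2, h3⟩ := hstep s σ (by omega) h
    obtain ⟨ρ, u, h4, h5, h6⟩ := ih (s + 1) τ (by omega) h3
    refine ⟨ρ, t + u + 1, .while_true hb hh h1 h4, ?_, h6⟩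
    rw [Nat.succ_mul]
    omega

end Halts

/-- A straight-line program. -/
def block : List Instr → Prog
  | [] => .skip
  | i :: l => .seq (.instr i) (block l)

/-- The memory after a straight-line program. -/
noncomputable def blockRun : List Instr → Mem → Mem
  | [], σ => σ
  | i :: l, σ => blockRun l (i.run σ)

/-- A straight-line program can be executed. -/
def BlockValid (S : ℕ) : List Instr → Mem → Prop
  | [], _ => True
  | i :: l, σ => i.Valid S σ ∧ BlockValid S l (i.run σ)

lemma halts_block {S : ℕ} {l : List Instr} {σ : Mem} {Q : Mem → Prop} (hv : BlockValid S l σ)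
    (h : Q (blockRun l σ)) : Halts S (block l) σ l.length Q := by
  induction l generalizing σ with
  | nil => exact Halts.skip h
  | cons i l ih =>
    rw [List.length_cons, add_comm]
    exact Halts.seq (Halts.instr hv.1 (ih hv.2 h))

/-! ### The leaves of the enumeration tree -/

/-- The data that the enumeration of the order vectors computes for one of them: what remains of
the order, the code of the order vector, the code of the position, and the sign. -/
structure Leaf where
  rem : ℕ
  key : ℕ
  pos : ℕ
  sgn : ℤ

/-- The address of the table entry. -/
def Leaf.addr (h : ℕ) (l : Leaf) : ℕ := l.key * 2 ^ h + l.pos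

/-- The list of the leaves, in the order of the enumeration. -/
noncomputable def leaves (h : ℕ) : (k : ℕ) → (Fin k → ℝ) → ℕ → ℕ → ℕ → ℤ → List Leaf
  | 0, _, r, key, pos, sg => [⟨r, key, pos, sg⟩]
  | k + 1, x, r, key, pos, sg => (List.range (r + 1)).flatMap fun s =>
      leaves h k (Fin.tail x) (r - s) (key * (h + 1) + s) (pos * 2 ^ s + dyadic s (x 0) / 2)
        (sg * (-1) ^ dyadic s (x 0))

/-- The leaf that belongs to an order vector. -/
noncomputable def leafOf (h : ℕ) : (k : ℕ) → (Fin k → ℝ) → (Fin k → ℕ) → ℕ → ℕ → ℕ → ℤ → Leaf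
  | 0, _, _, r, key, pos, sg => ⟨r, key, pos, sg⟩
  | k + 1, x, s, r, key, pos, sg =>
      leafOf h k (Fin.tail x) (Fin.tail s) (r - s 0) (key * (h + 1) + s 0)
        (pos * 2 ^ s 0 + dyadic (s 0) (x 0) / 2) (sg * (-1) ^ dyadic (s 0) (x 0))

/-- Connects the recursive enumeration with sums over order vectors: splitting off the first entry
corresponds to the outermost loop. -/
lemma sum_leaves {M : Type*} [AddCommMonoid M] (F : Leaf → M) (h k : ℕ) (x : Fin k → ℝ)
    (r key pos : ℕ) (sg : ℤ) :
    ((leaves h k x r key pos sg).map F).sum =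
      ∑ s ∈ orderVectors k 0 r, F (leafOf h k x s r key pos sg) := by
  induction k generalizing r key pos sg with
  | zero =>
    have : orderVectors 0 0 r = {fun i => i.elim0} := by
      ext s
      simp only [mem_orderVectors, Finset.univ_eq_empty, Finset.sum_empty, Finset.mem_singleton]
      exact ⟨fun _ => Subsingleton.elim _ _, fun _ => by simp⟩
    rw [this]
    simp [leaves, leafOf]
  | succ k ih =>
    simp only [leaves, List.map_flatMap]
    simp only [List.flatMap, List.sum_flatten, List.map_map, Function.comp_def, ih]
    rw [← List.sum_toFinset _ List.nodup_range, List.toFinset_range, Finset.sum_sigma']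
    refine Finset.sum_bij (fun p _ => Fin.cons p.1 p.2) ?_ ?_ ?_ ?_
    · rintro ⟨a, s⟩ hp
      simp only [Finset.mem_sigma, Finset.mem_range, mem_orderVectors] at hp
      simp only [mem_orderVectors, Fin.sum_univ_succ, Fin.cons_zero, Fin.cons_succ]
      omega
    · rintro ⟨a, s⟩ _ ⟨a', s'⟩ _ hp
      obtain ⟨h1, h2⟩ := Fin.cons_inj.1 hp
      simp only at h1 h2
      subst h1 h2
      rfl
    · intro s hs
      simp only [mem_orderVectors, Fin.sum_univ_succ] at hs
      refine ⟨⟨s 0, Fin.tail s⟩, ?_, Fin.cons_self_tail s⟩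
      simp only [Finset.mem_sigma, Finset.mem_range, mem_orderVectors]
      have : ∑ i, Fin.tail s i = ∑ i : Fin k, s i.succ := rfl
      omega
    · rintro ⟨a, s⟩ _
      simp [leafOf, Fin.tail_cons]

lemma mem_leaves {h k : ℕ} {x : Fin k → ℝ} {r key pos : ℕ} {sg : ℤ} {l : Leaf}
    (hl : l ∈ leaves h k x r key pos sg) :
    ∃ s ∈ orderVectors k 0 r, l = leafOf h k x s r key pos sg := by
  induction k generalizing r key pos sg with
  | zero =>
    simp only [leaves, List.mem_singleton] at hl
    exact ⟨fun i => i.elim0, by simp [mem_orderVectors], hl⟩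
  | succ k ih =>
    simp only [leaves, List.mem_flatMap, List.mem_range] at hl
    obtain ⟨a, ha, hl⟩ := hl
    obtain ⟨s, hs, rfl⟩ := ih hl
    refine ⟨Fin.cons a s, ?_, by simp [leafOf]⟩
    simp only [mem_orderVectors, Fin.sum_univ_succ, Fin.cons_zero, Fin.cons_succ] at hs ⊢
    omega

lemma leafOf_rem (h k : ℕ) (x : Fin k → ℝ) (s : Fin k → ℕ) (r key pos : ℕ) (sg : ℤ) :
    (leafOf h k x s r key pos sg).rem = r - ∑ i, s i := by
  induction k generalizing r key pos sg with
  | zero => simp [leafOf]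
  | succ k ih =>
    rw [leafOf, ih, Fin.sum_univ_succ, Nat.sub_sub]
    rfl

lemma leafOf_sgn (h k : ℕ) (x : Fin k → ℝ) (s : Fin k → ℕ) (r key pos : ℕ) (sg : ℤ) :
    (leafOf h k x s r key pos sg).sgn = sg * haarSgn s x := by
  induction k generalizing r key pos sg with
  | zero => simp [leafOf, haarSgn]
  | succ k ih =>
    rw [leafOf, ih, haarSgn, haarSgn, Fin.prod_univ_succ, mul_assoc]
    rfl

/-- The entries are appended to `key` as digits in base `h + 1`. -/
lemma leafOf_key_bounds (h k : ℕ) (x : Fin k → ℝ) (s : Fin k → ℕ) (hs : ∀ i, s i ≤ h)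
    (r key pos : ℕ) (sg : ℤ) :
    key * (h + 1) ^ k ≤ (leafOf h k x s r key pos sg).key ∧
      (leafOf h k x s r key pos sg).key < (key + 1) * (h + 1) ^ k := by
  induction k generalizing r key pos sg with
  | zero => simp [leafOf]
  | succ k ih =>
    have h0 := hs 0
    obtain ⟨h1, h2⟩ := ih (Fin.tail x) (Fin.tail s) (fun i => hs i.succ) (r - s 0)
      (key * (h + 1) + s 0) (pos * 2 ^ s 0 + dyadic (s 0) (x 0) / 2) (sg * (-1) ^ dyadic (s 0) (x 0))
    rw [leafOf]
    constructor
    · refine le_trans ?_ h1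
      rw [pow_succ', ← mul_assoc]
      gcongr
      omega
    · refine lt_of_lt_of_le h2 ?_
      rw [pow_succ', ← mul_assoc]
      gcongr
      rw [add_mul]
      omega

/-- The positions are appended with `s i` binary digits each, so `∑ s i` digits suffice for all
coordinates together. This keeps the table at size of order `h^d 2^h` rather than `2^{dh}`. -/
lemma leafOf_pos_lt (h k : ℕ) (x : Fin k → ℝ) (hx : ∀ i, x i ∈ Set.Ico (0 : ℝ) 1)
    (s : Fin k → ℕ) (r key pos : ℕ) (sg : ℤ) :
    (leafOf h k x s r key pos sg).pos < (pos + 1) * 2 ^ ∑ i, s i := by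
  induction k generalizing r key pos sg with
  | zero => simp [leafOf]
  | succ k ih =>
    have h1 := ih (Fin.tail x) (fun i => hx i.succ) (Fin.tail s) (r - s 0)
      (key * (h + 1) + s 0) (pos * 2 ^ s 0 + dyadic (s 0) (x 0) / 2) (sg * (-1) ^ dyadic (s 0) (x 0))
    rw [leafOf, Fin.sum_univ_succ, pow_add, ← mul_assoc]
    refine h1.trans_le ?_
    have h2 := dyadic_lt (s 0) (hx 0)
    have h3 : ∑ i, Fin.tail s i = ∑ i : Fin k, s i.succ := rfl
    rw [h3]
    gcongr
    rw [add_mul]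
    omega

lemma leafOf_key_inj {h k : ℕ} {x y : Fin k → ℝ} {s s' : Fin k → ℕ} (hs : ∀ i, s i ≤ h)
    (hs' : ∀ i, s' i ≤ h) {r r' key key' pos pos' : ℕ} {sg sg' : ℤ}
    (heq : (leafOf h k x s r key pos sg).key = (leafOf h k y s' r' key' pos' sg').key) :
    key = key' ∧ s = s' := by
  induction k generalizing r r' key key' pos pos' sg sg' with
  | zero => exact ⟨heq, Subsingleton.elim _ _⟩
  | succ k ih =>
    simp only [leafOf] at heq
    obtain ⟨h1, h2⟩ := ih (fun i => hs i.succ) (fun i => hs' i.succ) heq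
    have h0 := hs 0
    have h0' := hs' 0
    have e : key = key' := by
      have e1 : (key * (h + 1) + s 0) / (h + 1) = key := by
        rw [mul_comm, Nat.mul_add_div (by omega), Nat.div_eq_of_lt (by omega), add_zero]
      have e2 : (key' * (h + 1) + s' 0) / (h + 1) = key' := by
        rw [mul_comm, Nat.mul_add_div (by omega), Nat.div_eq_of_lt (by omega), add_zero]
      rw [← e1, ← e2, h1]
    subst e
    refine ⟨rfl, ?_⟩
    have h3 : Fin.tail s = Fin.tail s' := h2
    rw [← Fin.cons_self_tail s, ← Fin.cons_self_tail s', h3]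
    congr 1
    omega

lemma leafOf_pos_inj {h k : ℕ} {x y : Fin k → ℝ} (hx : ∀ i, x i ∈ Set.Ico (0 : ℝ) 1)
    (hy : ∀ i, y i ∈ Set.Ico (0 : ℝ) 1) {s : Fin k → ℕ}
    {r r' key key' pos pos' : ℕ} {sg sg' : ℤ}
    (heq : (leafOf h k x s r key pos sg).pos = (leafOf h k y s r' key' pos' sg').pos) :
    pos = pos' ∧ haarPos s x = haarPos s y := by
  induction k generalizing r r' key key' pos pos' sg sg' with
  | zero => exact ⟨heq, Subsingleton.elim _ _⟩
  | succ k ih =>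
    simp only [leafOf] at heq
    obtain ⟨h1, h2⟩ := ih (fun i => hx i.succ) (fun i => hy i.succ) heq
    have h0 := dyadic_lt (s 0) (hx 0)
    have h0' := dyadic_lt (s 0) (hy 0)
    have e : pos = pos' := by
      have hp : 0 < 2 ^ s 0 := by positivity
      have e1 : (pos * 2 ^ s 0 + dyadic (s 0) (x 0) / 2) / 2 ^ s 0 = pos := by
        rw [mul_comm, Nat.mul_add_div hp, Nat.div_eq_of_lt (by omega), add_zero]
      have e2 : (pos' * 2 ^ s 0 + dyadic (s 0) (y 0) / 2) / 2 ^ s 0 = pos' := by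
        rw [mul_comm, Nat.mul_add_div hp, Nat.div_eq_of_lt (by omega), add_zero]
      rw [← e1, ← e2, h1]
    subst e
    refine ⟨rfl, funext fun i => ?_⟩
    refine Fin.cases ?_ (fun j => ?_) i
    · simp only [haarPos]; omega
    · exact congrFun h2 j

lemma leafOf_key_congr (h k : ℕ) (x y : Fin k → ℝ) (s : Fin k → ℕ) (r r' key pos pos' : ℕ)
    (sg sg' : ℤ) :
    (leafOf h k x s r key pos sg).key = (leafOf h k y s r' key pos' sg').key := by
  induction k generalizing r r' key pos pos' sg sg' with
  | zero => rfl
  | succ k ih => exact ih _ _ _ _ _ _ _ _ _ _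

lemma leafOf_pos_congr (h k : ℕ) {x y : Fin k → ℝ} {s : Fin k → ℕ} (hxy : haarPos s x = haarPos s y)
    (r r' key key' pos : ℕ) (sg sg' : ℤ) :
    (leafOf h k x s r key pos sg).pos = (leafOf h k y s r' key' pos sg').pos := by
  induction k generalizing r r' key key' pos sg sg' with
  | zero => rfl
  | succ k ih =>
    have h0 : dyadic (s 0) (x 0) / 2 = dyadic (s 0) (y 0) / 2 := congrFun hxy 0
    have h1 : haarPos (Fin.tail s) (Fin.tail x) = haarPos (Fin.tail s) (Fin.tail y) :=
      funext fun i => congrFun hxy i.succ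
    simp only [leafOf]
    rw [h0]
    exact ih h1 _ _ _ _ _ _ _

/-! ### Addresses and contents of the table -/

section Table

variable {h key : ℕ} {x y : Pt d} {s s' : Fin d → ℕ}

/-- The leaf of an order vector in the enumeration for the point `x`. -/
noncomputable def leafAt (h key : ℕ) (x : Pt d) (s : Fin d → ℕ) : Leaf :=
  leafOf h d x s h key 0 1

lemma le_of_sum_le (hs : ∑ i, s i ≤ h) (i : Fin d) : s i ≤ h :=
  (Finset.single_le_sum (f := s) (fun _ _ => Nat.zero_le _) (Finset.mem_univ i)).trans hs

lemma leafAt_pos_lt (hx : x ∈ cube d) (hs : ∑ i, s i ≤ h) : (leafAt h key x s).pos < 2 ^ h := by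
  have h1 := leafOf_pos_lt h d x (mem_cube.1 hx) s h key 0 1
  rw [zero_add, one_mul] at h1
  exact h1.trans_le (Nat.pow_le_pow_right (by norm_num) hs)

/-- No collisions: the position is below `2^h`, so the address determines key and position, hence
the order vector and then the Haar function. -/
lemma leafAt_addr_eq_iff (hx : x ∈ cube d) (hy : y ∈ cube d) (hs : ∑ i, s i ≤ h)
    (hs' : ∑ i, s' i ≤ h) :
    (leafAt h key x s).addr h = (leafAt h key y s').addr h ↔
      s = s' ∧ haarPos s x = haarPos s y := by
  constructor
  · intro heq
    have hp := leafAt_pos_lt (key := key) hx hs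
    have hp' := leafAt_pos_lt (key := key) hy hs'
    have h2 : 0 < 2 ^ h := by positivity
    have hk : (leafAt h key x s).key = (leafAt h key y s').key := by
      have e := congrArg (· / 2 ^ h) heq
      simp only [Leaf.addr] at e
      rwa [mul_comm, Nat.mul_add_div h2, Nat.div_eq_of_lt hp, mul_comm, Nat.mul_add_div h2,
        Nat.div_eq_of_lt hp', add_zero, add_zero] at e
    obtain ⟨-, rfl⟩ := leafOf_key_inj (le_of_sum_le hs) (le_of_sum_le hs') hk
    rw [Leaf.addr, Leaf.addr, hk, Nat.add_left_cancel_iff] at heq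
    exact ⟨rfl, (leafOf_pos_inj (mem_cube.1 hx) (mem_cube.1 hy) heq).2⟩
  · rintro ⟨rfl, hxy⟩
    rw [Leaf.addr, Leaf.addr, leafAt, leafAt, leafOf_key_congr h d x y s h h key 0 0 1 1,
      leafOf_pos_congr h d hxy]

lemma le_leafAt_addr (hs : ∑ i, s i ≤ h) :
    key * (h + 1) ^ d * 2 ^ h ≤ (leafAt h key x s).addr h := by
  have h1 := (leafOf_key_bounds h d x s (le_of_sum_le hs) h key 0 1).1
  refine le_trans (Nat.mul_le_mul_right _ h1) ?_
  rw [Leaf.addr]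
  exact Nat.le_add_right _ _

lemma leafAt_addr_lt (hx : x ∈ cube d) (hs : ∑ i, s i ≤ h) :
    (leafAt h key x s).addr h < (key + 1) * (h + 1) ^ d * 2 ^ h := by
  have h1 := (leafOf_key_bounds h d x s (le_of_sum_le hs) h key 0 1).2
  have h2 := leafAt_pos_lt (key := key) hx hs
  have h3 : ((leafAt h key x s).key + 1) * 2 ^ h ≤ (key + 1) * (h + 1) ^ d * 2 ^ h :=
    Nat.mul_le_mul_right _ h1
  rw [Leaf.addr]
  rw [add_mul, one_mul] at h3
  omega

/-- The contribution of a point to the table. -/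
noncomputable def tableInc (h key : ℕ) (x : Pt d) (w : ℕ) : ℤ :=
  ((leaves h d x h key 0 1).map fun l => if l.addr h = w then l.sgn else 0).sum

lemma tableInc_eq (h key : ℕ) (x : Pt d) (w : ℕ) : tableInc h key x w =
    ∑ s ∈ orderVectors d 0 h, if (leafAt h key x s).addr h = w then haarSgn s x else 0 := by
  rw [tableInc, sum_leaves]
  refine Finset.sum_congr rfl fun s _ => ?_
  rw [leafOf_sgn, one_mul, leafAt]

/-- By injectivity of the addresses, `y` touches this entry only through the order vector `s`, and
only if it lies in the same support as `x`. -/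
lemma tableInc_leafAt (hx : x ∈ cube d) (hy : y ∈ cube d) (hs : ∑ i, s i ≤ h) :
    tableInc h key y ((leafAt h key x s).addr h) = haar s (haarPos s x) y := by
  rw [tableInc_eq, Finset.sum_congr rfl (g := fun s' => if s' = s then
    (if haarPos s x = haarPos s y then haarSgn s y else 0) else 0)]
  · rw [Finset.sum_ite_eq', if_pos (mem_orderVectors.2 ⟨Nat.zero_le _, hs⟩), haar_eq _ _ hy]
  · intro s' hs'
    simp only [leafAt_addr_eq_iff hy hx (mem_orderVectors.1 hs').2 hs]
    by_cases h : s' = s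
    · subst h
      simp only [true_and, if_true]
      exact if_congr eq_comm rfl rfl
    · simp only [h, false_and, if_false]

lemma tableInc_of_le (hx : x ∈ cube d) {w : ℕ} (hw : (key + 1) * (h + 1) ^ d * 2 ^ h ≤ w) :
    tableInc h key x w = 0 := by
  rw [tableInc_eq]
  refine Finset.sum_eq_zero fun s hs => if_neg ?_
  have := leafAt_addr_lt (key := key) hx (mem_orderVectors.1 hs).2
  omega

end Table

/-! ### The enumeration of the order vectors by nested loops -/

/-- The machine has no floor function: the next binary digit is found by doubling the fractional
part and comparing it with `1`. -/
lemma dyadic_succ_eq {x : ℝ} (hx : 0 ≤ x) (s : ℕ) : dyadic (s + 1) x =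
    if 1 ≤ (x * 2 ^ s - dyadic s x) + (x * 2 ^ s - dyadic s x) then dyadic s x + dyadic s x + 1
    else dyadic s x + dyadic s x := by
  obtain ⟨h1, h2⟩ := (dyadic_eq_iff (s := s) (k := dyadic s x) hx).1 rfl
  have hp : (0 : ℝ) < 2 ^ s := by positivity
  rw [div_le_iff₀ hp] at h1
  rw [lt_div_iff₀ hp] at h2
  have hp' : (0 : ℝ) < 2 ^ (s + 1) := by positivity
  split_ifs with h <;> rw [dyadic_eq_iff hx, div_le_iff₀ hp', lt_div_iff₀ hp', pow_succ] <;>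
    push_cast <;> constructor <;> linarith

/-- The program that runs `leaf` for every order vector of length `k` and order at most `W[b]`. The
loop for the first entry keeps its data in the integer cells `b, …, b + 8` and in the real
cell `y`; the coordinate of the point is in the real cell `c`. -/
def levels (leaf : Prog) (one : ℕ) : (k b c y : ℕ) → Prog
  | 0, _, _, _ => leaf
  | k + 1, b, c, y =>
    .seq (block [.const (b + 4) 0, .const (b + 5) 0, .const (b + 6) 0, .const (b + 7) 1,
        .const (b + 8) 1, .cast y (b + 4), .radd y y c]) <|
    .while (.ile (b + 4) b) <|
    .seq (block [.isub (b + 9) b (b + 4), .imul (b + 10) (b + 1) 3,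
        .iadd (b + 10) (b + 10) (b + 4), .imul (b + 11) (b + 2) (b + 7),
        .iadd (b + 11) (b + 11) (b + 5), .imul (b + 12) (b + 3) (b + 8)]) <|
    .seq (levels leaf one k (b + 9) (c + 1) (y + 1)) <|
    .seq (block [.iadd (b + 4) (b + 4) 1, .imul (b + 5) (b + 6) 1, .iadd (b + 7) (b + 7) (b + 7),
        .iadd (b + 6) (b + 6) (b + 6), .radd y y y]) <|
    .ite (.rle one y)
      (block [.rsub y y one, .iadd (b + 6) (b + 6) 1, .const (b + 8) (-1)])
      (block [.const (b + 8) 1])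

/-- A bound for the running time of `levels`. -/
def levelsCost (cl h : ℕ) : ℕ → ℕ
  | 0 => cl
  | k + 1 => 7 + ((h + 1) * (levelsCost cl h k + 16) + 1)

/-- A Hoare rule for the nested loops: if the leaf program turns `I a` into `I (f a l)`, the
enumeration folds `f` over the list of leaves. By `hstable`, `I` does not see the loop registers; in
turn the leaf program and the inner loops preserve the registers of the outer loops. -/
lemma halts_levels {α : Type*} {S h one bd y₀ Y cl : ℕ} {leaf : Prog} {I : α → Mem → Prop}
    {f : α → Leaf → α} {Good : Leaf → Prop} (hbd : bd + 4 ≤ S) (hY : Y ≤ S) (hone : one < y₀)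
    (hstable : ∀ a σ τ, I a σ → (∀ w, w < 16 ∨ bd + 4 ≤ w → τ.W w = σ.W w) →
      (∀ w, w < y₀ ∨ Y ≤ w → τ.R w = σ.R w) → I a τ)
    (hconst : ∀ a σ, I a σ → σ.W 1 = 1 ∧ σ.W 3 = h + 1 ∧ σ.R one = 1)
    (hleaf : ∀ a σ l, Good l → I a σ → σ.W bd = l.rem → σ.W (bd + 1) = l.key →
      σ.W (bd + 2) = l.pos → σ.W (bd + 3) = l.sgn →
      Halts S leaf σ cl fun τ => I (f a l) τ ∧ (∀ w, 16 ≤ w → w < bd + 4 → τ.W w = σ.W w) ∧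
        ∀ w, y₀ ≤ w → w < Y → τ.R w = σ.R w) (k : ℕ) :
    ∀ (b c y : ℕ) (x : Fin k → ℝ) (r key pos : ℕ) (sg : ℤ) (a : α) (σ : Mem),
      b + 9 * k = bd → 16 ≤ b → y + k = Y → y₀ ≤ y → c + k ≤ y₀ → r ≤ h →
      (∀ i, x i ∈ Set.Ico (0 : ℝ) 1) → (∀ l ∈ leaves h k x r key pos sg, Good l) →
      (∀ a σ, I a σ → ∀ i : Fin k, σ.R (c + i) = x i) → I a σ →
      σ.W b = r → σ.W (b + 1) = key → σ.W (b + 2) = pos → σ.W (b + 3) = sg →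
      Halts S (levels leaf one k b c y) σ (levelsCost cl h k) fun τ =>
        I ((leaves h k x r key pos sg).foldl f a) τ ∧
        (∀ w, 16 ≤ w → w < b + 4 → τ.W w = σ.W w) ∧ ∀ w, y₀ ≤ w → w < y → τ.R w = σ.R w := by
  induction k with
  | zero =>
    intro b c y x r key pos sg a σ hb _ hy _ _ _ _ hgood _ hI h0 h1 h2 h3
    obtain rfl : b = bd := by omega
    obtain rfl : y = Y := by omega
    exact hleaf a σ ⟨r, key, pos, sg⟩ (hgood _ (List.mem_singleton_self _)) hI h0 h1 h2 h3
  | succ k ih =>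
    intro b c y x r key pos sg a σ hb hb16 hy hy₀ hc hr hx hgood hpt hI h0 h1 h2 h3
    have hx0 := hpt a σ hI 0
    simp only [Fin.val_zero, add_zero] at hx0
    set L : ℕ → List Leaf := fun s => leaves h k (Fin.tail x) (r - s) (key * (h + 1) + s)
      (pos * 2 ^ s + dyadic s (x 0) / 2) (sg * (-1) ^ dyadic s (x 0)) with hL
    -- The state before the iteration with first entry `s`: the registers hold `s`, the position,
    -- the digit string, `2 ^ s`, the sign and the fractional part. The position is the previous
    -- digit string, saved before it is doubled.
    let J : ℕ → Mem → Prop := fun s τ => I (((List.range s).flatMap L).foldl f a) τ ∧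
      (∀ w, 16 ≤ w → w < b + 4 → τ.W w = σ.W w) ∧ (∀ w, y₀ ≤ w → w < y → τ.R w = σ.R w) ∧
      τ.W (b + 4) = s ∧ τ.W (b + 5) = (dyadic s (x 0) / 2 : ℕ) ∧ τ.W (b + 6) = dyadic s (x 0) ∧
      τ.W (b + 7) = 2 ^ s ∧ τ.W (b + 8) = (-1) ^ dyadic s (x 0) ∧
      τ.R y = x 0 * 2 ^ s - dyadic s (x 0)
    have hmem : ∀ s, s < r + 1 → ∀ l ∈ L s, Good l := fun s hs l hl =>
      hgood l (List.mem_flatMap.2 ⟨s, List.mem_range.2 hs, hl⟩)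
    have hinit : J 0 (blockRun [.const (b + 4) 0, .const (b + 5) 0, .const (b + 6) 0,
        .const (b + 7) 1, .const (b + 8) 1, .cast y (b + 4), .radd y y c] σ) := by
      refine ⟨hstable a σ _ hI ?_ ?_, ?_⟩
      · intro w hw
        simp (disch := omega) only [blockRun, Instr.run, Function.update_of_ne]
      · intro w hw
        simp (disch := omega) only [blockRun, Instr.run, Function.update_of_ne]
      · have hd0 := dyadic_zero (hx 0)
        refine ⟨fun w _ _ => ?_, fun w _ _ => ?_, ?_⟩
        · simp (disch := omega) only [blockRun, Instr.run, Function.update_of_ne]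
        · simp (disch := omega) only [blockRun, Instr.run, Function.update_of_ne]
        · simp (disch := omega) [blockRun, Instr.run, Function.update_of_ne, hd0, hx0]
    have hloop := Halts.while_loop (S := S)
      (b := .ile (b + 4) b) (c := levelsCost cl h k + 15)
      (p := .seq (block [.isub (b + 9) b (b + 4), .imul (b + 10) (b + 1) 3,
        .iadd (b + 10) (b + 10) (b + 4), .imul (b + 11) (b + 2) (b + 7),
        .iadd (b + 11) (b + 11) (b + 5), .imul (b + 12) (b + 3) (b + 8)]) <|
        .seq (levels leaf one k (b + 9) (c + 1) (y + 1)) <|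
        .seq (block [.iadd (b + 4) (b + 4) 1, .imul (b + 5) (b + 6) 1,
          .iadd (b + 7) (b + 7) (b + 7), .iadd (b + 6) (b + 6) (b + 6), .radd y y y]) <|
        .ite (.rle one y)
          (block [.rsub y y one, .iadd (b + 6) (b + 6) 1, .const (b + 8) (-1)])
          (block [.const (b + 8) 1]))
      (by simp only [Test.Valid]; omega) J (r + 1) ?_ ?_
    · refine (Halts.seq (halts_block (by simp only [BlockValid, Instr.Valid, and_true]; omega)
        (hloop (r + 1) 0 _ (by omega) hinit))).mono ?_ ?_
      · simp only [levelsCost, List.length_cons, List.length_nil]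
        gcongr
      · intro τ hτ
        exact ⟨hτ.1, hτ.2.1, hτ.2.2.1⟩
    · rintro s τ hs ⟨hIτ, hW, hR, e4, e5, e6, e7, e8, ey⟩
      have e0 : τ.W b = r := by rw [hW b (by omega) (by omega), h0]
      have e1 : τ.W (b + 1) = key := by rw [hW _ (by omega) (by omega), h1]
      have e2 : τ.W (b + 2) = pos := by rw [hW _ (by omega) (by omega), h2]
      have e3 : τ.W (b + 3) = sg := by rw [hW _ (by omega) (by omega), h3]
      obtain ⟨c1, c3, c0⟩ := hconst _ _ hIτ
      refine ⟨by simp only [Test.Holds, e4, e0]; omega, ?_⟩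
      have hc15 : levelsCost cl h k + 15 = 6 + (levelsCost cl h k + (5 + (3 + 1))) := by ring
      rw [hc15]
      refine Halts.seq (halts_block (by simp only [BlockValid, Instr.Valid, and_true]; omega) ?_)
      refine Halts.seq ?_
      refine (ih (b + 9) (c + 1) (y + 1) (Fin.tail x) (r - s) (key * (h + 1) + s)
        (pos * 2 ^ s + dyadic s (x 0) / 2) (sg * (-1) ^ dyadic s (x 0))
        (((List.range s).flatMap L).foldl f a) _ (by omega) (by omega) (by omega) (by omega)
        (by omega) (by omega) (fun i => hx i.succ) (hmem s hs) ?_ ?_ ?_ ?_ ?_ ?_).mono le_rfl ?_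
      · intro a σ h i
        have := hpt a σ h i.succ
        rw [Fin.val_succ] at this
        rw [add_assoc, add_comm 1]
        exact this
      · refine hstable _ τ _ hIτ ?_ ?_
        · intro w hw
          simp (disch := omega) only [blockRun, Instr.run, Function.update_of_ne]
        · intro w hw
          rfl
      · simp (disch := omega) only [blockRun, Instr.run, Function.update_of_ne,
          Function.update_self, e0, e4]
        omega
      · simp (disch := omega) only [blockRun, Instr.run, Function.update_of_ne,
          Function.update_self, e1, c3, e4]
        push_cast
        rfl
      · simp (disch := omega) only [blockRun, Instr.run, Function.update_of_ne,
          Function.update_self, e2, e7, e5]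
        push_cast
        rfl
      · simp (disch := omega) only [blockRun, Instr.run, Function.update_of_ne,
          Function.update_self, e3, e8]
      · rintro ρ ⟨hIρ, hWρ, hRρ⟩
        obtain ⟨d1, d3, d0⟩ := hconst _ _ hIρ
        have hIρ' : I (((List.range (s + 1)).flatMap L).foldl f a) ρ := by
          rw [List.range_succ, List.flatMap_append, List.foldl_append]
          simpa using hIρ
        have hWτ : ∀ w, 16 ≤ w → w < b + 9 → ρ.W w = τ.W w := by
          intro w hw hw'
          rw [hWρ w hw (by omega)]
          simp (disch := omega) only [blockRun, Instr.run, Function.update_of_ne]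
        have hRτ : ∀ w, y₀ ≤ w → w < y + 1 → ρ.R w = τ.R w := fun w hw hw' => hRρ w hw hw'
        have g4 := (hWτ (b + 4) (by omega) (by omega)).trans e4
        have g6 := (hWτ (b + 6) (by omega) (by omega)).trans e6
        have g7 := (hWτ (b + 7) (by omega) (by omega)).trans e7
        have gy := (hRτ y (by omega) (by omega)).trans ey
        have hds := dyadic_succ_eq (hx 0).1 s
        have hdv : dyadic (s + 1) (x 0) / 2 = dyadic s (x 0) := dyadic_succ_div_two s (x 0)
        refine Halts.seq (halts_block (by simp only [BlockValid, Instr.Valid, and_true]; omega) ?_)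
        refine Halts.ite (by simp only [Test.Valid]; omega) ?_ ?_
        · intro ht
          simp (disch := omega) only [blockRun, Instr.run, Function.update_of_ne,
            Function.update_self, Test.Holds, gy, d0] at ht
          rw [if_pos ht] at hds
          refine halts_block (by simp only [BlockValid, Instr.Valid, and_true]; omega) ?_
          refine ⟨hstable _ ρ _ hIρ' ?_ ?_, ?_, ?_, ?_, ?_, ?_, ?_, ?_, ?_⟩
          · intro w hw
            simp (disch := omega) only [blockRun, Instr.run, Function.update_of_ne]
          · intro w hw
            simp (disch := omega) only [blockRun, Instr.run, Function.update_of_ne]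
          · intro w hw hw'
            rw [← hW w hw hw', ← hWτ w hw (by omega)]
            simp (disch := omega) only [blockRun, Instr.run, Function.update_of_ne]
          · intro w hw hw'
            rw [← hR w hw hw', ← hRτ w hw (by omega)]
            simp (disch := omega) only [blockRun, Instr.run, Function.update_of_ne]
          · simp (disch := omega) only [blockRun, Instr.run, Function.update_of_ne,
              Function.update_self, g4, d1]
            push_cast
            rfl
          · simp (disch := omega) only [blockRun, Instr.run, Function.update_of_ne,
              Function.update_self, g6, d1, hdv, mul_one]
          · simp (disch := omega) only [blockRun, Instr.run, Function.update_of_ne,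
              Function.update_self, g6, d1, hds]
            push_cast
            rfl
          · simp (disch := omega) only [blockRun, Instr.run, Function.update_of_ne,
              Function.update_self, g7]
            ring
          · simp (disch := omega) only [blockRun, Instr.run, Function.update_of_ne,
              Function.update_self]
            rw [hds, (Even.add_one ⟨_, rfl⟩).neg_one_pow]
          · simp (disch := omega) only [blockRun, Instr.run, Function.update_of_ne,
              Function.update_self, gy, d0, hds]
            push_cast
            ring
        · intro ht
          simp (disch := omega) only [blockRun, Instr.run, Function.update_of_ne,
            Function.update_self, Test.Holds, gy, d0] at ht
          rw [if_neg ht] at hds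
          refine (halts_block (by simp only [BlockValid, Instr.Valid, and_true]; omega) ?_).mono
            (by simp) (fun _ h => h)
          refine ⟨hstable _ ρ _ hIρ' ?_ ?_, ?_, ?_, ?_, ?_, ?_, ?_, ?_, ?_⟩
          · intro w hw
            simp (disch := omega) only [blockRun, Instr.run, Function.update_of_ne]
          · intro w hw
            simp (disch := omega) only [blockRun, Instr.run, Function.update_of_ne]
          · intro w hw hw'
            rw [← hW w hw hw', ← hWτ w hw (by omega)]
            simp (disch := omega) only [blockRun, Instr.run, Function.update_of_ne]
          · intro w hw hw'
            rw [← hR w hw hw', ← hRτ w hw (by omega)]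
            simp (disch := omega) only [blockRun, Instr.run, Function.update_of_ne]
          · simp (disch := omega) only [blockRun, Instr.run, Function.update_of_ne,
              Function.update_self, g4, d1]
            push_cast
            rfl
          · simp (disch := omega) only [blockRun, Instr.run, Function.update_of_ne,
              Function.update_self, g6, d1, hdv, mul_one]
          · simp (disch := omega) only [blockRun, Instr.run, Function.update_of_ne,
              Function.update_self, g6, hds]
            push_cast
            rfl
          · simp (disch := omega) only [blockRun, Instr.run, Function.update_of_ne,
              Function.update_self, g7]
            ring
          · simp (disch := omega) only [blockRun, Instr.run, Function.update_of_ne,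
              Function.update_self]
            rw [hds, Even.neg_one_pow ⟨_, rfl⟩]
          · simp (disch := omega) only [blockRun, Instr.run, Function.update_of_ne,
              Function.update_self, gy, hds]
            push_cast
            ring
    · rintro τ ⟨-, hW, -, e4, -⟩
      rw [Test.Holds, e4, hW b (by omega) (by omega), h0]
      push_cast
      omega

/-! ### Reading and updating the table -/

lemma foldl_add_eq {M β : Type*} [AddMonoid M] (g : β → M) (l : List β) (a : M) :
    l.foldl (fun a b => a + g b) a = a + (l.map g).sum := by
  induction l generalizing a with
  | nil => simp
  | cons b l ih => rw [List.foldl_cons, ih, List.map_cons, List.sum_cons, add_assoc]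

/-- The data of the leaves are kept in the integer cells `leafBase d, …, leafBase d + 3`. -/
abbrev leafBase (d : ℕ) : ℕ := 16 + 9 * d

/-- The code from which the codes of the order vectors are formed. It is so large that the table
does not overlap with the registers. -/
abbrev rootKey (d : ℕ) : ℕ := 20 + 9 * d

/-- An upper bound for the addresses of the table for the orders up to `h`. -/
def tableEnd (d h : ℕ) : ℕ := (rootKey d + 1) * (h + 1) ^ d * 2 ^ h

/-- The registers have their values for the orders up to `h`, and the point `x` is
in the real cells `1, …, d`. -/
structure Ready (h : ℕ) (x : Pt d) (σ : Mem) : Prop where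
  w1 : σ.W 1 = 1
  w2 : σ.W 2 = h
  w3 : σ.W 3 = h + 1
  w4 : σ.W 4 = 2 ^ h
  w13 : σ.W 13 = 0
  r1 : σ.R (d + 2) = 1
  pt : ∀ i : Fin d, σ.R (1 + i) = x i

/-- Outside the working cells of the enumeration, and outside the integer cells in `s`, the
memory did not change. -/
def Frame (d : ℕ) (s : Finset ℕ) (σ τ : Mem) : Prop :=
  (∀ w, (w < 16 ∨ leafBase d + 4 ≤ w) → w ∉ s → τ.W w = σ.W w) ∧
    ∀ w, (w < d + 6 ∨ 2 * d + 6 ≤ w) → τ.R w = σ.R w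

lemma Frame.ready {h : ℕ} {x : Pt d} {s : Finset ℕ} {σ τ : Mem} (hF : Frame d s σ τ)
    (hσ : Ready h x σ) (hs : ∀ w ∈ s, w ∉ ({1, 2, 3, 4, 13} : Finset ℕ)) : Ready h x τ := by
  have hW : ∀ w ∈ ({1, 2, 3, 4, 13} : Finset ℕ), τ.W w = σ.W w := fun w hw =>
    hF.1 w (by simp at hw; omega) fun h => hs w h hw
  refine ⟨?_, ?_, ?_, ?_, ?_, ?_, fun i => ?_⟩
  · rw [hW 1 (by simp), hσ.w1]
  · rw [hW 2 (by simp), hσ.w2]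
  · rw [hW 3 (by simp), hσ.w3]
  · rw [hW 4 (by simp), hσ.w4]
  · rw [hW 13 (by simp), hσ.w13]
  · rw [hF.2 _ (by omega), hσ.r1]
  · rw [hF.2 _ (by omega), hσ.pt]

/-- The program that enumerates the order vectors for the point in the real cells `1, …, d`. -/
def enumerate (d : ℕ) (leaf : Prog) : Prog :=
  .seq (block [.imul 16 2 1, .const 17 (rootKey d), .const 18 0, .const 19 1])
    (levels leaf (d + 2) d 16 1 (d + 6))

/-- One rule for queries and updates alike: `V a` says that the memory represents the accumulated
value `a`, and every leaf adds `g l` to it. -/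
lemma halts_enumerate {M : Type*} [AddMonoid M] {S h cl : ℕ} {leaf : Prog}
    {x : Pt d} (hx : x ∈ cube d) {σ : Mem} (hσ : Ready h x σ) (hS : tableEnd d h ≤ S)
    (V : M → Mem → Prop) (g : Leaf → M) {s : Finset ℕ}
    (hs : ∀ w ∈ s, w ∉ ({1, 2, 3, 4, 13} : Finset ℕ))
    (hV : ∀ a σ τ, V a σ → (∀ w, w < 16 ∨ leafBase d + 4 ≤ w → τ.W w = σ.W w) → V a τ)
    (hleaf : ∀ a τ l, l.addr h < S → leafBase d + 4 ≤ l.addr h → V a τ → Ready h x τ →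
      Frame d s σ τ → τ.W (leafBase d) = l.rem → τ.W (leafBase d + 1) = l.key →
      τ.W (leafBase d + 2) = l.pos → τ.W (leafBase d + 3) = l.sgn →
      Halts S leaf τ cl fun ρ => V (a + g l) ρ ∧ Frame d s τ ρ ∧
        (∀ w, 16 ≤ w → w < leafBase d + 4 → ρ.W w = τ.W w) ∧ ρ.R = τ.R)
    {a : M} (ha : V a σ) :
    Halts S (enumerate d leaf) σ (4 + levelsCost cl h d) fun τ =>
      V (a + ((leaves h d x h (rootKey d) 0 1).map g).sum) τ ∧ Frame d s σ τ := by
  have hS0 : rootKey d + 1 ≤ tableEnd d h := by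
    rw [tableEnd, mul_assoc]
    exact Nat.le_mul_of_pos_right _ (by positivity)
  simp only [rootKey] at hS0
  -- Every table address lies above all integer registers, because the code starts from `rootKey d`,
  -- and below the memory bound.
  have hgood : ∀ l ∈ leaves h d x h (rootKey d) 0 1,
      l.addr h < S ∧ leafBase d + 4 ≤ l.addr h := by
    intro l hl
    obtain ⟨s, hs, rfl⟩ := mem_leaves hl
    have h1 := leafAt_addr_lt (key := rootKey d) hx (mem_orderVectors.1 hs).2
    have h2 := le_leafAt_addr (key := rootKey d) (x := x) (mem_orderVectors.1 hs).2
    refine ⟨h1.trans_le hS, le_trans ?_ h2⟩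
    rw [mul_assoc]
    exact (by simp only [leafBase, rootKey]; omega : leafBase d + 4 ≤ rootKey d).trans
      (Nat.le_mul_of_pos_right _ (by positivity))
  rw [← foldl_add_eq]
  refine Halts.seq (halts_block (by simp only [BlockValid, Instr.Valid, and_true]; omega) ?_)
  refine (halts_levels (S := S) (h := h) (bd := leafBase d) (y₀ := d + 6) (Y := 2 * d + 6)
    (I := fun a τ => V a τ ∧ Frame d s σ τ) (by simp only [leafBase]; omega) (by omega) (by omega)
    ?_ ?_ ?_ d 16 1 (d + 6) x h (rootKey d) 0 1 a _ (by simp only [leafBase]) le_rfl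
    (by omega) le_rfl (by omega)
    le_rfl (mem_cube.1 hx) hgood ?_ ⟨?_, ?_, ?_⟩ ?_ ?_ ?_ ?_).mono le_rfl fun τ h => h.1
  · rintro a τ ρ ⟨h1, h2, h3⟩ hW hR
    exact ⟨hV a τ ρ h1 hW, fun w hw hws => (hW w hw).trans (h2 w hw hws),
      fun w hw => (hR w hw).trans (h3 w hw)⟩
  · rintro a τ ⟨-, hF⟩
    have := hF.ready hσ hs
    exact ⟨this.w1, this.w3, this.r1⟩
  · rintro a τ l hl ⟨h1, h2⟩ e0 e1 e2 e3
    refine (hleaf a τ l hl.1 hl.2 h1 (h2.ready hσ hs) h2 e0 e1 e2 e3).mono le_rfl ?_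
    rintro ρ ⟨g1, g2, g3, g4⟩
    refine ⟨⟨g1, fun w hw hws => (g2.1 w hw hws).trans (h2.1 w hw hws), fun w hw => ?_⟩, g3,
      fun w _ _ => by rw [g4]⟩
    rw [g4, h2.2 w hw]
  · rintro a τ ⟨-, hF⟩ i
    exact (hF.ready hσ hs).pt i
  · refine hV a σ _ ha fun w hw => ?_
    simp only [leafBase] at hw
    simp (disch := omega) only [blockRun, Instr.run, Function.update_of_ne]
  · intro w hw _
    simp only [leafBase] at hw
    simp (disch := omega) only [blockRun, Instr.run, Function.update_of_ne]
  · intro w hw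
    rfl
  · simp (disch := omega) only [blockRun, Instr.run, Function.update_of_ne,
      Function.update_self, hσ.w1, hσ.w2, mul_one]
  · simp (disch := omega) only [blockRun, Instr.run, Function.update_of_ne,
      Function.update_self]
  · simp (disch := omega) only [blockRun, Instr.run, Function.update_of_ne,
      Function.update_self]
    rfl
  · simp (disch := omega) only [blockRun, Instr.run, Function.update_self]

/-- The leaf program of a query: unless the order is zero, it adds `1` to the count in the integer
cell `7`, and the value of the Haar function with the sign opposite to that of the table entry to
the integer cell `6`. -/
def queryLeaf (d : ℕ) : Prog :=
  .ite (.ile 2 (leafBase d)) .skip <|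
  .seq (block [.imul 11 (leafBase d + 1) 4, .iadd 11 11 (leafBase d + 2), .iload 12 11,
    .iadd 7 7 1]) <|
  .ite (.ile 12 13) (.ite (.ile 13 12) .skip (block [.iadd 6 6 (leafBase d + 3)]))
    (block [.isub 6 6 (leafBase d + 3)])

/-- The leaf program of an update: it adds the value of the Haar function to the table entry. -/
def updateLeaf (d : ℕ) : Prog :=
  block [.imul 11 (leafBase d + 1) 4, .iadd 11 11 (leafBase d + 2), .iload 12 11,
    .iadd 12 12 (leafBase d + 3), .istore 11 12]

lemma halts_updateLeaf {S h : ℕ} {τ : Mem} {x : Pt d} (hτ : Ready h x τ) {T : ℕ → ℤ} {l : Leaf}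
    (hT : ∀ w, leafBase d + 4 ≤ w → τ.W w = T w) (hlt : l.addr h < S)
    (hle : leafBase d + 4 ≤ l.addr h) (e1 : τ.W (leafBase d + 1) = l.key)
    (e2 : τ.W (leafBase d + 2) = l.pos) (e3 : τ.W (leafBase d + 3) = l.sgn) :
    Halts S (updateLeaf d) τ 5 fun ρ =>
      (∀ w, leafBase d + 4 ≤ w → ρ.W w = T w + if l.addr h = w then l.sgn else 0) ∧
      Frame d ({11, 12} ∪ Finset.Ico (leafBase d + 4) S) τ ρ ∧
      (∀ w, 16 ≤ w → w < leafBase d + 4 → ρ.W w = τ.W w) ∧ ρ.R = τ.R := by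
  have hb : leafBase d = 16 + 9 * d := rfl
  have hA : (l.key : ℤ) * 2 ^ h + l.pos = (l.addr h : ℕ) := by
    rw [Leaf.addr]; push_cast; rfl
  have hA0 : (0 : ℤ) ≤ (l.addr h : ℕ) ∧ ((l.addr h : ℕ) : ℤ) < S := ⟨by omega, by omega⟩
  refine halts_block ?_ ⟨?_, ⟨?_, ?_⟩, ?_, ?_⟩
  · simp (disch := omega) only [BlockValid, Instr.Valid, Instr.run, Function.update_of_ne,
      Function.update_self, e1, e2, hτ.w4, hA, hA0, and_true]
    omega
  · intro w hw
    simp (disch := omega) only [blockRun, Instr.run, Function.update_of_ne,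
      Function.update_self, e1, e2, e3, hτ.w4, hA, Int.toNat_natCast]
    by_cases hwA : l.addr h = w
    · subst hwA
      rw [Function.update_self, if_pos rfl, hT _ hw]
    · rw [if_neg hwA, add_zero, ← hT w hw]
      simp (disch := omega) only [Function.update_of_ne]
  · intro w hw hws
    simp only [Finset.mem_union, Finset.mem_insert, Finset.mem_singleton, Finset.mem_Ico,
      not_or, not_and, not_lt] at hws
    have h1 : w ≠ l.addr h := by
      rintro rfl
      exact absurd (hws.2 hle) (by omega)
    simp (disch := omega) only [blockRun, Instr.run, Function.update_of_ne,
      Function.update_self, e1, e2, e3, hτ.w4, hA, Int.toNat_natCast]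
  · intro w hw
    rfl
  · intro w hw hw'
    simp (disch := omega) only [blockRun, Instr.run, Function.update_of_ne,
      Function.update_self, e1, e2, e3, hτ.w4, hA, Int.toNat_natCast]
  · rfl

/-- The accumulated value is the whole table as a function of the address, so the sum over the
leaves is taken in `ℕ → ℤ`. -/
lemma halts_update {S h : ℕ} {x : Pt d} (hx : x ∈ cube d) {σ : Mem} (hσ : Ready h x σ)
    (hS : tableEnd d h ≤ S) :
    Halts S (enumerate d (updateLeaf d)) σ (4 + levelsCost 5 h d) fun τ =>
      (∀ w, leafBase d + 4 ≤ w → τ.W w = σ.W w + tableInc h (rootKey d) x w) ∧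
      (∀ w, w < 16 → w ∉ ({11, 12} : Finset ℕ) → τ.W w = σ.W w) ∧
      ∀ w, (w < d + 6 ∨ 2 * d + 6 ≤ w) → τ.R w = σ.R w := by
  have hb : leafBase d = 16 + 9 * d := rfl
  refine (halts_enumerate (M := ℕ → ℤ) (cl := 5) (leaf := updateLeaf d) hx hσ hS
    (fun T τ => ∀ w, leafBase d + 4 ≤ w → τ.W w = T w)
    (fun l w => if l.addr h = w then l.sgn else 0)
    (s := {11, 12} ∪ Finset.Ico (leafBase d + 4) S) ?_ ?_ ?_ (a := σ.W) fun _ _ => rfl).mono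
    le_rfl ?_
  · intro w hw
    simp only [Finset.mem_union, Finset.mem_insert, Finset.mem_singleton, Finset.mem_Ico] at hw ⊢
    omega
  · intro T τ ρ h1 h2 w hw
    rw [h2 w (Or.inr hw), h1 w hw]
  · intro T τ l hlt hle hT hτ _ _ e1 e2 e3
    exact halts_updateLeaf hτ hT hlt hle e1 e2 e3
  · rintro τ ⟨h1, h2, h3⟩
    refine ⟨fun w hw => ?_, fun w hw hws => h2 w (Or.inl hw) ?_, h3⟩
    · rw [h1 w hw, Pi.add_apply, tableInc]
      congr 1
      refine (map_list_sum (Pi.evalAddMonoidHom (fun _ : ℕ => ℤ) w) _).trans ?_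
      rw [List.map_map]
      rfl
    · simp only [Finset.mem_union, Finset.mem_Ico, not_or]
      exact ⟨hws, by omega⟩

lemma halts_queryLeaf {S h : ℕ} {σ τ : Mem} {x : Pt d} (hτ : Ready h x τ) {a : ℤ × ℤ} {l : Leaf}
    (h6 : τ.W 6 = a.1) (h7 : τ.W 7 = a.2) (hF : Frame d {6, 7, 11, 12} σ τ) (hlt : l.addr h < S)
    (hle : leafBase d + 4 ≤ l.addr h) (e0 : τ.W (leafBase d) = l.rem)
    (e1 : τ.W (leafBase d + 1) = l.key)
    (e2 : τ.W (leafBase d + 2) = l.pos) (e3 : τ.W (leafBase d + 3) = l.sgn) :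
    Halts S (queryLeaf d) τ 8 fun ρ =>
      (ρ.W 6 = (a + if h ≤ l.rem then 0 else ((-σ.W (l.addr h)).sign * l.sgn, 1)).1 ∧
        ρ.W 7 = (a + if h ≤ l.rem then 0 else ((-σ.W (l.addr h)).sign * l.sgn, 1)).2) ∧
      Frame d {6, 7, 11, 12} τ ρ ∧
      (∀ w, 16 ≤ w → w < leafBase d + 4 → ρ.W w = τ.W w) ∧ ρ.R = τ.R := by
  have hb : leafBase d = 16 + 9 * d := rfl
  have hA : (l.key : ℤ) * 2 ^ h + l.pos = (l.addr h : ℕ) := by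
    rw [Leaf.addr]; push_cast; rfl
  have hA0 : (0 : ℤ) ≤ (l.addr h : ℕ) ∧ ((l.addr h : ℕ) : ℤ) < S := ⟨by omega, by omega⟩
  have hT : τ.W (l.addr h) = σ.W (l.addr h) := hF.1 _ (Or.inr hle) (by simp; omega)
  refine Halts.ite (c := 7) (by simp only [Test.Valid]; omega) ?_ ?_
  · intro ht
    have ht' : h ≤ l.rem := by
      simp only [Test.Holds, hτ.w2, e0] at ht
      exact_mod_cast ht
    refine (Halts.skip ?_).mono (by omega) (fun _ h => h)
    rw [if_pos ht', add_zero]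
    exact ⟨⟨h6, h7⟩, ⟨fun _ _ _ => rfl, fun _ _ => rfl⟩, fun _ _ _ => rfl, rfl⟩
  · intro ht
    have ht' : ¬ h ≤ l.rem := by
      simp only [Test.Holds, hτ.w2, e0] at ht
      exact_mod_cast ht
    simp only [if_neg ht']
    refine Halts.seq (c := 4) (c' := 3) (halts_block ?_ ?_)
    · simp (disch := omega) only [BlockValid, Instr.Valid, Instr.run, Function.update_of_ne,
        Function.update_self, e1, e2, hτ.w4, hA, hA0, and_true]
      omega
    refine Halts.ite (c := 2) (by simp only [Test.Valid]; omega) ?_ ?_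
    · intro ht1
      simp (disch := omega) only [Test.Holds, blockRun, Instr.run, Function.update_of_ne,
        Function.update_self, e1, e2, hτ.w4, hA, Int.toNat_natCast, hT, hτ.w13] at ht1
      refine Halts.ite (c := 1) (by simp only [Test.Valid]; omega) ?_ ?_
      · intro ht2
        simp (disch := omega) only [Test.Holds, blockRun, Instr.run, Function.update_of_ne,
          Function.update_self, e1, e2, hτ.w4, hA, Int.toNat_natCast, hT, hτ.w13] at ht2
        have hz : σ.W (l.addr h) = 0 := le_antisymm ht1 ht2
        refine (Halts.skip ?_).mono (by omega) (fun _ h => h)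
        refine ⟨⟨?_, ?_⟩, ⟨fun w hw hws => ?_, fun _ _ => rfl⟩, fun w hw hw' => ?_, rfl⟩
        · simp (disch := omega) only [blockRun, Instr.run, Function.update_of_ne, hz, neg_zero,
            Int.sign_zero, zero_mul, Prod.fst_add, add_zero, h6]
        · simp (disch := omega) only [blockRun, Instr.run, Function.update_of_ne,
            Function.update_self, h7, hτ.w1, Prod.snd_add]
        · simp only [Finset.mem_insert, Finset.mem_singleton, not_or] at hws
          simp (disch := omega) only [blockRun, Instr.run, Function.update_of_ne]
        · simp (disch := omega) only [blockRun, Instr.run, Function.update_of_ne]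
      · intro ht2
        simp (disch := omega) only [Test.Holds, blockRun, Instr.run, Function.update_of_ne,
          Function.update_self, e1, e2, hτ.w4, hA, Int.toNat_natCast, hT, hτ.w13] at ht2
        have hz : (-σ.W (l.addr h)).sign = 1 := Int.sign_eq_one_of_pos (by omega)
        refine halts_block (by simp only [BlockValid, Instr.Valid, and_true]; omega) ?_
        refine ⟨⟨?_, ?_⟩, ⟨fun w hw hws => ?_, fun _ _ => rfl⟩, fun w hw hw' => ?_, rfl⟩
        · simp (disch := omega) only [blockRun, Instr.run, Function.update_of_ne, hz,
            one_mul, Prod.fst_add, h6, e3, Function.update_self]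
        · simp (disch := omega) only [blockRun, Instr.run, Function.update_of_ne,
            Function.update_self, h7, hτ.w1, Prod.snd_add]
        · simp only [Finset.mem_insert, Finset.mem_singleton, not_or] at hws
          simp (disch := omega) only [blockRun, Instr.run, Function.update_of_ne]
        · simp (disch := omega) only [blockRun, Instr.run, Function.update_of_ne]
    · intro ht1
      simp (disch := omega) only [Test.Holds, blockRun, Instr.run, Function.update_of_ne,
        Function.update_self, e1, e2, hτ.w4, hA, Int.toNat_natCast, hT, hτ.w13] at ht1
      have hz : (-σ.W (l.addr h)).sign = -1 := Int.sign_eq_neg_one_of_neg (by omega)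
      refine (halts_block (by simp only [BlockValid, Instr.Valid, and_true]; omega) ?_).mono
        (by simp) (fun _ h => h)
      refine ⟨⟨?_, ?_⟩, ⟨fun w hw hws => ?_, fun _ _ => rfl⟩, fun w hw hw' => ?_, rfl⟩
      · simp (disch := omega) only [blockRun, Instr.run, Function.update_of_ne, hz,
          neg_one_mul, Prod.fst_add, h6, e3, Function.update_self]
        rfl
      · simp (disch := omega) only [blockRun, Instr.run, Function.update_of_ne,
          Function.update_self, h7, hτ.w1, Prod.snd_add]
      · simp only [Finset.mem_insert, Finset.mem_singleton, not_or] at hws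
        simp (disch := omega) only [blockRun, Instr.run, Function.update_of_ne]
      · simp (disch := omega) only [blockRun, Instr.run, Function.update_of_ne]

/-- The accumulated value is a pair: the signed sum in the density, and the number of order vectors
of order at least `1`. Thus `W(h)` is counted and no binomial coefficient has to be computed. -/
lemma halts_query {S h : ℕ} (hd : 1 ≤ d) {x : Pt d} (hx : x ∈ cube d) {σ : Mem}
    (hσ : Ready h x σ) (hS : tableEnd d h ≤ S) (h6 : σ.W 6 = 0) (h7 : σ.W 7 = 0) :
    Halts S (enumerate d (queryLeaf d)) σ (4 + levelsCost 8 h d) fun τ =>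
      τ.W 6 = ∑ s ∈ orderVectors d 1 h,
        (-σ.W ((leafAt h (rootKey d) x s).addr h)).sign * haarSgn s x ∧
      τ.W 7 = haarWeight d h ∧ Frame d {6, 7, 11, 12} σ τ := by
  refine (halts_enumerate (M := ℤ × ℤ) (cl := 8) (leaf := queryLeaf d) hx hσ hS
    (fun a τ => τ.W 6 = a.1 ∧ τ.W 7 = a.2)
    (fun l => if h ≤ l.rem then 0 else ((-σ.W (l.addr h)).sign * l.sgn, 1))
    (s := {6, 7, 11, 12}) ?_ ?_ ?_ (a := 0) ⟨h6, h7⟩).mono le_rfl ?_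
  · intro w hw
    simp only [Finset.mem_insert, Finset.mem_singleton] at hw ⊢
    omega
  · rintro a τ ρ ⟨h1, h2⟩ hW
    rw [hW 6 (by omega), hW 7 (by omega)]
    exact ⟨h1, h2⟩
  · rintro a τ l hlt hle ⟨h1, h2⟩ hτ hF e0 e1 e2 e3
    exact halts_queryLeaf hτ h1 h2 hF hlt hle e0 e1 e2 e3
  · rintro τ ⟨⟨h1, h2⟩, h3⟩
    have hsum : ((leaves h d x h (rootKey d) 0 1).map fun l =>
        if h ≤ l.rem then (0 : ℤ × ℤ) else ((-σ.W (l.addr h)).sign * l.sgn, 1)).sum =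
        ∑ s ∈ orderVectors d 1 h,
          ((-σ.W ((leafAt h (rootKey d) x s).addr h)).sign * haarSgn s x, (1 : ℤ)) := by
      -- What remains of `h` equals `h` exactly when the order is `0`; this is the case that the
      -- leaf program skips.
      have hfil : orderVectors d 1 h = (orderVectors d 0 h).filter fun s =>
          ¬ h ≤ (leafAt h (rootKey d) x s).rem := by
        ext s
        simp only [Finset.mem_filter, mem_orderVectors, leafAt, leafOf_rem]
        omega
      rw [sum_leaves, hfil, Finset.sum_filter]
      refine Finset.sum_congr rfl fun s _ => ?_
      simp only [← leafAt.eq_1]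
      rw [ite_not]
      congr 3
      rw [leafAt, leafOf_sgn, one_mul]
    rw [hsum, zero_add] at h1 h2
    rw [Prod.fst_sum] at h1
    rw [Prod.snd_sum, Finset.sum_const, card_orderVectors d h hd, nsmul_one] at h2
    exact ⟨h1, h2, h3⟩

/-! ### The online algorithm -/

/-- The address of the first stored point. -/
abbrev pointBase (d : ℕ) : ℕ := 2 * d + 6

/-- Storing the first `k` coordinates of the shown point, the first of them at the address `W[10]`. -/
def storePoint : ℕ → Prog
  | 0 => .skip
  | k + 1 => .seq (storePoint k) (block [.rstore 10 (1 + k), .iadd 10 10 1])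

/-- Copying the first `k` coordinates of a stored point into the real cells `1, …, k`. -/
def loadPoint : ℕ → Prog
  | 0 => .skip
  | k + 1 => .seq (loadPoint k) (block [.rload (1 + k) 10, .iadd 10 10 1])

lemma halts_storePoint {S p : ℕ} {σ : Mem} (k : ℕ) (hS : 16 ≤ S) (hp : k < p) (hpS : p + k ≤ S)
    (h1 : σ.W 1 = 1) (h10 : σ.W 10 = p) :
    Halts S (storePoint k) σ (2 * k) fun τ => τ.W = Function.update σ.W 10 (p + k : ℕ) ∧
      (∀ i < k, τ.R (p + i) = σ.R (1 + i)) ∧ ∀ w, (w < p ∨ p + k ≤ w) → τ.R w = σ.R w := by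
  induction k with
  | zero =>
    refine Halts.skip ⟨?_, fun i hi => absurd hi (by omega), fun w _ => rfl⟩
    rw [add_zero, ← h10, Function.update_eq_self]
  | succ k ih =>
    refine Halts.seq (c := 2 * k) (c' := 2) ((ih (by omega) (by omega)).mono le_rfl ?_)
    rintro τ ⟨hW, hR, hR'⟩
    have e10 : τ.W 10 = (p + k : ℕ) := by rw [hW, Function.update_self]
    have e1 : τ.W 1 = 1 := by rw [hW, Function.update_of_ne (by omega), h1]
    refine halts_block ?_ ⟨?_, fun i hi => ?_, fun w hw => ?_⟩
    · simp only [BlockValid, Instr.Valid, e10, and_true]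
      omega
    · simp only [blockRun, Instr.run, e10, e1]
      rw [hW, Function.update_idem]
      push_cast
      rw [add_assoc]
    · simp only [blockRun, Instr.run, e10, Int.toNat_natCast]
      by_cases h : i = k
      · subst h
        rw [Function.update_self, hR' _ (by omega)]
      · rw [Function.update_of_ne (by omega), hR i (by omega)]
    · simp only [blockRun, Instr.run, e10, Int.toNat_natCast]
      rw [Function.update_of_ne (by omega), hR' _ (by omega)]

lemma halts_loadPoint {S p : ℕ} {σ : Mem} (k : ℕ) (hS : 16 ≤ S) (hp : k < p) (hpS : p + k ≤ S)
    (h1 : σ.W 1 = 1) (h10 : σ.W 10 = p) :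
    Halts S (loadPoint k) σ (2 * k) fun τ => τ.W = Function.update σ.W 10 (p + k : ℕ) ∧
      (∀ i < k, τ.R (1 + i) = σ.R (p + i)) ∧ ∀ w, (w = 0 ∨ k < w) → τ.R w = σ.R w := by
  induction k with
  | zero =>
    refine Halts.skip ⟨?_, fun i hi => absurd hi (by omega), fun w _ => rfl⟩
    rw [add_zero, ← h10, Function.update_eq_self]
  | succ k ih =>
    refine Halts.seq (c := 2 * k) (c' := 2) ((ih (by omega) (by omega)).mono le_rfl ?_)
    rintro τ ⟨hW, hR, hR'⟩
    have e10 : τ.W 10 = (p + k : ℕ) := by rw [hW, Function.update_self]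
    have e1 : τ.W 1 = 1 := by rw [hW, Function.update_of_ne (by omega), h1]
    refine halts_block ?_ ⟨?_, fun i hi => ?_, fun w hw => ?_⟩
    · simp only [BlockValid, Instr.Valid, e10, and_true]
      omega
    · simp only [blockRun, Instr.run, e10, e1]
      rw [hW, Function.update_idem]
      push_cast
      rw [add_assoc]
    · simp only [blockRun, Instr.run, e10, Int.toNat_natCast]
      by_cases h : i = k
      · subst h
        rw [Function.update_self, hR' _ (by omega)]
      · rw [Function.update_of_ne (by omega), hR i (by omega)]
    · simp only [blockRun, Instr.run, e10, Int.toNat_natCast]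
      rw [Function.update_of_ne (by omega), hR' _ (by omega)]

/-- The online algorithm. Integer registers: `1` the constant one, `2`, `3`, `4`, `8` the numbers
`h`, `h + 1`, `2 ^ h`, `2 ^ (h + 1)`, `5` the number of the current round, `9` the address where
the next point is stored, `13` the constant zero. Whenever `h` grows, the
table is built anew, at addresses that have not been used before. -/
def haarAlg (d : ℕ) : OnlineAlg where
  init := block [.const 1 1, .const 3 1, .const 4 1, .const 5 1, .const 8 2,
    .const 9 (pointBase d), .cast (d + 2) 1]
  decide :=
    .seq (block [.const 6 0, .const 7 0]) <|
    .seq (enumerate d (queryLeaf d)) <|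
    .seq (.ite (.ile 7 13) (block [.const 7 1]) .skip) <|
    .seq (block [.cast (d + 3) 7, .cast (d + 4) 6, .rsub (d + 4) (d + 4) (d + 3),
      .rmul (d + 4) (d + 4) 0, .radd (d + 3) (d + 3) (d + 3), .rsub (d + 5) (d + 2) (d + 1),
      .rmul (d + 3) (d + 3) (d + 5), .radd (d + 3) (d + 3) (d + 4), .cast (d + 5) 13]) <|
    .ite (.rle (d + 5) (d + 3)) (block [.const 0 0]) (block [.const 0 1])
  record :=
    .seq (block [.imul 10 9 1]) <|
    .seq (storePoint d) <|
    .seq (block [.iadd 5 5 1, .imul 10 9 1]) <|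
    .seq (.ite (.ile 8 5) (block [.iadd 2 2 1, .iadd 3 3 1, .imul 4 8 1, .iadd 8 8 8,
      .const 10 (pointBase d)]) .skip) <|
    .seq (.while (.ile 10 9) (.seq (loadPoint d) (enumerate d (updateLeaf d)))) <|
    block [.imul 9 10 1]

/-- The memory is prepared for the orders up to `h`; the first `n` points are stored, and the first
`j` of them are recorded in the table. -/
structure Prepared (β : ℝ) (z : ℕ → Pt d) (h n j : ℕ) (σ : Mem) : Prop where
  w1 : σ.W 1 = 1
  w2 : σ.W 2 = h
  w3 : σ.W 3 = h + 1
  w4 : σ.W 4 = 2 ^ h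
  w8 : σ.W 8 = 2 ^ (h + 1)
  w13 : σ.W 13 = 0
  r0 : σ.R 0 = β
  r1 : σ.R (d + 2) = 1
  pts : ∀ m < n, ∀ i : Fin d, σ.R (pointBase d + d * m + i) = z m i
  table : ∀ w, rootKey d * (h + 1) ^ d * 2 ^ h ≤ w →
    σ.W w = ∑ m ∈ Finset.range j, tableInc h (rootKey d) (z m) w

lemma rootKey_le (d h : ℕ) : rootKey d ≤ rootKey d * (h + 1) ^ d * 2 ^ h := by
  rw [mul_assoc]
  exact Nat.le_mul_of_pos_right _ (by positivity)

lemma Prepared.congr {β : ℝ} {z : ℕ → Pt d} {h n j : ℕ} {σ τ : Mem} (hσ : Prepared β z h n j σ)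
    (hW : ∀ w ∈ ({1, 2, 3, 4, 8, 13} : Finset ℕ), τ.W w = σ.W w)
    (hW' : ∀ w, leafBase d + 4 ≤ w → τ.W w = σ.W w)
    (hR : ∀ w, (w = 0 ∨ w = d + 2 ∨ pointBase d ≤ w) → τ.R w = σ.R w) : Prepared β z h n j τ where
  w1 := by rw [hW 1 (by simp), hσ.w1]
  w2 := by rw [hW 2 (by simp), hσ.w2]
  w3 := by rw [hW 3 (by simp), hσ.w3]
  w4 := by rw [hW 4 (by simp), hσ.w4]
  w8 := by rw [hW 8 (by simp), hσ.w8]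
  w13 := by rw [hW 13 (by simp), hσ.w13]
  r0 := by rw [hR _ (by simp), hσ.r0]
  r1 := by rw [hR _ (by simp), hσ.r1]
  pts m hm i := by rw [hR _ (by omega), hσ.pts m hm]
  table w hw := by
    have := rootKey_le d h
    rw [hW' w (by simp only [rootKey, leafBase] at *; omega), hσ.table w hw]

lemma Prepared.ready {β : ℝ} {z : ℕ → Pt d} {h n j : ℕ} {σ : Mem} (hσ : Prepared β z h n j σ) {x : Pt d}
    (hx : ∀ i : Fin d, σ.R (1 + i) = x i) : Ready h x σ :=
  ⟨hσ.w1, hσ.w2, hσ.w3, hσ.w4, hσ.w13, hσ.r1, hx⟩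

/-- The table for `h + 1` starts at or above `tableEnd d h`, since `2 ^ h` doubles and `rootKey d +
1 ≤ 2 * rootKey d`. No recorded point has touched these cells, so they are still `0` and represent
an empty table. -/
lemma Prepared.grow {β : ℝ} {z : ℕ → Pt d} {h n j : ℕ} {σ τ : Mem} (hσ : Prepared β z h n j σ)
    (hz : ∀ m, z m ∈ cube d)
    (w1 : τ.W 1 = 1) (w2 : τ.W 2 = σ.W 2 + 1) (w3 : τ.W 3 = σ.W 3 + 1) (w4 : τ.W 4 = σ.W 8)
    (w8 : τ.W 8 = σ.W 8 + σ.W 8) (w13 : τ.W 13 = 0)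
    (hW' : ∀ w, leafBase d + 4 ≤ w → τ.W w = σ.W w) (hR : τ.R = σ.R) :
    Prepared β z (h + 1) n 0 τ where
  w1 := w1
  w2 := by rw [w2, hσ.w2]; push_cast; rfl
  w3 := by rw [w3, hσ.w3]; push_cast; rfl
  w4 := by rw [w4, hσ.w8]
  w8 := by rw [w8, hσ.w8]; ring
  w13 := w13
  r0 := by rw [hR, hσ.r0]
  r1 := by rw [hR, hσ.r1]
  pts m hm i := by rw [hR, hσ.pts m hm]
  table w hw := by
    have h1 := rootKey_le d (h + 1)
    have h2 : tableEnd d h ≤ w := by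
      refine le_trans ?_ hw
      calc tableEnd d h ≤ (rootKey d * 2) * (h + 1 + 1) ^ d * 2 ^ h := by
            rw [tableEnd]
            gcongr
            · simp only [rootKey]; omega
            · omega
        _ = _ := by ring
    have h3 : rootKey d * (h + 1) ^ d * 2 ^ h ≤ w := by
      refine le_trans ?_ h2
      rw [tableEnd]
      gcongr
      omega
    rw [hW' w (by simp only [rootKey, leafBase] at *; omega), hσ.table w h3, Finset.range_zero,
      Finset.sum_empty]
    exact Finset.sum_eq_zero fun m _ => tableInc_of_le (hz m) h2

lemma showPoint_apply (σ : Mem) (x : Pt d) (i : Fin d) : (σ.showPoint x).R (1 + i) = x i := by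
  have h : 0 < 1 + (i : ℕ) ∧ 1 + (i : ℕ) - 1 < d := ⟨by omega, by omega⟩
  simp only [Mem.showPoint, h, and_self, dif_pos]
  congr 1
  ext
  simp

lemma showPoint_of (σ : Mem) (x : Pt d) {a : ℕ} (ha : a = 0 ∨ d < a) :
    (σ.showPoint x).R a = σ.R a := by
  simp only [Mem.showPoint]
  rw [dif_neg (by omega)]

/-- The memory after `n` rounds. -/
def AfterRound (β : ℝ) (z : ℕ → Pt d) (n : ℕ) (σ : Mem) : Prop :=
  Prepared β z (Nat.log 2 (n + 1)) n n σ ∧ σ.W 5 = (n + 1 : ℕ) ∧ σ.W 9 = (pointBase d + d * n : ℕ)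

lemma halts_init (β : ℝ) (z : ℕ → Pt d) {S : ℕ} (hS : 20 + 9 * d ≤ S) :
    Halts S (haarAlg d).init (Mem.start β) 7 (AfterRound β z 0) := by
  refine halts_block (by simp only [BlockValid, Instr.Valid, and_true]; omega) ?_
  have hl : Nat.log 2 (0 + 1) = 0 := by simp
  rw [AfterRound, hl]
  refine ⟨⟨?_, ?_, ?_, ?_, ?_, ?_, ?_, ?_, ?_, ?_⟩, ?_, ?_⟩
  · simp [blockRun, Instr.run, Mem.start]
  · simp [blockRun, Instr.run, Mem.start]
  · simp [blockRun, Instr.run, Mem.start]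
  · simp [blockRun, Instr.run, Mem.start]
  · simp [blockRun, Instr.run, Mem.start]
  · simp [blockRun, Instr.run, Mem.start]
  · simp [blockRun, Instr.run, Mem.start]
  · simp [blockRun, Instr.run, Mem.start]
  · intro m hm
    omega
  · intro w hw
    have := (rootKey_le d 0).trans hw
    simp only [rootKey] at this
    simp (disch := omega) only [blockRun, Instr.run, Function.update_of_ne, Mem.start]
    simp
  · simp [blockRun, Instr.run, Mem.start]
  · simp [blockRun, Instr.run, Mem.start]

lemma lt_tableEnd (d h : ℕ) : 20 + 9 * d < tableEnd d h := by
  have : rootKey d + 1 ≤ tableEnd d h := by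
    rw [tableEnd, mul_assoc]
    exact Nat.le_mul_of_pos_right _ (by positivity)
  simp only [rootKey] at this
  omega

lemma Prepared.table_leafAt {β : ℝ} {z : ℕ → Pt d} {h n : ℕ} {σ : Mem} (hσ : Prepared β z h n n σ)
    (hz : ∀ m, z m ∈ cube d) {x : Pt d} (hx : x ∈ cube d) {s : Fin d → ℕ} (hs : ∑ i, s i ≤ h) :
    σ.W ((leafAt h (rootKey d) x s).addr h) =
      haarPairing (fun i : Fin n => z i) s (haarPos s x) := by
  rw [hσ.table _ (le_leafAt_addr hs), haarPairing,
    Fin.sum_univ_eq_sum_range (fun j => haar s (haarPos s x) (z j))]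
  exact Finset.sum_congr rfl fun m _ => tableInc_leafAt hx (hz m) hs

/-- The machine cannot divide, so the inequality `u ≤ λ - β/2` is multiplied by `2W`. For `W = 0`
the signed sum is empty and `W` may be replaced by `1`, which turns the test into `u ≤ 1 - β/2`. -/
lemma rejectBit_haarStrategy {β : ℝ} (n : ℕ) (z : Fin n → Pt d) {x : Pt d} (hx : x ∈ cube d)
    (u : ℝ) (v : ℕ)
    (hv : v = if haarWeight d (Nat.log 2 (n + 1)) = 0 then 1 else haarWeight d (Nat.log 2 (n + 1))) :
    rejectBit (haarStrategy d β) n z x u =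
      if 0 ≤ ((v : ℝ) + v) * (1 - u) + (((∑ s ∈ orderVectors d 1 (Nat.log 2 (n + 1)),
        (-haarPairing z s (haarPos s x)).sign * haarSgn s x : ℤ) : ℝ) - v) * β then 0 else 1 := by
  rw [rejectBit, haarStrategy, haarDensity,
    sum_haarIndex 1 _ hx fun s a => (-haarPairing z s a).sign]
  set D : ℤ := ∑ s ∈ orderVectors d 1 (Nat.log 2 (n + 1)),
    (-haarPairing z s (haarPos s x)).sign * haarSgn s x with hD
  rw [← ite_not]
  refine if_congr ?_ rfl rfl
  rw [not_lt]
  by_cases hw : haarWeight d (Nat.log 2 (n + 1)) = 0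
  · have h0 : Nat.log 2 (n + 1) = 0 := by
      by_contra h
      exact (haarWeight_pos d (Nat.pos_of_ne_zero h)).ne' hw
    have hD0 : D = 0 := by
      rw [hD, h0]
      refine Finset.sum_eq_zero fun s hs => ?_
      have := mem_orderVectors.1 hs
      omega
    rw [if_pos hw] at hv
    rw [hw, hD0, hv]
    push_cast
    rw [mul_zero, add_zero]
    constructor <;> intro h <;> linarith
  · rw [if_neg hw] at hv
    rw [← hv]
    have hv0 : (0 : ℝ) < v := by
      rw [hv]
      exact_mod_cast Nat.pos_of_ne_zero hw
    have key : ((v : ℝ) + v) * (1 - u) + ((D : ℝ) - v) * β =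
        2 * v * (1 + β / (2 * v) * D - β / 2 - u) := by
      field_simp
      ring
    rw [key, mul_nonneg_iff_of_pos_left (by positivity), sub_nonneg]

lemma halts_decide {β : ℝ} (hd : 1 ≤ d) {z : ℕ → Pt d} (hz : ∀ m, z m ∈ cube d) {x : Pt d}
    (hx : x ∈ cube d) {S n : ℕ} {σ : Mem} (hσ : AfterRound β z n σ)
    (hS : tableEnd d (Nat.log 2 (n + 1)) ≤ S) (u : ℝ) :
    Halts S (haarAlg d).decide ((σ.showPoint x).showRandom d u)
      (19 + levelsCost 8 (Nat.log 2 (n + 1)) d) fun τ =>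
        τ.W 0 = (rejectBit (haarStrategy d β) n (fun i => z i) x u : ℤ) ∧ AfterRound β z n τ := by
  obtain ⟨hP, h5, h9⟩ := hσ
  have hb : leafBase d = 16 + 9 * d := rfl
  have hp : pointBase d = 2 * d + 6 := rfl
  have hSd := (lt_tableEnd d (Nat.log 2 (n + 1))).trans_le hS
  set h := Nat.log 2 (n + 1) with hh
  set σ' := blockRun [.const 6 0, .const 7 0] ((σ.showPoint x).showRandom d u) with hσ'
  have hW' : ∀ w, w ≠ 6 → w ≠ 7 → σ'.W w = σ.W w := fun w h6 h7 => by
    simp only [hσ', blockRun, Instr.run, Function.update_of_ne h6, Function.update_of_ne h7]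
    rfl
  have hR' : ∀ w, (w = 0 ∨ d + 1 < w) → σ'.R w = σ.R w := fun w hw => by
    simp only [hσ', blockRun, Instr.run, Mem.showRandom]
    rw [Function.update_of_ne (by omega), showPoint_of _ _ (by omega)]
  have hx' : ∀ i : Fin d, σ'.R (1 + i) = x i := fun i => by
    simp only [hσ', blockRun, Instr.run, Mem.showRandom]
    rw [Function.update_of_ne (by omega), showPoint_apply]
  have hu' : σ'.R (d + 1) = u := by
    simp only [hσ', blockRun, Instr.run, Mem.showRandom]
    rw [Function.update_self]
  have hP' : Prepared β z h n n σ' := by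
    refine hP.congr (fun w hw => ?_) (fun w hw => ?_) (fun w hw => ?_)
    · simp only [Finset.mem_insert, Finset.mem_singleton] at hw
      exact hW' w (by omega) (by omega)
    · exact hW' w (by omega) (by omega)
    · exact hR' w (by omega)
  have hc : 19 + levelsCost 8 h d = 2 + ((4 + levelsCost 8 h d) + (2 + (9 + 2))) := by ring
  rw [hc]
  refine Halts.seq (halts_block (by simp only [BlockValid, Instr.Valid, and_true]; omega) ?_)
  rw [← hσ']
  refine Halts.seq ((halts_query hd hx (hP'.ready hx') hS (by simp [hσ', blockRun, Instr.run])
    (by simp [hσ', blockRun, Instr.run])).mono le_rfl ?_)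
  rintro τ ⟨e6, e7, hF⟩
  rw [Finset.sum_congr rfl fun s hs => by
    rw [hP'.table_leafAt hz hx (mem_orderVectors.1 hs).2]] at e6
  have k1 : τ.W 1 = 1 := by rw [hF.1 _ (by simp) (by simp), hP'.w1]
  have k13 : τ.W 13 = 0 := by rw [hF.1 _ (by simp) (by simp), hP'.w13]
  have k0 : τ.R 0 = β := by rw [hF.2 _ (by simp), hP'.r0]
  have ku : τ.R (d + 1) = u := by rw [hF.2 _ (by omega), hu']
  have kr : τ.R (d + 2) = 1 := by rw [hF.2 _ (by omega), hP'.r1]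
  obtain ⟨v, hv⟩ : ∃ v : ℕ, v = if haarWeight d h = 0 then 1 else haarWeight d h := ⟨_, rfl⟩
  refine Halts.seq (Halts.mono (c := 2)
    (Q := fun ρ => ρ.W = Function.update τ.W 7 (v : ℤ) ∧ ρ.R = τ.R) ?_ le_rfl ?_)
  · refine Halts.ite (c := 1) (by simp only [Test.Valid]; omega) ?_ ?_
    · intro ht
      simp only [Test.Holds, e7, k13] at ht
      have hw0 : haarWeight d h = 0 := by omega
      rw [if_pos hw0] at hv
      refine halts_block (by simp only [BlockValid, Instr.Valid, and_true]; omega) ⟨?_, rfl⟩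
      simp only [blockRun, Instr.run, hv]
      rfl
    · intro ht
      simp only [Test.Holds, e7, k13] at ht
      have hw0 : haarWeight d h ≠ 0 := by omega
      rw [if_neg hw0] at hv
      refine (Halts.skip ⟨?_, rfl⟩).mono (by omega) (fun _ h => h)
      rw [hv, ← e7, Function.update_eq_self]
  · rintro ρ ⟨hρW, hρR⟩
    have m6 : ρ.W 6 = τ.W 6 := by rw [hρW, Function.update_of_ne (by omega)]
    have m7 : ρ.W 7 = v := by rw [hρW, Function.update_self]
    have m13 : ρ.W 13 = 0 := by rw [hρW, Function.update_of_ne (by omega), k13]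
    have hPρ : ∀ ρ' : Mem, (∀ w, w ≠ 0 → ρ'.W w = ρ.W w) →
        (∀ w, (w < d + 3 ∨ d + 6 ≤ w) → ρ'.R w = ρ.R w) → AfterRound β z n ρ' := by
      intro ρ' hW hR
      have hWσ : ∀ w, w ≠ 0 → w ≠ 6 → w ≠ 7 → w ≠ 11 → w ≠ 12 → (w < 16 ∨ leafBase d + 4 ≤ w) →
          ρ'.W w = σ.W w := by
        intro w w0 w6 w7 w11 w12 hw
        rw [hW w w0, hρW, Function.update_of_ne w7, hF.1 w hw (by simp; omega), hW' w w6 w7]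
      refine ⟨hP.congr (fun w hw => ?_) (fun w hw => ?_) (fun w hw => ?_), ?_, ?_⟩
      · simp only [Finset.mem_insert, Finset.mem_singleton] at hw
        exact hWσ w (by omega) (by omega) (by omega) (by omega) (by omega) (by omega)
      · exact hWσ w (by omega) (by omega) (by omega) (by omega) (by omega) (by omega)
      · rw [hR w (by omega), hρR, hF.2 w (by omega), hR' w (by omega)]
      · rw [hWσ 5 (by omega) (by omega) (by omega) (by omega) (by omega) (by omega), h5]
      · rw [hWσ 9 (by omega) (by omega) (by omega) (by omega) (by omega) (by omega), h9]
    refine Halts.seq (halts_block (by simp only [BlockValid, Instr.Valid, and_true]; omega) ?_)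
    rw [rejectBit_haarStrategy n _ hx u v hv, ← hh, ← e6]
    refine Halts.ite (c := 1) (by simp only [Test.Valid]; omega) ?_ ?_
    · intro ht
      simp (disch := omega) only [Test.Holds, blockRun, Instr.run, Function.update_of_ne,
        Function.update_self, m6, m7, m13, hρR, k0, ku, kr, Int.cast_natCast, Int.cast_zero] at ht
      rw [if_pos ht]
      refine halts_block (by simp only [BlockValid, Instr.Valid, and_true]; omega) ⟨?_, ?_⟩
      · simp only [blockRun, Instr.run, Function.update_self]
        rfl
      · refine hPρ _ (fun w hw => ?_) (fun w hw => ?_)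
        · simp (disch := omega) only [blockRun, Instr.run, Function.update_of_ne]
        · simp (disch := omega) only [blockRun, Instr.run, Function.update_of_ne]
    · intro ht
      simp (disch := omega) only [Test.Holds, blockRun, Instr.run, Function.update_of_ne,
        Function.update_self, m6, m7, m13, hρR, k0, ku, kr, Int.cast_natCast, Int.cast_zero] at ht
      rw [if_neg ht]
      refine halts_block (by simp only [BlockValid, Instr.Valid, and_true]; omega) ⟨?_, ?_⟩
      · simp only [blockRun, Instr.run, Function.update_self]
        rfl
      · refine hPρ _ (fun w hw => ?_) (fun w hw => ?_)
        · simp (disch := omega) only [blockRun, Instr.run, Function.update_of_ne]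
        · simp (disch := omega) only [blockRun, Instr.run, Function.update_of_ne]

/-- The number of points that are recorded in the table after the sample of index `n`. -/
def recordCount (n : ℕ) : ℕ := if Nat.log 2 (n + 2) = Nat.log 2 (n + 1) then 1 else n + 1

/-- In an ordinary round only the new point is entered into the table. When `n + 2` is a power of
two, `h` grows and the same loop starts from the first stored point, filling a new table. -/
lemma halts_record {β : ℝ} (hd : 1 ≤ d) {z : ℕ → Pt d} (hz : ∀ m, z m ∈ cube d) {S n : ℕ}
    {σ : Mem} (hσ : AfterRound β z n σ) (hS : tableEnd d (Nat.log 2 (n + 2)) ≤ S)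
    (hS' : pointBase d + d * (n + 1) ≤ S) :
    Halts S (haarAlg d).record (σ.showPoint (z n))
      (2 * d + 11 + recordCount n * (2 * d + 5 + levelsCost 5 (Nat.log 2 (n + 2)) d))
      (AfterRound β z (n + 1)) := by
  obtain ⟨hP, h5, h9⟩ := hσ
  have hb : leafBase d = 16 + 9 * d := rfl
  have hp : pointBase d = 2 * d + 6 := rfl
  have hSd := (lt_tableEnd d (Nat.log 2 (n + 2))).trans_le hS
  rw [mul_add, mul_one] at hS'
  set L := levelsCost 5 (Nat.log 2 (n + 2)) d
  have hc : 2 * d + 11 + recordCount n * (2 * d + 5 + L) =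
      1 + (2 * d + (2 + (6 + ((recordCount n * (2 * d + (4 + L) + 1) + 1) + 1)))) := by ring
  rw [hc]
  refine Halts.seq (halts_block (by simp only [BlockValid, Instr.Valid, and_true]; omega) ?_)
  refine Halts.seq ((halts_storePoint (S := S) (p := pointBase d + d * n) d (by omega) (by omega)
    (by omega) ?_ ?_).mono le_rfl ?_)
  · simp (disch := omega) only [blockRun, Instr.run, Function.update_of_ne]
    exact hP.w1
  · simp (disch := omega) only [blockRun, Instr.run, Function.update_self]
    simp only [Mem.showPoint, hP.w1, h9, mul_one]
  rintro τ ⟨hτW, hτR, hτR'⟩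
  have hW : ∀ w, w ≠ 10 → τ.W w = σ.W w := by
    intro w hw
    rw [hτW, Function.update_of_ne hw]
    simp only [blockRun, Instr.run, Function.update_of_ne hw]
    rfl
  have hR : ∀ w, (w = 0 ∨ d < w ∧ w < pointBase d + d * n) → τ.R w = σ.R w := by
    intro w hw
    rw [hτR' w (by omega)]
    exact showPoint_of _ _ (by omega)
  have hPτ : Prepared β z (Nat.log 2 (n + 1)) (n + 1) n τ := by
    have hd2 : d + 2 < pointBase d := by omega
    refine ⟨?_, ?_, ?_, ?_, ?_, ?_, ?_, ?_, fun m hm i => ?_, fun w hw => ?_⟩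
    · rw [hW 1 (by omega), hP.w1]
    · rw [hW 2 (by omega), hP.w2]
    · rw [hW 3 (by omega), hP.w3]
    · rw [hW 4 (by omega), hP.w4]
    · rw [hW 8 (by omega), hP.w8]
    · rw [hW 13 (by omega), hP.w13]
    · rw [hR 0 (by omega), hP.r0]
    · rw [hR _ (by omega), hP.r1]
    · rcases Nat.lt_succ_iff_lt_or_eq.1 hm with hm | rfl
      · have hi : d * m + i < d * n := by
          calc d * m + i < d * m + d := by omega
            _ = d * (m + 1) := by ring
            _ ≤ d * n := by gcongr; omega
        rw [hR _ (by omega), hP.pts m hm]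
      · rw [hτR i i.2]
        exact showPoint_apply _ _ _
    · have := (rootKey_le d _).trans hw
      simp only [rootKey] at this
      rw [hW w (by omega), hP.table w hw]
  have h5τ : τ.W 5 = (n + 1 : ℕ) := by rw [hW 5 (by omega), h5]
  have h9τ : τ.W 9 = (pointBase d + d * n : ℕ) := by rw [hW 9 (by omega), h9]
  refine Halts.seq (halts_block (by simp only [BlockValid, Instr.Valid, and_true]; omega) ?_)
  set τ' := blockRun [.iadd 5 5 1, .imul 10 9 1] τ with hτ'
  have hW' : ∀ w, w ≠ 5 → w ≠ 10 → τ'.W w = τ.W w := by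
    intro w h5 h10
    simp only [hτ', blockRun, Instr.run, Function.update_of_ne h5, Function.update_of_ne h10]
  have h5' : τ'.W 5 = (n + 2 : ℕ) := by
    simp (disch := omega) only [hτ', blockRun, Instr.run, Function.update_self,
      Function.update_of_ne, h5τ, hPτ.w1]
    push_cast
    ring
  have h10' : τ'.W 10 = (pointBase d + d * n : ℕ) := by
    simp (disch := omega) only [hτ', blockRun, Instr.run, Function.update_self,
      Function.update_of_ne, h9τ, hPτ.w1, mul_one]
  have hP' : Prepared β z (Nat.log 2 (n + 1)) (n + 1) n τ' := by
    refine hPτ.congr (fun w hw => ?_) (fun w hw => ?_) (fun w hw => rfl)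
    · simp only [Finset.mem_insert, Finset.mem_singleton] at hw
      exact hW' w (by omega) (by omega)
    · exact hW' w (by omega) (by omega)
  have h9' : τ'.W 9 = (pointBase d + d * n : ℕ) := by rw [hW' 9 (by omega) (by omega), h9τ]
  -- The invariant of the recording loop: `j` points are in the table, and the integer cell `10`
  -- points to the next one. It starts at `j = n` in an ordinary round and at `j = 0` in a rebuild.
  let J : ℕ → Mem → Prop := fun j ρ => Prepared β z (Nat.log 2 (n + 2)) (n + 1) j ρ ∧
    ρ.W 5 = (n + 2 : ℕ) ∧ ρ.W 9 = (pointBase d + d * n : ℕ) ∧ ρ.W 10 = (pointBase d + d * j : ℕ)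
  have hk : n + 1 - recordCount n + recordCount n = n + 1 := by
    refine Nat.sub_add_cancel ?_
    rw [recordCount]
    split_ifs <;> omega
  refine Halts.seq (Halts.mono (c := 6) (Q := J (n + 1 - recordCount n)) ?_ le_rfl ?_)
  · have hl1 : 2 ^ Nat.log 2 (n + 1) ≤ n + 1 := Nat.pow_log_le_self 2 (by omega)
    have hl2 : n + 1 < 2 ^ (Nat.log 2 (n + 1) + 1) := Nat.lt_pow_succ_log_self (by omega) _
    refine Halts.ite (c := 5) (by simp only [Test.Valid]; omega) ?_ ?_
    · intro ht
      simp only [Test.Holds, hP'.w8, h5'] at ht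
      have hlog : Nat.log 2 (n + 2) = Nat.log 2 (n + 1) + 1 := by
        rw [Nat.log_eq_iff (by omega)]
        refine ⟨by exact_mod_cast ht, ?_⟩
        rw [pow_succ]
        omega
      have hrc : n + 1 - recordCount n = 0 := by
        rw [recordCount, if_neg (by omega), Nat.sub_self]
      rw [hrc]
      refine halts_block (by simp only [BlockValid, Instr.Valid, and_true]; omega) ?_
      refine ⟨?_, ?_, ?_, ?_⟩
      · rw [hlog]
        refine hP'.grow hz ?_ ?_ ?_ ?_ ?_ ?_ (fun w hw => ?_) rfl
        · simp (disch := omega) only [blockRun, Instr.run, Function.update_of_ne, hP'.w1]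
        · simp (disch := omega) only [blockRun, Instr.run, Function.update_of_ne,
            Function.update_self, hP'.w1]
        · simp (disch := omega) only [blockRun, Instr.run, Function.update_of_ne,
            Function.update_self, hP'.w1]
        · simp (disch := omega) only [blockRun, Instr.run, Function.update_of_ne,
            Function.update_self, hP'.w1, mul_one]
        · simp (disch := omega) only [blockRun, Instr.run, Function.update_of_ne,
            Function.update_self]
        · simp (disch := omega) only [blockRun, Instr.run, Function.update_of_ne, hP'.w13]
        · simp (disch := omega) only [blockRun, Instr.run, Function.update_of_ne]
      · simp (disch := omega) only [blockRun, Instr.run, Function.update_of_ne, h5']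
      · simp (disch := omega) only [blockRun, Instr.run, Function.update_of_ne, h9']
      · simp (disch := omega) only [blockRun, Instr.run, Function.update_self, mul_zero, add_zero]
    · intro ht
      simp only [Test.Holds, hP'.w8, h5', not_le] at ht
      have hlog : Nat.log 2 (n + 2) = Nat.log 2 (n + 1) := by
        rw [Nat.log_eq_iff (by omega)]
        exact ⟨by omega, by exact_mod_cast ht⟩
      have hrc : n + 1 - recordCount n = n := by
        rw [recordCount, if_pos hlog, Nat.add_sub_cancel]
      rw [hrc]
      refine (Halts.skip ⟨?_, h5', h9', h10'⟩).mono (by omega) (fun _ h => h)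
      rw [hlog]
      exact hP'
  · intro ρ hρ
    refine Halts.seq ((Halts.while_loop (by simp only [Test.Valid]; omega) J (n + 1) ?_ ?_
      (recordCount n) _ ρ hk hρ).mono le_rfl ?_)
    · rintro j μ hj ⟨hPμ, m5, m9, m10⟩
      have hjn : d * j ≤ d * n := by gcongr; omega
      refine ⟨by simp only [Test.Holds, m9, m10]; omega, ?_⟩
      refine Halts.seq ((halts_loadPoint d (by omega) (by omega) (by omega) hPμ.w1 m10).mono
        le_rfl ?_)
      rintro ν ⟨hνW, hνR, hνR'⟩
      have hPν : Prepared β z (Nat.log 2 (n + 2)) (n + 1) j ν := by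
        refine hPμ.congr (fun w hw => ?_) (fun w hw => ?_) (fun w hw => hνR' w (by omega))
        · simp only [Finset.mem_insert, Finset.mem_singleton] at hw
          rw [hνW, Function.update_of_ne (by omega)]
        · rw [hνW, Function.update_of_ne (by omega)]
      have hpt : ∀ i : Fin d, ν.R (1 + i) = z j i := fun i => by
        rw [hνR i i.2, hPμ.pts j hj]
      refine (halts_update (hz j) (hPν.ready hpt) hS).mono le_rfl ?_
      rintro κ ⟨g1, g2, g3⟩
      refine ⟨⟨?_, ?_, ?_, ?_, ?_, ?_, ?_, ?_, fun m hm i => ?_, fun w hw => ?_⟩, ?_, ?_, ?_⟩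
      · rw [g2 1 (by omega) (by simp), hPν.w1]
      · rw [g2 2 (by omega) (by simp), hPν.w2]
      · rw [g2 3 (by omega) (by simp), hPν.w3]
      · rw [g2 4 (by omega) (by simp), hPν.w4]
      · rw [g2 8 (by omega) (by simp), hPν.w8]
      · rw [g2 13 (by omega) (by simp), hPν.w13]
      · rw [g3 0 (by omega), hPν.r0]
      · rw [g3 _ (by omega), hPν.r1]
      · rw [g3 _ (by omega), hPν.pts m hm]
      · have := (rootKey_le d _).trans hw
        simp only [rootKey] at this
        rw [g1 w (by omega), hPν.table w hw, Finset.sum_range_succ]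
      · rw [g2 5 (by omega) (by simp), hνW, Function.update_of_ne (by omega), m5]
      · rw [g2 9 (by omega) (by simp), hνW, Function.update_of_ne (by omega), m9]
      · rw [g2 10 (by omega) (by simp), hνW, Function.update_self, mul_add, mul_one, add_assoc]
    · rintro μ ⟨-, -, m9, m10⟩
      simp only [Test.Holds, m9, m10, mul_add, mul_one]
      omega
    · rintro μ ⟨hPμ, m5, m9, m10⟩
      refine halts_block (by simp only [BlockValid, Instr.Valid, and_true]; omega) ⟨?_, ?_, ?_⟩
      · refine hPμ.congr (fun w hw => ?_) (fun w hw => ?_) (fun w hw => rfl)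
        · simp only [Finset.mem_insert, Finset.mem_singleton] at hw
          simp (disch := omega) only [blockRun, Instr.run, Function.update_of_ne]
        · simp (disch := omega) only [blockRun, Instr.run, Function.update_of_ne]
      · simp (disch := omega) only [blockRun, Instr.run, Function.update_of_ne, m5]
      · simp (disch := omega) only [blockRun, Instr.run, Function.update_self, m10, hPμ.w1, mul_one]

/-! ### Total running time and memory -/

lemma levelsCost_mono {cl cl' h h' : ℕ} (hcl : cl ≤ cl') (hh : h ≤ h') (k : ℕ) :
    levelsCost cl h k ≤ levelsCost cl' h' k := by
  induction k with
  | zero => exact hcl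
  | succ k ih =>
    simp only [levelsCost]
    gcongr

lemma levelsCost_le (cl h k : ℕ) : levelsCost cl h k ≤ (cl + 24 * k) * (h + 1) ^ k := by
  induction k with
  | zero => simp [levelsCost]
  | succ k ih =>
    have h1 : 1 ≤ (h + 1) ^ k := Nat.one_le_pow _ _ (by omega)
    calc levelsCost cl h (k + 1) ≤ 8 * (h + 1) + (h + 1) * (levelsCost cl h k + 16) := by
          simp only [levelsCost]; omega
      _ = (h + 1) * (levelsCost cl h k + 24 * 1) := by ring
      _ ≤ (h + 1) * ((cl + 24 * k) * (h + 1) ^ k + 24 * (h + 1) ^ k) := by gcongr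
      _ = _ := by ring

/-- A bound for the running time spent on one point. -/
def pointCost (d h : ℕ) : ℕ := levelsCost 8 h d + 6 * d + 40

/-- A bound for the memory used in the first `n` rounds. -/
def memoryBound (d n : ℕ) : ℕ := tableEnd d (Nat.log 2 (n + 1)) + pointBase d + d * n

/-- Amortisation with the potential `2 · 2^h`: a rebuild enters `2 ^ (h + 1) - 1` points, while the
potential rises by `2 ^ (h + 1)`. An ordinary round enters one point. -/
lemma two_pow_log_succ_add (n : ℕ) : 2 * 2 ^ Nat.log 2 (n + 1) + recordCount n ≤
    2 * 2 ^ Nat.log 2 (n + 2) + 1 := by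
  rw [recordCount]
  split_ifs with h
  · rw [h]
  · have hl1 : 2 ^ Nat.log 2 (n + 1) ≤ n + 1 := Nat.pow_log_le_self 2 (by omega)
    have hl2 : 2 ^ Nat.log 2 (n + 2) ≤ n + 2 := Nat.pow_log_le_self 2 (by omega)
    have hl3 : n + 1 < 2 ^ (Nat.log 2 (n + 1) + 1) := Nat.lt_pow_succ_log_self (by omega) _
    have hlt : Nat.log 2 (n + 1) + 1 ≤ Nat.log 2 (n + 2) :=
      lt_of_le_of_ne (Nat.log_mono_right (by omega)) (Ne.symm h)
    have h2 := Nat.pow_le_pow_right (n := 2) (by omega) hlt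
    rw [pow_succ] at h2 hl3
    omega

/-- In the time bound, `2n` pays for the decision and the overhead of each round and for one
recorded point per round, and `2 · 2^h` for the rebuilds. The memory bound is fixed by the final
round `N`, but the program does not know `N`. -/
lemma exists_applies (hd : 1 ≤ d) (β : ℝ) {X : ℕ → Pt d} (U : ℕ → ℝ) (hX : ∀ j, X j ∈ cube d)
    (N : ℕ) : ∀ n ≤ N, ∃ σ t, Applies (haarAlg d) (haarStrategy d β) β (memoryBound d N) X U n σ t ∧
      AfterRound β (sample (haarStrategy d β) X U) n σ ∧
      t ≤ (2 * n + 2 * 2 ^ Nat.log 2 (n + 1)) * pointCost d (Nat.log 2 (n + 1)) := by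
  have hp : pointBase d = 2 * d + 6 := rfl
  have hz : ∀ m, sample (haarStrategy d β) X U m ∈ cube d := fun m => hX _
  have hS : ∀ n ≤ N, tableEnd d (Nat.log 2 (n + 1)) ≤ memoryBound d N := by
    intro n hn
    have hl : Nat.log 2 (n + 1) ≤ Nat.log 2 (N + 1) := Nat.log_mono_right (by omega)
    have : tableEnd d (Nat.log 2 (n + 1)) ≤ tableEnd d (Nat.log 2 (N + 1)) := by
      rw [tableEnd, tableEnd]
      gcongr
      omega
    rw [memoryBound]
    omega
  intro n
  induction n with
  | zero =>
    intro h0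
    have := (lt_tableEnd d (Nat.log 2 (0 + 1))).trans_le (hS 0 h0)
    obtain ⟨σ, t, h1, h2, h3⟩ := halts_init (d := d) β (sample (haarStrategy d β) X U)
      (S := memoryBound d N) (by omega)
    refine ⟨σ, t, .init (by omega) h1, h3, ?_⟩
    simp only [pointCost, zero_add, Nat.log_one_right, pow_zero]
    omega
  | succ n ih =>
    intro hn
    obtain ⟨σ, t, h1, h2, h3⟩ := ih (by omega)
    obtain ⟨τ, t₁, g1, g2, g3, g4⟩ := halts_decide hd hz (hX (n + rejections _ X U n)) h2
      (hS n (by omega)) (U n)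
    have hmem : pointBase d + d * (n + 1) ≤ memoryBound d N := by
      have : d * (n + 1) ≤ d * N := by gcongr
      rw [memoryBound]
      omega
    obtain ⟨ρ, t₂, k1, k2, k3⟩ := halts_record hd hz g4 (hS (n + 1) hn) hmem
    refine ⟨ρ, _, .round h1 g1 ?_ k1, k3, ?_⟩
    · rw [g3, decision, thinned_fst]
      rfl
    · have hl : Nat.log 2 (n + 1) ≤ Nat.log 2 (n + 2) := Nat.log_mono_right (by omega)
      rw [show n + 1 + 1 = n + 2 from rfl]
      set H := Nat.log 2 (n + 2)
      set E := pointCost d H with hE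
      have hm1 := levelsCost_mono (le_refl 8) hl d
      have hm2 := levelsCost_mono (show 5 ≤ 8 by omega) (le_refl H) d
      have hEE : pointCost d (Nat.log 2 (n + 1)) ≤ E := by
        simp only [hE, pointCost]
        omega
      have hE1 : d + 1 + t₁ + (2 * d + 11 + d) ≤ E := by
        simp only [hE, pointCost]
        omega
      have hE2 : 2 * d + 5 + levelsCost 5 H d ≤ E := by
        simp only [hE, pointCost]
        omega
      have hr : 2 * 2 ^ Nat.log 2 (n + 1) + recordCount n ≤ 2 * 2 ^ H + 1 := two_pow_log_succ_add n
      have hr1 : 1 ≤ recordCount n := by rw [recordCount]; split_ifs <;> omega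
      calc t + (d + 1 + t₁) + (d + t₂)
          ≤ (2 * n + 2 * 2 ^ Nat.log 2 (n + 1)) * E + (d + 1 + t₁ + (2 * d + 11 + d)) +
            recordCount n * (2 * d + 5 + levelsCost 5 H d) := by
            have := h3.trans (Nat.mul_le_mul_left _ hEE)
            omega
        _ ≤ (2 * n + 2 * 2 ^ Nat.log 2 (n + 1)) * E + E + recordCount n * E := by gcongr
        _ = (2 * n + 2 * 2 ^ Nat.log 2 (n + 1) + 1 + recordCount n) * E := by ring
        _ ≤ (2 * (n + 1) + 2 * 2 ^ H) * E := by
            refine Nat.mul_le_mul_right _ ?_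
            omega

lemma log_succ_add_one_le {n : ℕ} (hn : 2 ≤ n) :
    (Nat.log 2 (n + 1) : ℝ) + 1 ≤ 3 * Real.logb 2 n := by
  have hn0 : (2 : ℝ) ≤ n := by exact_mod_cast hn
  have h1 : 1 ≤ Real.logb 2 n := by
    rw [Real.le_logb_iff_rpow_le (by norm_num) (by linarith), Real.rpow_one]
    exact hn0
  have h2 : (Nat.log 2 (n + 1) : ℝ) ≤ Real.logb 2 n + 1 := by
    have h3 : (2 : ℝ) ^ Nat.log 2 (n + 1) ≤ n * 2 := by
      have : 2 ^ Nat.log 2 (n + 1) ≤ n + 1 := Nat.pow_log_le_self 2 (by omega)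
      have h4 : ((2 ^ Nat.log 2 (n + 1) : ℕ) : ℝ) ≤ (n + 1 : ℕ) := by exact_mod_cast this
      push_cast at h4
      linarith
    have h5 : Real.logb 2 ((n : ℝ) * 2) = Real.logb 2 n + 1 := by
      rw [Real.logb_mul (by linarith) (by norm_num), Real.logb_self_eq_one (by norm_num)]
    rw [← h5, Real.le_logb_iff_rpow_le (by norm_num) (by linarith), Real.rpow_natCast]
    exact h3
  linarith

/-- As `2^h ≤ n + 1`, time and table size are both of order `n (h+1)^d`. The factor `3^d` comes from
`h + 1 ≤ 3 log n`, the factor `5` from `2n + 2(n + 1) ≤ 5n`; both use `n ≥ 2`. -/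
lemma applies_bounds (d : ℕ) {n : ℕ} (hn : 2 ≤ n) :
    (((2 * n + 2 * 2 ^ Nat.log 2 (n + 1)) * pointCost d (Nat.log 2 (n + 1)) : ℕ) : ℝ) ≤
      ((48 + 54 * d) * 3 ^ d * 5 : ℝ) * (n * Real.logb 2 n ^ d) ∧
    (memoryBound d n : ℝ) ≤ ((48 + 54 * d) * 3 ^ d * 5 : ℝ) * (n * Real.logb 2 n ^ d) := by
  set h := Nat.log 2 (n + 1) with hh
  have h2 : 2 ^ h ≤ n + 1 := Nat.pow_log_le_self 2 (by omega)
  have hpow : 1 ≤ (h + 1) ^ d := Nat.one_le_pow _ _ (by omega)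
  have hC : pointCost d h ≤ (48 + 54 * d) * (h + 1) ^ d := by
    have := levelsCost_le 8 h d
    calc pointCost d h ≤ (8 + 24 * d) * (h + 1) ^ d + (6 * d + 40) * 1 := by
          rw [pointCost]; omega
      _ ≤ (8 + 24 * d) * (h + 1) ^ d + (30 * d + 40) * (h + 1) ^ d := by gcongr; omega
      _ = _ := by ring
  have ht : (2 * n + 2 * 2 ^ h) * pointCost d h ≤ (48 + 54 * d) * 5 * (n * (h + 1) ^ d) := by
    calc _ ≤ (5 * n) * ((48 + 54 * d) * (h + 1) ^ d) := by gcongr; omega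
      _ = _ := by ring
  have hm : memoryBound d n ≤ (48 + 54 * d) * 5 * (n * (h + 1) ^ d) := by
    calc memoryBound d n ≤ (rootKey d + 1) * (h + 1) ^ d * (2 * n) + (d * 3 + 6) * n := by
          rw [memoryBound, tableEnd]
          have : (rootKey d + 1) * (h + 1) ^ d * 2 ^ h ≤ (rootKey d + 1) * (h + 1) ^ d * (2 * n) := by
            gcongr; omega
          simp only [pointBase]
          nlinarith
      _ = (21 + 9 * d) * (h + 1) ^ d * (2 * n) + (d * 3 + 6) * n * 1 := by
          simp only [rootKey]; ring
      _ ≤ (21 + 9 * d) * (h + 1) ^ d * (2 * n) + (d * 3 + 6) * n * (h + 1) ^ d := by gcongr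
      _ = (48 + 21 * d) * (n * (h + 1) ^ d) := by ring
      _ ≤ _ := by gcongr; omega
  have hlog := log_succ_add_one_le hn
  have hfin : (((48 + 54 * d) * 5 * (n * (h + 1) ^ d) : ℕ) : ℝ) ≤
      ((48 + 54 * d) * 3 ^ d * 5 : ℝ) * (n * Real.logb 2 n ^ d) := by
    push_cast
    calc ((48 : ℝ) + 54 * d) * 5 * (n * (h + 1) ^ d)
        ≤ (48 + 54 * d) * 5 * (n * (3 * Real.logb 2 n) ^ d) := by gcongr
      _ = _ := by rw [mul_pow]; ring
  exact ⟨le_trans (by exact_mod_cast ht) hfin, le_trans (by exact_mod_cast hm) hfin⟩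

theorem theorem2 (d : ℕ) (hd : 1 ≤ d) :
    -- the tail bound for the discrepancy
    (∀ β : ℝ, 0 < β → β ≤ 1 →
      IsThinningStrategy β (haarStrategy d β) ∧
      ∀ (Ω : Type*) [MeasurableSpace Ω] (P : Measure Ω) [IsProbabilityMeasure P]
        (X : ℕ → Ω → Pt d) (U : ℕ → Ω → ℝ),
        (∀ j, Measurable (X j)) → (∀ j, Measurable (U j)) →
        (∀ j, P.map (X j) = unifCube d) →
        (∀ j, P.map (U j) = volume.restrict (Set.Icc 0 1)) →
        iIndepFun X P → iIndepFun U P →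
        IndepFun (fun ω j => X j ω) (fun ω j => U j ω) P →
        ∀ n : ℕ, 2 ≤ n → ∀ Δ : ℝ, 0 < Δ →
          P.real {ω | β⁻¹ * Real.logb 2 n ^ (2 * d) * (Δ + 1000 + 100 * (d : ℝ) ^ 2 * Real.logb 2 n) ≤
              disc (sample (haarStrategy d β) (fun j => X j ω) (fun j => U j ω)) n} ≤
            (β ^ 2)⁻¹ * Real.exp (-(Δ / 50))) ∧
    -- the time and memory needed to apply the strategy
    (∃ (A : OnlineAlg) (C : ℝ), ∀ β : ℝ, 0 < β → β ≤ 1 →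
      ∀ (X : ℕ → Pt d) (U : ℕ → ℝ), (∀ j, X j ∈ cube d) → (∀ j, U j ∈ Set.Icc (0 : ℝ) 1) →
        ∀ n : ℕ, 2 ≤ n → ∃ (S t : ℕ) (σ : Mem),
          Applies A (haarStrategy d β) β S X U n σ t ∧
          (t : ℝ) ≤ C * (n * Real.logb 2 n ^ d) ∧
          (S : ℝ) ≤ C * (n * Real.logb 2 n ^ d)) := by
  refine ⟨fun β h0 h1 => ⟨isThinningStrategy_haarStrategy hd h0 h1, ?_⟩,
    haarAlg d, (48 + 54 * d) * 3 ^ d * 5, fun β _ _ X U hX _ n hn => ?_⟩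
  · intro Ω _ P _ X U hX hU hXl hUl hXi hUi hXU n hn Δ hΔ
    exact measureReal_disc_ge_le hd h0 h1 hX hU hXl hUl hXi hUi hXU hn hΔ
  · obtain ⟨σ, t, hA, -, ht⟩ := exists_applies hd β U hX n n le_rfl
    obtain ⟨h1, h2⟩ := applies_bounds d hn
    exact ⟨_, t, σ, hA, le_trans (by exact_mod_cast ht) h1, h2⟩
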